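/- Let $\mathbf k$ be an algebraically closed field of characteristic $0$. **The bicategories.** $\mathrm{Alg}_2^{fd}$ is the bicategory whose objects are the finite-dimensional semisimple $\mathbf k$-algebras, whose 1-morphisms $A\to B$ are the finite-dimensional $(A,B)$-bimodules, with composite $M\otimes_B N$ of ${}_AM_B$ and ${}_BN_C$ and identities ${}_AA_A$, and whose 2-morphisms are the bimodule maps. $\mathrm{KV}_{\mathbf k}$ is the strict 2-category whose objects are the Kapranov–Voevodsky vector spaces, that is, the $\mathbf k$-linear categories that are $\mathbf k$-linearly equivalent to $(\mathrm{Vect}^{fd}_{\mathbf k})^n$ for some $n\ge 0$, whose 1-morphisms are the exact $\mathbf k$-linear functors, and whose 2-morphisms are the natural transformations. For a bicategory $\mathcal A$ let $\mathcal A^{co}$ denote $\mathcal A$ with the 2-morphisms reversed. Composites of 1-morphisms are written in diagrammatic order. **Duality involutions.** Let $\mathcal A$ be a bicategory, $(-)^\circ:\mathcal A^{co}\to\mathcal A$ a pseudofunctor, $\mathfrak y:1_{\mathcal A}\Rightarrow(-)^{\circ\circ}$ a pseudonatural transformation with 2-cells $\mathfrak y_f: f\,\mathfrak y_b\cong\mathfrak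 y_a\,f^{\circ\circ}$ for $f:a\to b$, and $\zeta_x:\mathfrak y_{x^\circ}\cong(\mathfrak y_x)^\circ$, $x\in\mathcal A$, invertible 2-cells. These form a *weak duality involution* if * $\mathfrak y$ is part of a pseudonatural adjoint equivalence; * $\zeta$ is a modification, from the transformation with components $\mathfrak y_{x^\circ}$ to the one with components $(\mathfrak y_x)^\circ$; * for every $x$, the 2-cell $\mathfrak y_x\,\mathfrak y_{x^{\circ\circ}}\Rightarrow\mathfrak y_x\,(\mathfrak y_{x^\circ})^\circ$ given by $\zeta_{x^\circ}$ equals $\mathfrak y_{\mathfrak y_x}:\mathfrak y_x\,\mathfrak y_{x^{\circ\circ}}\Rightarrow\mathfrak y_x\,(\mathfrak y_x)^{\circ\circ}$ followed by $(\zeta_x)^\circ$. A weak duality involution is *strict* if $\mathcal A$ is a strict bicategory, $(-)^\circ$ is a strict functor, $x^{\circ\circ}=x$ and $\mathfrak y_x=1_x$ for all $x$, and all $\mathfrak y_f$ and $\zeta_x$ are identities. **Duality pseudofunctors.** Let $\mathcal A,\mathcal B$ be bicategories with weak duality involutions, both denoted $((-)^\circ,\mathfrak y,\zeta)$. A *duality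 pseudofunctor* structure on a pseudofunctor $F:\mathcal A\to\mathcal B$ consists of a pseudonatural transformation $\mathfrak i$, with components $\mathfrak i_x:(Fx)^\circ\to F(x^\circ)$ and 2-cells $\mathfrak i_f:(Ff)^\circ\,\mathfrak i_b\cong\mathfrak i_a\,F(f^\circ)$, that is part of a pseudonatural adjoint equivalence, and an invertible modification $\theta$ with components $$\theta_x:\ \mathfrak y_{Fx}\,(\mathfrak i_x)^\circ\,\mathfrak i_{x^\circ}\ \cong\ F(\mathfrak y_x),$$ such that for every $x$ the following two 2-cells $\mathfrak i_x\,\mathfrak y_{F(x^\circ)}\,(\mathfrak i_{x^\circ})^\circ\,\mathfrak i_{x^{\circ\circ}}\Rightarrow\mathfrak i_x\,F((\mathfrak y_x)^\circ)$ agree: the first is $\theta_{x^\circ}$ followed by $F(\zeta_x)$; the second is the composite $$\mathfrak i_x\mathfrak y_{F(x^\circ)}(\mathfrak i_{x^\circ})^\circ\mathfrak i_{x^{\circ\circ}}\Rightarrow\mathfrak y_{(Fx)^\circ}(\mathfrak i_x)^{\circ\circ}(\mathfrak i_{x^\circ})^\circ\mathfrak i_{x^{\circ\circ}}\Rightarrow(\mathfrak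 y_{Fx})^\circ(\mathfrak i_x)^{\circ\circ}(\mathfrak i_{x^\circ})^\circ\mathfrak i_{x^{\circ\circ}}\Rightarrow(F\mathfrak y_x)^\circ\,\mathfrak i_{x^{\circ\circ}}\Rightarrow\mathfrak i_xF((\mathfrak y_x)^\circ)$$ of $\mathfrak y_{\mathfrak i_x}$, $\zeta_{Fx}$, $(\theta_x^{-1})^\circ$ and $\mathfrak i_{\mathfrak y_x}$. **The data.** On $\mathrm{Alg}_2^{fd}$, let $A^\circ=A^{op}$; let $({}_AM_B)^\circ=\mathrm{hom}_B(M,B)$ (right $B$-module maps), regarded as an $(A^{op},B^{op})$-bimodule; and let $f^\circ=f^*$ be precomposition with $f$. The coherence isomorphisms are $1_A^\circ=\mathrm{hom}_A(A,A)\cong A^{op}$, $f\mapsto f(1)$, and $(M\otimes_BN)^\circ\cong M^\circ\otimes_{B^\circ}N^\circ$, the inverse of $f\otimes g\mapsto\big(m\otimes n\mapsto g(f(m)\,n)\big)$. Let $\mathfrak y_A={}_AA_A$, let $\mathfrak y_M$ be the composite $M\otimes_BB\cong M\cong M^{\circ\circ}\cong A\otimes_AM^{\circ\circ}$ whose middle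 map is $m\mapsto(f\mapsto f(m))$, and let $\zeta_A$ be the inverse of $(\mathfrak y_A)^\circ=\mathrm{hom}_A(A,A)\to A^{op}$, $f\mapsto f(1)$. On $\mathrm{KV}_{\mathbf k}$, let $(-)^{op}$ send categories, functors and natural transformations to their opposites, with $\mathfrak y$ and $\zeta$ identities. Let $\mathrm{Rep}:\mathrm{Alg}_2^{fd}\to\mathrm{KV}_{\mathbf k}$ be the pseudofunctor sending $A$ to the category of finite-dimensional right $A$-modules, ${}_AM_B$ to $(-)\otimes_AM$, and a bimodule map $g$ to $\mathrm{id}\otimes g$, with the canonical coherence isomorphisms. Let $\mathfrak i_A:\mathrm{Rep}(A)^{op}\to\mathrm{Rep}(A^\circ)$ be $V\mapsto V^\circ:=\mathrm{hom}_A(V,A)$, $f\mapsto f^*$. Let its naturality 2-cell at ${}_AM_B$ be the canonical isomorphism between $V^\circ\otimes_{A^\circ}M^\circ$ and $(V\otimes_AM)^\circ$, $f\otimes g\mapsto\big(v\otimes m\mapsto g(f(v)\,m)\big)$. Let $(\theta_A)_V:V^{\circ\circ}\cong V\cong V\otimes_AA$, where $V^{\circ\circ}\cong V$ is the inverse of $v\mapsto(f\mapsto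 f(v))$. **Theorem.** 1. $((-)^\circ,\mathfrak y,\zeta)$ is a weak duality involution on $\mathrm{Alg}_2^{fd}$. 2. $(-)^{op}$, with identity $\mathfrak y$ and $\zeta$, is a strict duality involution on $\mathrm{KV}_{\mathbf k}$. 3. With respect to these, $\mathrm{Rep}$ equipped with $\mathfrak i$ and $\theta$ is a duality pseudofunctor. 4. $\mathrm{Rep}$ is a biequivalence: every object of $\mathrm{KV}_{\mathbf k}$ is equivalent to some $\mathrm{Rep}(A)$, and $\mathrm{Rep}$ is an equivalence on each hom-category. -/

import Mathlib

open CategoryTheory Bicategory MulOpposite TensorProduct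
open scoped Pseudofunctor.StrongTrans

universe u

noncomputable section

/-! ### Tensor products over a noncommutative algebra -/

section Tens

variable {k : Type u} [Field k] {X R Y : Type u} [AddCommGroup X] [Module k X]
  [AddCommGroup R] [Module k R] [AddCommGroup Y] [Module k Y]

/-- The subspace of `X ⊗ Y` spanned by the elements `xa ⊗ y - x ⊗ ay`, where `ρ x a = xa` and
`l a y = ay` are a right and a left action. -/
def tensRel (ρ : X →ₗ[k] R →ₗ[k] X) (l : R →ₗ[k] Y →ₗ[k] Y) : Submodule k (X ⊗[k] Y) :=
  Submodule.span k {z | ∃ x a y, z = ρ x a ⊗ₜ[k] y - x ⊗ₜ[k] l a y}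

/-- The tensor product of a right module and a left module. -/
def Tens (ρ : X →ₗ[k] R →ₗ[k] X) (l : R →ₗ[k] Y →ₗ[k] Y) : Type u :=
  (X ⊗[k] Y) ⧸ tensRel ρ l

namespace Tens

variable (ρ : X →ₗ[k] R →ₗ[k] X) (l : R →ₗ[k] Y →ₗ[k] Y)

instance : AddCommGroup (Tens ρ l) := inferInstanceAs (AddCommGroup ((X ⊗[k] Y) ⧸ tensRel ρ l))
instance : Module k (Tens ρ l) := inferInstanceAs (Module k ((X ⊗[k] Y) ⧸ tensRel ρ l))
instance [Module.Finite k X] [Module.Finite k Y] : Module.Finite k (Tens ρ l) :=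
  inferInstanceAs (Module.Finite k ((X ⊗[k] Y) ⧸ tensRel ρ l))

/-- The class of `x ⊗ y`. -/
def mk : X →ₗ[k] Y →ₗ[k] Tens ρ l :=
  (TensorProduct.mk k X Y).compr₂ (Submodule.mkQ (tensRel ρ l))

variable {ρ l}

theorem mk_act (x : X) (a : R) (y : Y) : mk ρ l (ρ x a) y = mk ρ l x (l a y) :=
  (Submodule.Quotient.eq (tensRel ρ l)).2 (Submodule.subset_span ⟨x, a, y, rfl⟩)

variable {Z : Type u} [AddCommGroup Z] [Module k Z]

/-- The linear map out of the tensor product induced by a balanced bilinear map. -/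
def lift (f : X →ₗ[k] Y →ₗ[k] Z) (h : ∀ x a y, f (ρ x a) y = f x (l a y)) :
    Tens ρ l →ₗ[k] Z :=
  Submodule.liftQ (tensRel ρ l) (TensorProduct.lift f) (by
    refine Submodule.span_le.2 ?_
    rintro _ ⟨x, a, y, rfl⟩
    simp [h])

@[simp] theorem lift_mk (f : X →ₗ[k] Y →ₗ[k] Z) (h : ∀ x a y, f (ρ x a) y = f x (l a y))
    (x : X) (y : Y) : lift f h (mk ρ l x y) = f x y := by
  exact TensorProduct.lift.tmul x y

theorem ext {f g : Tens ρ l →ₗ[k] Z} (h : ∀ x y, f (mk ρ l x y) = g (mk ρ l x y)) : f = g := by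
  refine Submodule.linearMap_qext (p := tensRel ρ l) (f := f) (g := g) (TensorProduct.ext' ?_)
  exact h

theorem ext₂ {R' Y' : Type u} [AddCommGroup R'] [Module k R'] [AddCommGroup Y'] [Module k Y']
    {l' : R' →ₗ[k] Y' →ₗ[k] Y'} {ρ' : Tens ρ l →ₗ[k] R' →ₗ[k] Tens ρ l}
    {f g : Tens ρ' l' →ₗ[k] Z}
    (h : ∀ x y z, f (mk ρ' l' (mk ρ l x y) z) = g (mk ρ' l' (mk ρ l x y) z)) : f = g := by
  refine ext fun t z => ?_
  have : f ∘ₗ (mk ρ' l').flip z = g ∘ₗ (mk ρ' l').flip z := ext fun x y => h x y z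
  exact LinearMap.congr_fun this t

theorem ext₂' {R' Y' : Type u} [AddCommGroup R'] [Module k R'] [AddCommGroup Y'] [Module k Y']
    {ρ' : Y' →ₗ[k] R' →ₗ[k] Y'} {l' : R' →ₗ[k] Tens ρ l →ₗ[k] Tens ρ l}
    {f g : Tens ρ' l' →ₗ[k] Z}
    (h : ∀ z x y, f (mk ρ' l' z (mk ρ l x y)) = g (mk ρ' l' z (mk ρ l x y))) : f = g := by
  refine ext fun z t => ?_
  have : f ∘ₗ mk ρ' l' z = g ∘ₗ mk ρ' l' z := ext fun x y => h z x y
  exact LinearMap.congr_fun this t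

theorem induction {p : Tens ρ l → Prop} (t : Tens ρ l) (h0 : p 0)
    (hmk : ∀ x y, p (mk ρ l x y)) (hadd : ∀ s t, p s → p t → p (s + t)) : p t := by
  obtain ⟨t, rfl⟩ := Submodule.Quotient.mk_surjective (tensRel ρ l) t
  induction t using TensorProduct.induction_on with
  | zero => exact h0
  | tmul x y => exact hmk x y
  | add s t hs ht => exact hadd _ _ hs ht

/-- The right action on the tensor product induced by one on the second factor. -/
def ract {S : Type u} [AddCommGroup S] [Module k S] (β : Y →ₗ[k] S →ₗ[k] Y)
    (h : ∀ a y s, β (l a y) s = l a (β y s)) : Tens ρ l →ₗ[k] S →ₗ[k] Tens ρ l :=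
  lift (LinearMap.mk₂ k (fun x y => mk ρ l x ∘ₗ β y)
      (by intros; ext; simp) (by intros; ext; simp) (by intros; ext; simp) (by intros; ext; simp))
    (fun x a y => by ext s; simp [mk_act, h])

@[simp] theorem ract_mk {S : Type u} [AddCommGroup S] [Module k S] (β : Y →ₗ[k] S →ₗ[k] Y)
    (h : ∀ a y s, β (l a y) s = l a (β y s)) (x : X) (y : Y) (s : S) :
    ract (ρ := ρ) β h (mk ρ l x y) s = mk ρ l x (β y s) := by
  rw [ract, lift_mk]; rfl

/-- The left action on the tensor product induced by one on the first factor. -/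
def lact {S : Type u} [AddCommGroup S] [Module k S] (β : S →ₗ[k] X →ₗ[k] X)
    (h : ∀ s x a, ρ (β s x) a = β s (ρ x a)) : S →ₗ[k] Tens ρ l →ₗ[k] Tens ρ l :=
  (lift (LinearMap.mk₂ k (fun x y => (mk ρ l).flip y ∘ₗ β.flip x)
      (by intros; ext; simp) (by intros; ext; simp) (by intros; ext; simp) (by intros; ext; simp))
    (fun x a y => by ext s; simp [mk_act, ← h])).flip

@[simp] theorem lact_mk {S : Type u} [AddCommGroup S] [Module k S] (β : S →ₗ[k] X →ₗ[k] X)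
    (h : ∀ s x a, ρ (β s x) a = β s (ρ x a)) (s : S) (x : X) (y : Y) :
    lact (l := l) β h s (mk ρ l x y) = mk ρ l (β s x) y := by
  rw [lact, LinearMap.flip_apply, lift_mk]; rfl

theorem ract_lact {S T : Type u} [AddCommGroup S] [Module k S] [AddCommGroup T] [Module k T]
    (β : S →ₗ[k] X →ₗ[k] X) (h : ∀ s x a, ρ (β s x) a = β s (ρ x a)) (γ : Y →ₗ[k] T →ₗ[k] Y)
    (h' : ∀ a y s, γ (l a y) s = l a (γ y s)) (s : S) (t : T) (z : Tens ρ l) :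
    ract γ h' (lact β h s z) t = lact β h s (ract γ h' z t) := by
  induction z using induction with
  | h0 => simp
  | hmk v m => simp
  | hadd s t hs ht => simp [hs, ht]

end Tens

end Tens

/-! ### Algebras, right modules, bimodules -/

/-- A finite-dimensional semisimple `k`-algebra. -/
structure AlgFd (k : Type u) [Field k] where
  carrier : Type u
  [ring : Ring carrier]
  [algebra : Algebra k carrier]
  [finite : Module.Finite k carrier]
  [semisimple : IsSemisimpleRing carrier]

attribute [instance] AlgFd.ring AlgFd.algebra AlgFd.finite AlgFd.semisimple

section

variable {k : Type u} [Field k]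

instance : CoeSort (AlgFd k) (Type u) := ⟨AlgFd.carrier⟩

/-- The opposite algebra. -/
def AlgFd.op (A : AlgFd k) : AlgFd k := { carrier := A.carrierᵐᵒᵖ }

/-- A finite-dimensional right `A`-module; `act v a` is `v · a`. -/
structure RMod (A : AlgFd k) where
  carrier : Type u
  [addCommGroup : AddCommGroup carrier]
  [module : Module k carrier]
  [finite : Module.Finite k carrier]
  act : carrier →ₗ[k] A →ₗ[k] carrier
  act_one : ∀ v, act v 1 = v
  act_mul : ∀ v a b, act v (a * b) = act (act v a) b

attribute [instance] RMod.addCommGroup RMod.module RMod.finite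

instance (A : AlgFd k) : CoeSort (RMod A) (Type u) := ⟨RMod.carrier⟩

/-- A finite-dimensional `(A, B)`-bimodule, with the same action of `k` from both sides;
`lact a m` is `a · m`. -/
structure Bim (A B : AlgFd k) extends RMod B where
  lact : A →ₗ[k] carrier →ₗ[k] carrier
  one_lact : ∀ m, lact 1 m = m
  mul_lact : ∀ a a' m, lact (a * a') m = lact a (lact a' m)
  lact_act : ∀ a m b, act (lact a m) b = lact a (act m b)

instance (A B : AlgFd k) : CoeSort (Bim A B) (Type u) := ⟨fun M => M.carrier⟩

namespace RMod

variable {A B : AlgFd k}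

/-- The space `hom_A(V, W)` of right `A`-module maps. -/
def homs (V W : RMod A) : Submodule k (V →ₗ[k] W) where
  carrier := {f | ∀ v a, f (V.act v a) = W.act (f v) a}
  add_mem' hf hg v a := by simp [hf v a, hg v a]
  zero_mem' v a := by simp
  smul_mem' c f hf v a := by simp [hf v a]

instance : Category (RMod A) where
  Hom V W := homs V W
  id V := ⟨LinearMap.id, fun _ _ => rfl⟩
  comp f g := ⟨g.1 ∘ₗ f.1, fun v a => by simp [f.2 v a, g.2 _ a]⟩

/-- The underlying linear map of a morphism. -/
def lin {V W : RMod A} (f : V ⟶ W) : V →ₗ[k] W := f.1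

theorem lin_act {V W : RMod A} (f : V ⟶ W) (v : V) (a : A) :
    lin f (V.act v a) = W.act (lin f v) a := f.2 v a

/-- Constructor of morphisms. -/
def ofLin {V W : RMod A} (f : V →ₗ[k] W) (h : ∀ v a, f (V.act v a) = W.act (f v) a) : V ⟶ W :=
  ⟨f, h⟩

@[simp] theorem lin_ofLin {V W : RMod A} (f : V →ₗ[k] W) (h) : lin (ofLin (V := V) f h) = f := rfl
@[simp] theorem lin_id (V : RMod A) : lin (𝟙 V) = LinearMap.id := rfl
@[simp] theorem lin_comp {U V W : RMod A} (f : U ⟶ V) (g : V ⟶ W) :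
    lin (f ≫ g) = lin g ∘ₗ lin f := rfl

@[ext] theorem hom_ext {V W : RMod A} {f g : V ⟶ W} (h : lin f = lin g) : f = g := Subtype.ext h

instance : Preadditive (RMod A) where
  homGroup V W := inferInstanceAs (AddCommGroup (homs V W))
  add_comp _ _ _ _ _ _ := Subtype.ext (LinearMap.comp_add _ _ _)
  comp_add _ _ _ _ _ _ := Subtype.ext (LinearMap.add_comp _ _ _)

instance : Linear k (RMod A) where
  homModule V W := inferInstanceAs (Module k (homs V W))
  smul_comp _ _ _ _ _ _ := Subtype.ext (LinearMap.comp_smul _ _ _)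
  comp_smul _ _ _ _ _ _ := Subtype.ext (LinearMap.smul_comp _ _ _)

@[simp] theorem lin_add {V W : RMod A} (f g : V ⟶ W) : lin (f + g) = lin f + lin g := rfl
@[simp] theorem lin_smul {V W : RMod A} (c : k) (f : V ⟶ W) : lin (c • f) = c • lin f := rfl
@[simp] theorem lin_zero {V W : RMod A} : lin (0 : V ⟶ W) = 0 := rfl

/-- A bijective morphism is an isomorphism. -/
def isoOfBijective {V W : RMod A} (f : V ⟶ W) (h : Function.Bijective (lin f)) : V ≅ W where
  hom := f
  inv := ofLin (LinearEquiv.ofBijective (lin f) h).symm (fun w a => by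
    refine h.1 ?_
    rw [lin_act]
    simp [← LinearEquiv.ofBijective_apply (lin f) (hf := h)])
  hom_inv_id := by
    ext v
    exact (LinearEquiv.ofBijective (lin f) h).symm_apply_apply v
  inv_hom_id := by
    ext v
    exact (LinearEquiv.ofBijective (lin f) h).apply_symm_apply v

@[simp] theorem isoOfBijective_hom {V W : RMod A} (f : V ⟶ W) (h) :
    (isoOfBijective f h).hom = f := rfl

/-- `A` as a right module over itself. -/
def reg (A : AlgFd k) : RMod A where
  carrier := A
  act := LinearMap.mul k A
  act_one v := mul_one v
  act_mul v a b := (mul_assoc v a b).symm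

/-- The right module `V ⊗_A M`. -/
def tensor (V : RMod A) (M : Bim A B) : RMod B where
  carrier := Tens V.act M.lact
  act := Tens.ract M.act fun a m b => M.lact_act a m b
  act_one t := by
    induction t using Tens.induction with
    | h0 => simp
    | hmk v m => simp [M.act_one]
    | hadd s t hs ht => simp [hs, ht]
  act_mul t a b := by
    induction t using Tens.induction with
    | h0 => simp
    | hmk v m => simp [M.act_mul]
    | hadd s t hs ht => simp [hs, ht]

/-- The element `v ⊗ m` of `V ⊗_A M`. -/
def tmk (V : RMod A) (M : Bim A B) : V →ₗ[k] M →ₗ[k] V.tensor M := Tens.mk V.act M.lact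

theorem tmk_act (V : RMod A) (M : Bim A B) (v : V) (a : A) (m : M) :
    tmk V M (V.act v a) m = tmk V M v (M.lact a m) := Tens.mk_act v a m

@[simp] theorem tensor_act (V : RMod A) (M : Bim A B) (v : V) (m : M) (b : B) :
    (V.tensor M).act (tmk V M v m) b = tmk V M v (M.act m b) :=
  Tens.ract_mk M.act (fun a m b => M.lact_act a m b) v m b

theorem tensor_ext {V : RMod A} {M : Bim A B} {Z : Type u} [AddCommGroup Z] [Module k Z]
    {f g : V.tensor M →ₗ[k] Z} (h : ∀ v m, f (tmk V M v m) = g (tmk V M v m)) : f = g :=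
  Tens.ext h

theorem tensor_induction {V : RMod A} {M : Bim A B} {p : V.tensor M → Prop} (t : V.tensor M)
    (h0 : p 0) (hmk : ∀ v m, p (tmk V M v m)) (hadd : ∀ s t, p s → p t → p (s + t)) : p t :=
  Tens.induction t h0 hmk hadd

/-- The linear map out of `V ⊗_A M` induced by a balanced bilinear map. -/
def tlift {V : RMod A} {M : Bim A B} {Z : Type u} [AddCommGroup Z] [Module k Z]
    (f : V →ₗ[k] M →ₗ[k] Z) (h : ∀ v a m, f (V.act v a) m = f v (M.lact a m)) :
    V.tensor M →ₗ[k] Z := Tens.lift f h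

@[simp] theorem tlift_tmk {V : RMod A} {M : Bim A B} {Z : Type u} [AddCommGroup Z] [Module k Z]
    (f : V →ₗ[k] M →ₗ[k] Z) (h : ∀ v a m, f (V.act v a) m = f v (M.lact a m)) (v : V) (m : M) :
    tlift f h (tmk V M v m) = f v m := Tens.lift_mk f h v m

/-- A morphism out of `V ⊗_A M` given on pure tensors. -/
def thom {V : RMod A} {M : Bim A B} {W : RMod B}
    (f : V →ₗ[k] M →ₗ[k] W) (h : ∀ v a m, f (V.act v a) m = f v (M.lact a m))
    (h' : ∀ v m b, f v (M.act m b) = W.act (f v m) b) : V.tensor M ⟶ W :=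
  ofLin (tlift f h) fun t b => by
    induction t using tensor_induction with
    | h0 => simp
    | hmk v m => simp [h']
    | hadd s t hs ht => simp [hs, ht]

@[simp] theorem lin_thom_tmk {V : RMod A} {M : Bim A B} {W : RMod B}
    (f : V →ₗ[k] M →ₗ[k] W) (h) (h') (v : V) (m : M) :
    lin (thom (V := V) (M := M) f h h') (tmk V M v m) = f v m := tlift_tmk f h v m

@[ext 1100] theorem hom_ext_tensor {V : RMod A} {M : Bim A B} {W : RMod B} {f g : V.tensor M ⟶ W}
    (h : ∀ v m, lin f (tmk V M v m) = lin g (tmk V M v m)) : f = g :=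
  hom_ext (tensor_ext h)

end RMod

namespace Bim

variable {A B C D : AlgFd k}

/-- The space of bimodule maps. -/
def homs (M N : Bim A B) : Submodule k (M →ₗ[k] N) where
  carrier := {f | (∀ m b, f (M.act m b) = N.act (f m) b) ∧ ∀ a m, f (M.lact a m) = N.lact a (f m)}
  add_mem' hf hg := ⟨fun v a => by simp [hf.1 v a, hg.1 v a], fun v a => by simp [hf.2 v a, hg.2 v a]⟩
  zero_mem' := ⟨fun v a => by simp, fun v a => by simp⟩
  smul_mem' c f hf := ⟨fun v a => by simp [hf.1 v a], fun v a => by simp [hf.2 v a]⟩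

instance : Category (Bim A B) where
  Hom M N := homs M N
  id M := ⟨LinearMap.id, fun _ _ => rfl, fun _ _ => rfl⟩
  comp f g := ⟨g.1 ∘ₗ f.1, fun v a => by simp [f.2.1 v a, g.2.1 _ a],
    fun v a => by simp [f.2.2 v a, g.2.2 v]⟩

/-- The underlying linear map of an intertwiner. -/
def lin {M N : Bim A B} (f : M ⟶ N) : M →ₗ[k] N := f.1

theorem lin_act {M N : Bim A B} (f : M ⟶ N) (m : M) (b : B) :
    lin f (M.act m b) = N.act (lin f m) b := f.2.1 m b

theorem lin_lact {M N : Bim A B} (f : M ⟶ N) (a : A) (m : M) :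
    lin f (M.lact a m) = N.lact a (lin f m) := f.2.2 a m

/-- Constructor of intertwiners. -/
def ofLin {M N : Bim A B} (f : M →ₗ[k] N) (h : ∀ m b, f (M.act m b) = N.act (f m) b)
    (h' : ∀ a m, f (M.lact a m) = N.lact a (f m)) : M ⟶ N :=
  ⟨f, h, h'⟩

@[simp] theorem lin_ofLin {M N : Bim A B} (f : M →ₗ[k] N) (h) (h') :
    lin (ofLin (M := M) f h h') = f := rfl
@[simp] theorem lin_id (M : Bim A B) : lin (𝟙 M) = LinearMap.id := rfl
@[simp] theorem lin_comp {M N P : Bim A B} (f : M ⟶ N) (g : N ⟶ P) :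
    lin (f ≫ g) = lin g ∘ₗ lin f := rfl

@[ext] theorem hom_ext {M N : Bim A B} {f g : M ⟶ N} (h : lin f = lin g) : f = g := Subtype.ext h

/-- The right module map underlying an intertwiner. -/
def toR {M N : Bim A B} (f : M ⟶ N) : M.toRMod ⟶ N.toRMod := RMod.ofLin (lin f) (lin_act f)

/-- An intertwiner whose underlying right module map is invertible is invertible. -/
def isoOfR {M N : Bim A B} (e : M.toRMod ≅ N.toRMod)
    (h : ∀ a m, RMod.lin e.hom (M.lact a m) = N.lact a (RMod.lin e.hom m)) : M ≅ N where
  hom := ofLin (RMod.lin e.hom) (RMod.lin_act e.hom) h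
  inv := ofLin (RMod.lin e.inv) (RMod.lin_act e.inv) fun a n => by
    have h1 : ∀ n, RMod.lin e.hom (RMod.lin e.inv n) = n := fun n =>
      LinearMap.congr_fun (congrArg RMod.lin e.inv_hom_id) n
    have h2 : ∀ n, RMod.lin e.inv (RMod.lin e.hom n) = n := fun n =>
      LinearMap.congr_fun (congrArg RMod.lin e.hom_inv_id) n
    conv_lhs => rw [← h1 n, ← h, h2]
  hom_inv_id := hom_ext (congrArg RMod.lin e.hom_inv_id)
  inv_hom_id := hom_ext (congrArg RMod.lin e.inv_hom_id)

theorem tensor_one_lact (M : Bim A B) (N : Bim B C) (t : Tens M.act N.lact) :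
    Tens.lact M.lact (fun a m b => M.lact_act a m b) 1 t = t := by
  induction t using Tens.induction with
  | h0 => simp
  | hmk v m => simp [M.one_lact]
  | hadd s t hs ht => simp [hs, ht]

theorem tensor_mul_lact (M : Bim A B) (N : Bim B C) (a a' : A) (t : Tens M.act N.lact) :
    Tens.lact M.lact (fun a m b => M.lact_act a m b) (a * a') t =
      Tens.lact M.lact (fun a m b => M.lact_act a m b) a
        (Tens.lact M.lact (fun a m b => M.lact_act a m b) a' t) := by
  induction t using Tens.induction with
  | h0 => simp
  | hmk v m => simp [M.mul_lact]
  | hadd s t hs ht => simp [hs, ht]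

/-- The bimodule `M ⊗_B N`. -/
def tensor (M : Bim A B) (N : Bim B C) : Bim A C where
  toRMod := M.toRMod.tensor N
  lact := Tens.lact M.lact fun a m b => M.lact_act a m b
  one_lact := tensor_one_lact M N
  mul_lact := tensor_mul_lact M N
  lact_act a t b := Tens.ract_lact M.lact (fun a m b => M.lact_act a m b) N.act
    (fun a m b => N.lact_act a m b) a b t

/-- The unit bimodule `A`. -/
def one (A : AlgFd k) : Bim A A where
  toRMod := RMod.reg A
  lact := LinearMap.mul k A
  one_lact v := one_mul (M := A) v
  mul_lact a b v := mul_assoc (G := A) a b v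
  lact_act a m b := mul_assoc (G := A) a m b

/-- The element `m ⊗ n` of `M ⊗_B N`. -/
def tmk (M : Bim A B) (N : Bim B C) : M →ₗ[k] N →ₗ[k] M.tensor N := RMod.tmk M.toRMod N

variable {M : Bim A B} {N : Bim B C}

theorem tmk_act (m : M) (b : B) (n : N) : tmk M N (M.act m b) n = tmk M N m (N.lact b n) :=
  RMod.tmk_act M.toRMod N m b n

@[simp] theorem tensor_act (m : M) (n : N) (c : C) :
    (M.tensor N).act (tmk M N m n) c = tmk M N m (N.act n c) := RMod.tensor_act M.toRMod N m n c

@[simp] theorem tensor_lact (a : A) (m : M) (n : N) :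
    (M.tensor N).lact a (tmk M N m n) = tmk M N (M.lact a m) n :=
  Tens.lact_mk M.lact (fun a m b => M.lact_act a m b) a m n

theorem tensor_induction {p : M.tensor N → Prop} (t : M.tensor N)
    (h0 : p 0) (hmk : ∀ v m, p (tmk M N v m)) (hadd : ∀ s t, p s → p t → p (s + t)) : p t :=
  Tens.induction t h0 hmk hadd

/-- An intertwiner out of `M ⊗_B N` given on pure tensors. -/
def thom {P : Bim A C} (f : M →ₗ[k] N →ₗ[k] P)
    (h : ∀ m b n, f (M.act m b) n = f m (N.lact b n))
    (h' : ∀ m n c, f m (N.act n c) = P.act (f m n) c)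
    (h'' : ∀ a m n, f (M.lact a m) n = P.lact a (f m n)) : M.tensor N ⟶ P :=
  ofLin (RMod.lin (RMod.thom (V := M.toRMod) (W := P.toRMod) f h h'))
    (RMod.lin_act (RMod.thom (V := M.toRMod) (W := P.toRMod) f h h')) fun a t => by
      induction t using tensor_induction with
      | h0 => simp
      | hmk m n =>
        rw [tensor_lact]
        exact (RMod.lin_thom_tmk f h h' _ _).trans ((h'' a m n).trans
          (congrArg (P.lact a) (RMod.lin_thom_tmk f h h' _ _).symm))
      | hadd s t hs ht => simp only [map_add, hs, ht]

@[simp] theorem lin_thom_tmk {P : Bim A C} (f : M →ₗ[k] N →ₗ[k] P) (h) (h') (h'') (m : M) (n : N) :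
    lin (thom (M := M) (N := N) f h h' h'') (tmk M N m n) = f m n :=
  RMod.lin_thom_tmk (V := M.toRMod) (W := P.toRMod) f h h' m n

theorem tensor_ext {Z : Type u} [AddCommGroup Z] [Module k Z] {f g : M.tensor N →ₗ[k] Z}
    (h : ∀ m n, f (tmk M N m n) = g (tmk M N m n)) : f = g := Tens.ext h

@[ext 1100] theorem hom_ext_tensor {P : Bim A C} {f g : M.tensor N ⟶ P}
    (h : ∀ m n, lin f (tmk M N m n) = lin g (tmk M N m n)) : f = g := hom_ext (tensor_ext h)

@[ext 1200] theorem hom_ext_tensor_left {P : Bim C D} {Q : Bim A D} {f g : (M.tensor N).tensor P ⟶ Q}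
    (h : ∀ m n p, lin f (tmk _ P (tmk M N m n) p) = lin g (tmk _ P (tmk M N m n) p)) : f = g :=
  hom_ext (Tens.ext₂ h)

@[ext 1200] theorem hom_ext_tensor_right {P : Bim D A} {Q : Bim D C} {f g : P.tensor (M.tensor N) ⟶ Q}
    (h : ∀ p m n, lin f (tmk P _ p (tmk M N m n)) = lin g (tmk P _ p (tmk M N m n))) : f = g :=
  hom_ext (Tens.ext₂' h)

/-- The linear map out of `M ⊗_B N` induced by a balanced bilinear map. -/
def tlift {Z : Type u} [AddCommGroup Z] [Module k Z]
    (f : M →ₗ[k] N →ₗ[k] Z) (h : ∀ m b n, f (M.act m b) n = f m (N.lact b n)) :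
    M.tensor N →ₗ[k] Z := Tens.lift f h

@[simp] theorem tlift_tmk {Z : Type u} [AddCommGroup Z] [Module k Z]
    (f : M →ₗ[k] N →ₗ[k] Z) (h : ∀ m b n, f (M.act m b) n = f m (N.lact b n)) (m : M) (n : N) :
    tlift f h (tmk M N m n) = f m n := Tens.lift_mk f h m n

@[simp] theorem lin_toR {M N : Bim A B} (f : M ⟶ N) : RMod.lin (toR f) = lin f := rfl

end Bim

namespace RMod

variable {A B C D : AlgFd k}

@[ext 1200] theorem hom_ext_tensor_left {V : RMod A} {M : Bim A B} {P : Bim B C} {Q : RMod C}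
    {f g : (V.tensor M).tensor P ⟶ Q}
    (h : ∀ v m p, lin f (tmk _ P (tmk V M v m) p) = lin g (tmk _ P (tmk V M v m) p)) : f = g :=
  hom_ext (Tens.ext₂ h)

@[ext 1200] theorem hom_ext_tensor_right {V : RMod A} {M : Bim A B} {P : Bim B C} {Q : RMod C}
    {f g : V.tensor (M.tensor P) ⟶ Q}
    (h : ∀ v m p, lin f (tmk V _ v (Bim.tmk M P m p)) = lin g (tmk V _ v (Bim.tmk M P m p))) :
    f = g :=
  hom_ext (Tens.ext₂' h)

/-- The tensor product `f ⊗ g` of a right module map and an intertwiner. -/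
def map {V W : RMod A} {M N : Bim A B} (f : V ⟶ W) (g : M ⟶ N) : V.tensor M ⟶ W.tensor N :=
  thom ((tmk W N).compl₁₂ (lin f) (Bim.lin g))
    (fun m b n => by simp [lin_act, Bim.lin_lact, tmk_act])
    (fun m n c => by simp [Bim.lin_act])

@[simp] theorem map_tmk {V W : RMod A} {M N : Bim A B} (f : V ⟶ W) (g : M ⟶ N) (v : V) (m : M) :
    lin (map f g) (tmk V M v m) = tmk W N (lin f v) (Bim.lin g m) := by
  simp [map]

/-- The linear map `(v ⊗ m) ⊗ n ↦ f v m n` out of a triple tensor product. -/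
def assocAux (V : RMod A) (M : Bim A B) (N : Bim B C) :
    V.tensor M →ₗ[k] N →ₗ[k] V.tensor (M.tensor N) :=
  tlift (LinearMap.mk₂ k (fun v m => (tmk V (M.tensor N) v) ∘ₗ (Bim.tmk M N m))
      (by intros; ext; simp) (by intros; ext; simp) (by intros; ext; simp) (by intros; ext; simp))
    (fun m b n => by ext p; simp [tmk_act])

@[simp] theorem assocAux_tmk (V : RMod A) (M : Bim A B) (N : Bim B C) (v : V) (m : M) (n : N) :
    assocAux V M N (tmk V M v m) n = tmk V (M.tensor N) v (Bim.tmk M N m n) := by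
  rw [assocAux, tlift_tmk]; rfl

/-- The linear map `m ⊗ n ↦ (v ⊗ m) ⊗ n`. -/
def assocAux' (V : RMod A) (M : Bim A B) (N : Bim B C) :
    V →ₗ[k] M.tensor N →ₗ[k] (V.tensor M).tensor N :=
  (Bim.tlift (LinearMap.mk₂ k (fun m n => ((tmk (V.tensor M) N).flip n) ∘ₗ ((tmk V M).flip m))
      (by intros; ext; simp) (by intros; ext; simp) (by intros; ext; simp) (by intros; ext; simp))
    (fun m b n => by ext p; simp [← tmk_act])).flip

@[simp] theorem assocAux'_tmk (V : RMod A) (M : Bim A B) (N : Bim B C) (v : V) (m : M) (n : N) :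
    assocAux' V M N v (Bim.tmk M N m n) = tmk (V.tensor M) N (tmk V M v m) n := by
  rw [assocAux', LinearMap.flip_apply, Bim.tlift_tmk]; rfl

/-- The canonical isomorphism `(V ⊗ M) ⊗ N ≅ V ⊗ (M ⊗ N)`, `(v ⊗ m) ⊗ n ↦ v ⊗ (m ⊗ n)`. -/
def assoc (V : RMod A) (M : Bim A B) (N : Bim B C) :
    (V.tensor M).tensor N ≅ V.tensor (M.tensor N) where
  hom := thom (assocAux V M N)
    (fun t b n => by
      induction t using tensor_induction with
      | h0 => simp
      | hmk v m => simp [Bim.tmk_act]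
      | hadd s t hs ht => simp only [map_add, hs, ht, LinearMap.add_apply])
    (fun t n c => by
      induction t using tensor_induction with
      | h0 => simp
      | hmk v m => simp
      | hadd s t hs ht => simp only [map_add, hs, ht, LinearMap.add_apply])
  inv := thom (assocAux' V M N)
    (fun v a t => by
      induction t using Bim.tensor_induction with
      | h0 => simp
      | hmk m n => simp [tmk_act]
      | hadd s t hs ht => simp only [map_add, hs, ht])
    (fun v t c => by
      induction t using Bim.tensor_induction with
      | h0 => simp
      | hmk m n => simp
      | hadd s t hs ht => simp only [map_add, hs, ht, LinearMap.add_apply])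
  hom_inv_id := by ext; simp
  inv_hom_id := by ext; simp

@[simp] theorem assoc_hom_tmk (V : RMod A) (M : Bim A B) (N : Bim B C) (v : V) (m : M) (n : N) :
    lin (assoc V M N).hom (tmk _ N (tmk V M v m) n) = tmk V (M.tensor N) v (Bim.tmk M N m n) := by
  simp [assoc]

@[simp] theorem assoc_inv_tmk (V : RMod A) (M : Bim A B) (N : Bim B C) (v : V) (m : M) (n : N) :
    lin (assoc V M N).inv (tmk V (M.tensor N) v (Bim.tmk M N m n)) = tmk _ N (tmk V M v m) n := by
  simp [assoc]

/-- The element `a` of the unit bimodule. -/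
def el : A →ₗ[k] Bim.one A := LinearMap.id

theorem el_surj (x : Bim.one A) : ∃ a : A, el a = x := ⟨x, rfl⟩

@[simp] theorem el_act (a b : A) : (Bim.one A).act (el a) b = el (a * b) := rfl
@[simp] theorem el_lact (a b : A) : (Bim.one A).lact b (el a) = el (b * a) := rfl

/-- The bilinear map `(v, a) ↦ va` on the unit bimodule. -/
def actOne (V : RMod A) : V →ₗ[k] Bim.one A →ₗ[k] V := V.act

@[simp] theorem actOne_el (V : RMod A) (v : V) (a : A) : actOne V v (el a) = V.act v a := rfl

theorem tmk_el (V : RMod A) (v : V) (a : A) :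
    tmk V (Bim.one A) v (el a) = tmk V (Bim.one A) (V.act v a) (el 1) := by
  rw [tmk_act, el_lact, mul_one]

/-- The canonical isomorphism `V ⊗_A A ≅ V`, `v ⊗ a ↦ va`. -/
def tensorOne (V : RMod A) : V.tensor (Bim.one A) ≅ V where
  hom := thom (M := Bim.one A) (actOne V)
    (fun v a x => by obtain ⟨b, rfl⟩ := el_surj x; simp [V.act_mul])
    (fun v x b => by obtain ⟨a, rfl⟩ := el_surj x; simp [V.act_mul])
  inv := ofLin ((tmk V (Bim.one A)).flip (el 1)) (fun v a => by
    rw [LinearMap.flip_apply, LinearMap.flip_apply, tensor_act, el_act, one_mul, ← tmk_el])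
  hom_inv_id := by
    ext v x
    obtain ⟨a, rfl⟩ := el_surj x
    simp [← tmk_el]
  inv_hom_id := by
    ext v
    simp [V.act_one]

@[simp] theorem tensorOne_hom_tmk (V : RMod A) (v : V) (a : A) :
    lin (tensorOne V).hom (tmk V (Bim.one A) v (el a)) = V.act v a := by
  simp [tensorOne]

@[simp] theorem tensorOne_inv (V : RMod A) (v : V) :
    lin (tensorOne V).inv v = tmk V (Bim.one A) v (el 1) := rfl

end RMod

namespace Bim

open RMod (el el_surj el_act el_lact)

variable {A B C D : AlgFd k}

/-- The associator `(M ⊗ N) ⊗ P ≅ M ⊗ (N ⊗ P)`. -/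
def assoc (M : Bim A B) (N : Bim B C) (P : Bim C D) :
    (M.tensor N).tensor P ≅ M.tensor (N.tensor P) :=
  isoOfR (RMod.assoc M.toRMod N P) fun a t => by
    induction t using tensor_induction with
    | h0 => simp only [map_zero]
    | hadd s t hs ht => simp only [map_add, hs, ht]
    | hmk t p =>
      induction t using tensor_induction with
      | h0 => simp only [map_zero, LinearMap.zero_apply]
      | hadd s t hs ht => simp only [map_add, hs, ht, LinearMap.add_apply]
      | hmk m n =>
        rw [tensor_lact, tensor_lact]
        refine (RMod.assoc_hom_tmk M.toRMod N P _ n p).trans ?_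
        refine (tensor_lact (M := M) (N := N.tensor P) a m (tmk N P n p)).symm.trans ?_
        exact congrArg ((M.tensor (N.tensor P)).lact a) (RMod.assoc_hom_tmk M.toRMod N P _ n p).symm

@[simp] theorem assoc_hom_tmk (M : Bim A B) (N : Bim B C) (P : Bim C D) (m : M) (n : N) (p : P) :
    lin (assoc M N P).hom (tmk _ P (tmk M N m n) p) = tmk M (N.tensor P) m (tmk N P n p) :=
  RMod.assoc_hom_tmk M.toRMod N P m n p

@[simp] theorem assoc_inv_tmk (M : Bim A B) (N : Bim B C) (P : Bim C D) (m : M) (n : N) (p : P) :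
    lin (assoc M N P).inv (tmk M (N.tensor P) m (tmk N P n p)) = tmk _ P (tmk M N m n) p :=
  RMod.assoc_inv_tmk M.toRMod N P m n p

/-- The right unitor `M ⊗_B B ≅ M`, `m ⊗ b ↦ mb`. -/
def tensorOne (M : Bim A B) : M.tensor (one B) ≅ M :=
  isoOfR (RMod.tensorOne M.toRMod) fun a t => by
    induction t using tensor_induction with
    | h0 => simp only [map_zero]
    | hadd s t hs ht => simp only [map_add, hs, ht]
    | hmk m x =>
      obtain ⟨b, rfl⟩ := el_surj x
      rw [tensor_lact]
      refine (RMod.tensorOne_hom_tmk M.toRMod _ b).trans ((M.lact_act a m b).trans ?_)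
      exact congrArg (M.lact a) (RMod.tensorOne_hom_tmk M.toRMod _ b).symm

@[simp] theorem tensorOne_hom_tmk (M : Bim A B) (m : M) (b : B) :
    lin (tensorOne M).hom (tmk M (one B) m (el b)) = M.act m b :=
  RMod.tensorOne_hom_tmk M.toRMod m b

@[simp] theorem tensorOne_inv (M : Bim A B) (m : M) :
    lin (tensorOne M).inv m = tmk M (one B) m (el 1) := rfl

/-- The bilinear map `(a, m) ↦ am` on the unit bimodule. -/
def lactOne (M : Bim A B) : one A →ₗ[k] M →ₗ[k] M := M.lact

@[simp] theorem lactOne_el (M : Bim A B) (a : A) (m : M) : lactOne M (el a) m = M.lact a m := rfl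

theorem tmk_el (M : Bim A B) (a : A) (m : M) :
    tmk (one A) M (el a) m = tmk (one A) M (el 1) (M.lact a m) := by
  rw [← tmk_act, el_act, one_mul]

/-- The left unitor `A ⊗_A M ≅ M`, `a ⊗ m ↦ am`. -/
def oneTensor (M : Bim A B) : (one A).tensor M ≅ M where
  hom := thom (M := one A) (lactOne M)
    (fun x a m => by obtain ⟨b, rfl⟩ := el_surj x; simp [M.mul_lact])
    (fun x m b => by obtain ⟨a, rfl⟩ := el_surj x; simp [M.lact_act])
    (fun a x m => by obtain ⟨b, rfl⟩ := el_surj x; simp [M.mul_lact])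
  inv := ofLin (tmk (one A) M (el 1)) (fun m b => by simp) (fun a m => by
    rw [← tmk_el, tensor_lact, el_lact, mul_one])
  hom_inv_id := by
    ext x m
    obtain ⟨a, rfl⟩ := el_surj x
    simp [← tmk_el]
  inv_hom_id := by
    ext m
    simp [M.one_lact]

@[simp] theorem oneTensor_hom_tmk (M : Bim A B) (a : A) (m : M) :
    lin (oneTensor M).hom (tmk (one A) M (el a) m) = M.lact a m := by
  simp [oneTensor]

@[simp] theorem oneTensor_inv (M : Bim A B) (m : M) :
    lin (oneTensor M).inv m = tmk (one A) M (el 1) m := rfl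

/-- The tensor product `f ⊗ g` of two intertwiners. -/
def map {M M' : Bim A B} {N N' : Bim B C} (f : M ⟶ M') (g : N ⟶ N') :
    M.tensor N ⟶ M'.tensor N' :=
  thom ((tmk M' N').compl₁₂ (lin f) (lin g))
    (fun m b n => by simp [lin_act, lin_lact, tmk_act])
    (fun m n c => by simp [lin_act])
    (fun a m n => by simp [lin_lact])

@[simp] theorem map_tmk {M M' : Bim A B} {N N' : Bim B C} (f : M ⟶ M') (g : N ⟶ N')
    (m : M) (n : N) : lin (map f g) (tmk M N m n) = tmk M' N' (lin f m) (lin g n) := by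
  simp [map]

end Bim

end

section

variable {k : Type u} [Field k]

namespace Bim

open RMod (el el_surj)

variable {A B C D E : AlgFd k}

theorem map_id (M : Bim A B) (N : Bim B C) : map (𝟙 M) (𝟙 N) = 𝟙 (M.tensor N) := by
  ext m n; simp

theorem map_comp {M M' M'' : Bim A B} {N N' N'' : Bim B C} (f : M ⟶ M') (f' : M' ⟶ M'')
    (g : N ⟶ N') (g' : N' ⟶ N'') : map (f ≫ f') (g ≫ g') = map f g ≫ map f' g' := by
  ext m n; simp

theorem assoc_naturality {M M' : Bim A B} {N N' : Bim B C} {P P' : Bim C D}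
    (f : M ⟶ M') (g : N ⟶ N') (h : P ⟶ P') :
    map (map f g) h ≫ (assoc M' N' P').hom = (assoc M N P).hom ≫ map f (map g h) := by
  ext m n p; simp

theorem oneTensor_naturality {M N : Bim A B} (f : M ⟶ N) :
    map (𝟙 (one A)) f ≫ (oneTensor N).hom = (oneTensor M).hom ≫ f := by
  ext x m; obtain ⟨a, rfl⟩ := el_surj x; simp [lin_lact]

theorem tensorOne_naturality {M N : Bim A B} (f : M ⟶ N) :
    map f (𝟙 (one B)) ≫ (tensorOne N).hom = (tensorOne M).hom ≫ f := by
  ext m x; obtain ⟨a, rfl⟩ := el_surj x; simp [lin_act]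

theorem pentagon (M : Bim A B) (N : Bim B C) (P : Bim C D) (Q : Bim D E) :
    map (assoc M N P).hom (𝟙 Q) ≫ (assoc M (N.tensor P) Q).hom ≫ map (𝟙 M) (assoc N P Q).hom =
      (assoc (M.tensor N) P Q).hom ≫ (assoc M N (P.tensor Q)).hom := by
  refine hom_ext (Tens.ext fun t q => ?_)
  have : (lin (map (assoc M N P).hom (𝟙 Q) ≫ (assoc M (N.tensor P) Q).hom ≫
        map (𝟙 M) (assoc N P Q).hom)) ∘ₗ (tmk _ Q).flip q =
      lin ((assoc (M.tensor N) P Q).hom ≫ (assoc M N (P.tensor Q)).hom) ∘ₗ (tmk _ Q).flip q :=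
    Tens.ext₂ fun m n p => by
      change (lin (map (assoc M N P).hom (𝟙 Q) ≫ (assoc M (N.tensor P) Q).hom ≫
        map (𝟙 M) (assoc N P Q).hom)) (tmk _ Q (tmk _ P (tmk M N m n) p) q) =
        lin ((assoc (M.tensor N) P Q).hom ≫ (assoc M N (P.tensor Q)).hom)
          (tmk _ Q (tmk _ P (tmk M N m n) p) q)
      simp
  exact LinearMap.congr_fun this t

theorem triangle (M : Bim A B) (N : Bim B C) :
    (assoc M (one B) N).hom ≫ map (𝟙 M) (oneTensor N).hom = map (tensorOne M).hom (𝟙 N) := by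
  ext m x n; obtain ⟨a, rfl⟩ := el_surj x; simp [tmk_act]

end Bim

instance : CategoryStruct (AlgFd k) where
  Hom A B := Bim A B
  id A := Bim.one A
  comp M N := M.tensor N

open Bim in
/-- The Morita bicategory of finite-dimensional semisimple algebras, bimodules and intertwiners;
the composite of `M : A ⟶ B` and `N : B ⟶ C` is `M ⊗_B N`. -/
instance : Bicategory (AlgFd k) where
  homCategory A B := inferInstanceAs (Category (Bim A B))
  whiskerLeft {A B C} (M : Bim A B) (N N' : Bim B C) (g : N ⟶ N') := Bim.map (𝟙 M) g
  whiskerRight {A B C} {M M' : Bim A B} (f : M ⟶ M') (N : Bim B C) := Bim.map f (𝟙 N)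
  associator M N P := Bim.assoc M N P
  leftUnitor M := Bim.oneTensor M
  rightUnitor M := Bim.tensorOne M
  whiskerLeft_id M N := Bim.map_id M N
  whiskerLeft_comp {A B C} (M : Bim A B) (N N' N'' : Bim B C) (f : N ⟶ N') (g : N' ⟶ N'') :=
    show Bim.map (𝟙 M) (f ≫ g) = Bim.map (𝟙 M) f ≫ Bim.map (𝟙 M) g by
      rw [← Bim.map_comp, Category.comp_id]
  id_whiskerLeft {A B} (M N : Bim A B) (f : M ⟶ N) :=
    show Bim.map (𝟙 (Bim.one A)) f = (oneTensor M).hom ≫ f ≫ (oneTensor N).inv by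
      rw [← Category.assoc, ← oneTensor_naturality]; simp
  comp_whiskerLeft {A B C D} (M : Bim A B) (N : Bim B C) (P P' : Bim C D) (f : P ⟶ P') :=
    show Bim.map (𝟙 (M.tensor N)) f =
        (assoc M N P).hom ≫ Bim.map (𝟙 M) (Bim.map (𝟙 N) f) ≫ (assoc M N P').inv by
      rw [← Category.assoc, ← assoc_naturality]; simp [Bim.map_id]
  id_whiskerRight M N := Bim.map_id M N
  comp_whiskerRight {A B C} {M M' M'' : Bim A B} (f : M ⟶ M') (g : M' ⟶ M'') (N : Bim B C) :=
    show Bim.map (f ≫ g) (𝟙 N) = Bim.map f (𝟙 N) ≫ Bim.map g (𝟙 N) by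
      rw [← Bim.map_comp, Category.comp_id]
  whiskerRight_id {A B} {M N : Bim A B} (f : M ⟶ N) :=
    show Bim.map f (𝟙 (Bim.one B)) = (tensorOne M).hom ≫ f ≫ (tensorOne N).inv by
      rw [← Category.assoc, ← tensorOne_naturality]; simp
  whiskerRight_comp {A B C D} {M M' : Bim A B} (f : M ⟶ M') (N : Bim B C) (P : Bim C D) :=
    show Bim.map f (𝟙 (N.tensor P)) =
        (assoc M N P).inv ≫ Bim.map (Bim.map f (𝟙 N)) (𝟙 P) ≫ (assoc M' N P).hom by
      rw [assoc_naturality]; simp [Bim.map_id]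
  whisker_assoc {A B C D} (M : Bim A B) (N N' : Bim B C) (f : N ⟶ N') (P : Bim C D) :=
    show Bim.map (Bim.map (𝟙 M) f) (𝟙 P) =
        (assoc M N P).hom ≫ Bim.map (𝟙 M) (Bim.map f (𝟙 P)) ≫ (assoc M N' P).inv by
      rw [← Category.assoc, ← assoc_naturality]; simp
  whisker_exchange {A B C} {M M' : Bim A B} {N N' : Bim B C} (f : M ⟶ M') (g : N ⟶ N') :=
    show Bim.map (𝟙 M) g ≫ Bim.map f (𝟙 N') = Bim.map f (𝟙 N) ≫ Bim.map (𝟙 M') g by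
      rw [← Bim.map_comp, ← Bim.map_comp]; simp
  pentagon M N P Q := Bim.pentagon M N P Q
  triangle M N := Bim.triangle M N

end

/-! ### Duality involutions and duality pseudofunctors -/

universe w v w₁ v₁ u₁ w₂ v₂ u₂

/-- The objects of the 2-cell dual of a bicategory. -/
structure Co (A : Type u) where
  of ::
  un : A

namespace Co

variable {A : Type u} [Bicategory.{w, v} A]

instance : CategoryStruct (Co A) where
  Hom X Y := (X.un ⟶ Y.un)ᵒᵖ
  id X := Opposite.op (𝟙 X.un)
  comp f g := Opposite.op (Opposite.unop f ≫ Opposite.unop g)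

/-- The 1-cell of `A` underlying a 1-cell of `Co A`. -/
def dn {X Y : Co A} (f : X ⟶ Y) : X.un ⟶ Y.un := Opposite.unop f

/-- The 1-cell of `Co A` given by a 1-cell of `A`. -/
def up {a b : A} (f : a ⟶ b) : of a ⟶ of b := Opposite.op f

instance (X Y : Co A) : Category (X ⟶ Y) :=
  inferInstanceAs (Category (X.un ⟶ Y.un)ᵒᵖ)

/-- The 2-cell of `A` underlying a 2-cell of `Co A`. -/
def dn₂ {X Y : Co A} {f g : X ⟶ Y} (η : f ⟶ g) : dn g ⟶ dn f := Quiver.Hom.unop η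

/-- The 2-cell of `Co A` given by a 2-cell of `A`. -/
def up₂ {X Y : Co A} {f g : X ⟶ Y} (η : dn g ⟶ dn f) : f ⟶ g := Quiver.Hom.op η

theorem ext₂ {X Y : Co A} {f g : X ⟶ Y} {η θ : f ⟶ g} (h : dn₂ η = dn₂ θ) : η = θ :=
  Quiver.Hom.unop_inj h

/-- An invertible 2-cell of `A` as an invertible 2-cell of `Co A`. -/
def upIso {X Y : Co A} {f g : X ⟶ Y} (η : dn f ≅ dn g) : f ≅ g where
  hom := up₂ η.inv
  inv := up₂ η.hom
  hom_inv_id := ext₂ η.hom_inv_id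
  inv_hom_id := ext₂ η.inv_hom_id

/-- The 2-cell dual: the hom-categories are replaced by their opposites. -/
instance : Bicategory (Co A) where
  homCategory _ _ := inferInstance
  whiskerLeft f _ _ η := up₂ (dn f ◁ dn₂ η)
  whiskerRight η h := up₂ (dn₂ η ▷ dn h)
  associator f g h := upIso (α_ (dn f) (dn g) (dn h))
  leftUnitor f := upIso (λ_ (dn f))
  rightUnitor f := upIso (ρ_ (dn f))
  whiskerLeft_id f g := ext₂ (whiskerLeft_id (dn f) (dn g))
  whiskerLeft_comp f _ _ _ η θ := ext₂ (whiskerLeft_comp (dn f) (dn₂ θ) (dn₂ η))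
  id_whiskerLeft η := ext₂ ((id_whiskerLeft (dn₂ η)).trans (Category.assoc _ _ _).symm)
  comp_whiskerLeft f g _ _ η := ext₂
    ((comp_whiskerLeft (dn f) (dn g) (dn₂ η)).trans (Category.assoc _ _ _).symm)
  id_whiskerRight f g := ext₂ (id_whiskerRight (dn f) (dn g))
  comp_whiskerRight η θ f := ext₂ (comp_whiskerRight (dn₂ θ) (dn₂ η) (dn f))
  whiskerRight_id η := ext₂ ((whiskerRight_id (dn₂ η)).trans (Category.assoc _ _ _).symm)
  whiskerRight_comp η g h := ext₂
    ((whiskerRight_comp (dn₂ η) (dn g) (dn h)).trans (Category.assoc _ _ _).symm)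
  whisker_assoc f _ _ η h := ext₂
    ((whisker_assoc (dn f) (dn₂ η) (dn h)).trans (Category.assoc _ _ _).symm)
  whisker_exchange η θ := ext₂ (whisker_exchange (dn₂ η) (dn₂ θ)).symm
  pentagon f g h i := ext₂
    ((Category.assoc _ _ _).trans (pentagon_inv (dn f) (dn g) (dn h) (dn i)))
  triangle f g := ext₂ (triangle_assoc_comp_left_inv (dn f) (dn g))

end Co

section

variable {A : Type u₁} [Bicategory.{w₁, v₁} A] {B : Type u₂} [Bicategory.{w₂, v₂} B]

open Co

theorem map₂_associator_inv' (F : A ⥤ᵖ B) {a b c d : A} (f : a ⟶ b) (g : b ⟶ c) (h : c ⟶ d) :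
    F.map₂ (α_ f g h).inv = ((((F.mapComp f (g ≫ h)).hom ≫ F.map f ◁ (F.mapComp g h).hom) ≫
      (α_ _ _ _).inv) ≫ (F.mapComp f g).inv ▷ F.map h) ≫ (F.mapComp (f ≫ g) h).inv := by
  rw [← cancel_epi (F.map₂ (α_ f g h).hom), ← F.map₂_comp, F.map₂_associator]
  simp

theorem map₂_left_unitor_inv' (F : A ⥤ᵖ B) {a b : A} (f : a ⟶ b) :
    F.map₂ (λ_ f).inv =
      ((λ_ _).inv ≫ (F.mapId a).inv ▷ F.map f) ≫ (F.mapComp (𝟙 a) f).inv := by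
  rw [← cancel_epi (F.map₂ (λ_ f).hom), ← F.map₂_comp, F.map₂_left_unitor]
  simp

theorem map₂_right_unitor_inv' (F : A ⥤ᵖ B) {a b : A} (f : a ⟶ b) :
    F.map₂ (ρ_ f).inv =
      ((ρ_ _).inv ≫ F.map f ◁ (F.mapId b).inv) ≫ (F.mapComp f (𝟙 b)).inv := by
  rw [← cancel_epi (F.map₂ (ρ_ f).hom), ← F.map₂_comp, F.map₂_right_unitor]
  simp

/-- The pseudofunctor `F^co : A^co ⥤ B^co` induced by `F : A ⥤ B`. -/
def coMap (F : A ⥤ᵖ B) : Co A ⥤ᵖ Co B where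
  obj X := of (F.obj X.un)
  map f := up (F.map (dn f))
  map₂ η := up₂ (F.map₂ (dn₂ η))
  mapId X := upIso (F.mapId X.un)
  mapComp f g := upIso (F.mapComp (dn f) (dn g))
  map₂_id f := ext₂ (F.map₂_id (dn f))
  map₂_comp η θ := ext₂ (F.map₂_comp (dn₂ θ) (dn₂ η))
  map₂_whisker_left f _ _ η := ext₂
    ((F.map₂_whisker_left (dn f) (dn₂ η)).trans (Category.assoc _ _ _).symm)
  map₂_whisker_right η f := ext₂
    ((F.map₂_whisker_right (dn₂ η) (dn f)).trans (Category.assoc _ _ _).symm)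
  map₂_associator f g h := ext₂ (map₂_associator_inv' F (dn f) (dn g) (dn h))
  map₂_left_unitor f := ext₂ (map₂_left_unitor_inv' F (dn f))
  map₂_right_unitor f := ext₂ (map₂_right_unitor_inv' F (dn f))

/-- The pseudofunctor `F^co : A ⥤ B^co` induced by `F : A^co ⥤ B`. -/
def coMap' (F : Co A ⥤ᵖ B) : A ⥤ᵖ Co B where
  obj a := of (F.obj (of a))
  map f := up (F.map (up f))
  map₂ η := up₂ (F.map₂ (up₂ η))
  mapId a := upIso (F.mapId (of a))
  mapComp f g := upIso (F.mapComp (up f) (up g))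
  map₂_id f := ext₂ (F.map₂_id (up f))
  map₂_comp η θ := ext₂ (F.map₂_comp (up₂ θ) (up₂ η))
  map₂_whisker_left f _ _ η := ext₂
    ((F.map₂_whisker_left (up f) (up₂ η)).trans (Category.assoc _ _ _).symm)
  map₂_whisker_right η f := ext₂
    ((F.map₂_whisker_right (up₂ η) (up f)).trans (Category.assoc _ _ _).symm)
  map₂_associator f g h := ext₂ (map₂_associator_inv' F (up f) (up g) (up h))
  map₂_left_unitor f := ext₂ (map₂_left_unitor_inv' F (up f))
  map₂_right_unitor f := ext₂ (map₂_right_unitor_inv' F (up f))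

end

section

variable (A : Type u₁) [Bicategory.{w₁, v₁} A]

open Co

/-- The data of a duality involution: a pseudofunctor `(-)° : A^co ⥤ A`, a pseudonatural
transformation `y : 1 ⟶ (-)°°` and invertible 2-cells `ζ x : y_{x°} ≅ (y_x)°`. -/
structure DualityData where
  dual : Co A ⥤ᵖ A
  y : Pseudofunctor.id A ⟶ (coMap' dual).comp dual
  ζ : ∀ x : A, y.app (dual.obj (of x)) ≅ dual.map (up (y.app x))

end

namespace DualityData

variable {A : Type u₁} [Bicategory.{w₁, v₁} A] (D : DualityData A)

open Co

/-- The dual `x°` of an object. -/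
def d (x : A) : A := D.dual.obj (of x)

/-- The dual `f° : x° ⟶ y°` of a 1-cell. -/
def d₁ {x y : A} (f : x ⟶ y) : D.d x ⟶ D.d y := D.dual.map (up f)

/-- The dual `η° : g° ⟶ f°` of a 2-cell `η : f ⟶ g`. -/
def d₂ {x y : A} {f g : x ⟶ y} (η : f ⟶ g) : D.d₁ g ⟶ D.d₁ f := D.dual.map₂ (up₂ η)

/-- The invertible 2-cell `(f ≫ g)° ≅ f° ≫ g°`. -/
def dComp {x y z : A} (f : x ⟶ y) (g : y ⟶ z) : D.d₁ (f ≫ g) ≅ D.d₁ f ≫ D.d₁ g :=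
  D.dual.mapComp (up f) (up g)

/-- The component `y_x : x ⟶ x°°`. -/
def yApp (x : A) : x ⟶ D.d (D.d x) := D.y.app x

/-- The 2-cell `f ≫ y_b ≅ y_a ≫ f°°` of the pseudonatural transformation `y`. -/
def yNat {a b : A} (f : a ⟶ b) : f ≫ D.yApp b ≅ D.yApp a ≫ D.d₁ (D.d₁ f) := D.y.naturality f

/-- The 2-cell `y_{x°} ≅ (y_x)°`. -/
def ζIso (x : A) : D.yApp (D.d x) ≅ D.d₁ (D.yApp x) := D.ζ x

/-- The dual of an invertible square `f ≫ q ≅ p ≫ g`, namely `f° ≫ q° ⟶ p° ≫ g°`. -/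
def dSquare {a b c e : A} {f : a ⟶ b} {q : b ⟶ e} {p : a ⟶ c} {g : c ⟶ e}
    (s : f ≫ q ≅ p ≫ g) : D.d₁ f ≫ D.d₁ q ⟶ D.d₁ p ≫ D.d₁ g :=
  (D.dComp f q).inv ≫ D.d₂ s.inv ≫ (D.dComp p g).hom

/-- A weak duality involution: `y` is part of an adjoint equivalence in the bicategory of
pseudofunctors, pseudonatural transformations and modifications, `ζ` is a modification from
`x ↦ y_{x°}` to `x ↦ (y_x)°`, and the two 2-cells `y_x ≫ y_{x°°} ⟶ y_x ≫ (y_{x°})°` given by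
`ζ_{x°}`, and by the naturality of `y` at `y_x` followed by `(ζ_x)°`, agree. -/
structure IsWeakDualityInvolution : Prop where
  y_equiv : ∃ e : Bicategory.Equivalence (Pseudofunctor.id A) ((coMap' D.dual).comp D.dual),
    e.hom = D.y
  ζ_natural : ∀ {a b : A} (f : a ⟶ b),
    D.d₁ f ◁ (D.ζIso b).hom ≫ D.dSquare (D.yNat f) =
      (D.yNat (D.d₁ f)).hom ≫ (D.ζIso a).hom ▷ D.d₁ (D.d₁ (D.d₁ f))
  coherence : ∀ x : A,
    D.yApp x ◁ (D.ζIso (D.d x)).hom = (D.yNat (D.yApp x)).hom ≫ D.yApp x ◁ D.d₂ (D.ζIso x).hom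

/-- A strict duality involution, on a strict bicategory: the pseudofunctor `(-)°` is strict, the
double dual of an object is that object, `y` is the identity, that is, its components are identity
1-cells and its naturality 2-cells are identities, and the 2-cells `ζ x` are identities. -/
structure IsStrictDualityInvolution : Prop extends D.IsWeakDualityInvolution where
  strict : Bicategory.Strict A
  map_id : ∀ x : A, D.d₁ (𝟙 x) = 𝟙 (D.d x)
  mapId_eq : ∀ x : A, D.dual.mapId (of x) = eqToIso (map_id x)
  map_comp : ∀ {x y z : A} (f : x ⟶ y) (g : y ⟶ z), D.d₁ (f ≫ g) = D.d₁ f ≫ D.d₁ g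
  mapComp_eq : ∀ {x y z : A} (f : x ⟶ y) (g : y ⟶ z), D.dComp f g = eqToIso (map_comp f g)
  dual_dual : ∀ x : A, D.d (D.d x) = x
  y_eq_id : ∀ x : A, HEq (D.yApp x) (𝟙 x)
  y_naturality : ∀ {a b : A} (f : a ⟶ b), f ≫ D.yApp b = D.yApp a ≫ D.d₁ (D.d₁ f)
  yNat_eq : ∀ {a b : A} (f : a ⟶ b), D.yNat f = eqToIso (y_naturality f)
  y_dual : ∀ x : A, D.yApp (D.d x) = D.d₁ (D.yApp x)
  ζ_eq : ∀ x : A, D.ζIso x = eqToIso (y_dual x)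

end DualityData

section

open Co

variable {A : Type u₁} [Bicategory.{w₁, v₁} A] {B : Type u₂} [Bicategory.{w₂, v₂} B]

/-- The data of a duality pseudofunctor structure on `F : A ⥤ B`: a pseudonatural transformation
`i` with components `(F x)° ⟶ F (x°)` and invertible 2-cells
`θ x : y_{F x} ≫ (i_x)° ≫ i_{x°} ≅ F (y_x)`. -/
structure DualityFunctorData (D : DualityData A) (E : DualityData B) (F : A ⥤ᵖ B) where
  i : (coMap F).comp E.dual ⟶ D.dual.comp F
  θ : ∀ x : A, E.yApp (F.obj x) ≫ E.d₁ (i.app (of x)) ≫ i.app (of (D.d x)) ≅ F.map (D.yApp x)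

namespace DualityFunctorData

variable {D : DualityData A} {E : DualityData B} {F : A ⥤ᵖ B} (S : DualityFunctorData D E F)

/-- The component `i_x : (F x)° ⟶ F (x°)`. -/
def iApp (x : A) : E.d (F.obj x) ⟶ F.obj (D.d x) := S.i.app (of x)

/-- The 2-cell `(F f)° ≫ i_b ≅ i_a ≫ F (f°)`. -/
def iNat {a b : A} (f : a ⟶ b) :
    E.d₁ (F.map f) ≫ S.iApp b ≅ S.iApp a ≫ F.map (D.d₁ f) := S.i.naturality (up f)

/-- The 2-cell `θ_x`. -/
def θIso (x : A) :
    E.yApp (F.obj x) ≫ E.d₁ (S.iApp x) ≫ S.iApp (D.d x) ≅ F.map (D.yApp x) := S.θ x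

/-- The naturality 2-cell at `f` of the composite transformation
`x ↦ y_{F x} ≫ (i_x)° ≫ i_{x°}`. -/
def θSource {a b : A} (f : a ⟶ b) :
    F.map f ≫ E.yApp (F.obj b) ≫ E.d₁ (S.iApp b) ≫ S.iApp (D.d b) ⟶
      (E.yApp (F.obj a) ≫ E.d₁ (S.iApp a) ≫ S.iApp (D.d a)) ≫ F.map (D.d₁ (D.d₁ f)) :=
  (α_ _ _ _).inv ≫ (E.yNat (F.map f)).hom ▷ (E.d₁ (S.iApp b) ≫ S.iApp (D.d b)) ≫
    (α_ _ _ _).hom ≫ E.yApp (F.obj a) ◁ ((α_ _ _ _).inv ≫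
      E.dSquare (S.iNat f) ▷ S.iApp (D.d b) ≫ (α_ _ _ _).hom ≫
      E.d₁ (S.iApp a) ◁ (S.iNat (D.d₁ f)).hom ≫ (α_ _ _ _).inv) ≫ (α_ _ _ _).inv

/-- The naturality 2-cell at `f` of the transformation `x ↦ F (y_x)`. -/
def θTarget (D : DualityData A) (F : A ⥤ᵖ B) {a b : A} (f : a ⟶ b) :
    F.map f ≫ F.map (D.yApp b) ⟶ F.map (D.yApp a) ≫ F.map (D.d₁ (D.d₁ f)) :=
  (F.mapComp f (D.yApp b)).inv ≫ F.map₂ (D.yNat f).hom ≫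
    (F.mapComp (D.yApp a) (D.d₁ (D.d₁ f))).hom

/-- The 2-cell from `i_x ≫ y_{F(x°)} ≫ (i_{x°})° ≫ i_{x°°}` to `i_x ≫ F ((y_x)°)` obtained by
pasting the naturality of `y` at `i_x`, the 2-cell `ζ_{F x}`, the dual of `θ_x⁻¹` and the
naturality of `i` at `y_x`. -/
def pasting (x : A) :
    S.iApp x ≫ E.yApp (F.obj (D.d x)) ≫ E.d₁ (S.iApp (D.d x)) ≫ S.iApp (D.d (D.d x)) ⟶
      S.iApp x ≫ F.map (D.d₁ (D.yApp x)) :=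
  (α_ _ _ _).inv ≫
    ((E.yNat (S.iApp x)).hom ≫ (E.ζIso (F.obj x)).hom ▷ E.d₁ (E.d₁ (S.iApp x))) ▷
      (E.d₁ (S.iApp (D.d x)) ≫ S.iApp (D.d (D.d x))) ≫
    (α_ _ _ _).hom ≫ E.d₁ (E.yApp (F.obj x)) ◁ (α_ _ _ _).inv ≫ (α_ _ _ _).inv ≫
    (E.d₁ (E.yApp (F.obj x)) ◁ (E.dComp (E.d₁ (S.iApp x)) (S.iApp (D.d x))).inv ≫
      (E.dComp (E.yApp (F.obj x)) (E.d₁ (S.iApp x) ≫ S.iApp (D.d x))).inv ≫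
      E.d₂ (S.θIso x).inv) ▷ S.iApp (D.d (D.d x)) ≫
    (S.iNat (D.yApp x)).hom

/-- `F` with the data `S` is a duality pseudofunctor: `i` is part of an adjoint equivalence,
`θ` is a modification, and `θ_{x°}` followed by `F (ζ_x)` is the pasting composite above. -/
structure IsDualityPseudofunctor : Prop where
  i_equiv : ∃ e : Bicategory.Equivalence ((coMap F).comp E.dual) (D.dual.comp F), e.hom = S.i
  θ_natural : ∀ {a b : A} (f : a ⟶ b),
    F.map f ◁ (S.θIso b).hom ≫ θTarget D F f =
      S.θSource f ≫ (S.θIso a).hom ▷ F.map (D.d₁ (D.d₁ f))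
  coherence : ∀ x : A,
    S.iApp x ◁ ((S.θIso (D.d x)).hom ≫ F.map₂ (D.ζIso x).hom) = S.pasting x

end DualityFunctorData

/-- A biequivalence: essentially surjective on objects up to equivalence, and an equivalence on
each hom-category. -/
structure IsBiequivalence (F : A ⥤ᵖ B) : Prop where
  essSurj : ∀ b : B, ∃ a : A, Nonempty (Bicategory.Equivalence (F.obj a) b)
  locallyEquiv : ∀ a a' : A, (F.mapFunctor a a').IsEquivalence

end

section

variable {k : Type u} [Field k]

/-! ### Kapranov-Voevodsky vector spaces -/

section KV

open Limits

variable (k)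

/-- The category of finite-dimensional vector spaces, to the power `n`. -/
abbrev VectPow (n : ℕ) : Type (u + 1) := Fin n → FGModuleCat.{u} k

instance (n : ℕ) : Preadditive (VectPow k n) where
  homGroup V W := inferInstanceAs (AddCommGroup (∀ i, V i ⟶ W i))
  add_comp P Q R f f' g := funext fun i => Preadditive.add_comp (P i) (Q i) (R i) (f i) (f' i) (g i)
  comp_add P Q R f g g' := funext fun i => Preadditive.comp_add (P i) (Q i) (R i) (f i) (g i) (g' i)

instance (n : ℕ) : Linear k (VectPow k n) where
  homModule V W := inferInstanceAs (Module k (∀ i, V i ⟶ W i))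
  smul_comp P Q R c f g := funext fun i => Linear.smul_comp (P i) (Q i) (R i) c (f i) (g i)
  comp_smul P Q R f c g := funext fun i => Linear.comp_smul (P i) (Q i) (R i) (f i) c (g i)

/-- A `k`-linear category is a Kapranov-Voevodsky vector space if it is equivalent, as a linear
category, to `Vect^n` for some `n`; it is then abelian, finite and semisimple. -/
def IsKV (C : Type (u + 1)) [Category.{u} C] [Preadditive C] [Linear k C] : Prop :=
  ∃ (n : ℕ) (e : C ≌ VectPow k n), e.functor.Additive ∧ e.functor.Linear k

variable {k}

instance (n : ℕ) : HasFiniteLimits (VectPow k n) where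
  out _ _ _ := Adjunction.hasLimitsOfShape_of_equivalence
    (piEquivalenceFunctorDiscrete (Fin n) (FGModuleCat.{u} k)).functor

instance (n : ℕ) : HasFiniteColimits (VectPow k n) where
  out _ _ _ := Adjunction.hasColimitsOfShape_of_equivalence
    (piEquivalenceFunctorDiscrete (Fin n) (FGModuleCat.{u} k)).functor

theorem linearMap_regular {V W : Type u} [AddCommGroup V] [Module k V] [AddCommGroup W] [Module k W]
    (f : V →ₗ[k] W) : ∃ g : W →ₗ[k] V, f ∘ₗ g ∘ₗ f = f := by
  obtain ⟨s, hs⟩ := f.rangeRestrict.exists_rightInverse_of_surjective f.range_rangeRestrict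
  obtain ⟨r, hr⟩ := (LinearMap.range f).subtype.exists_leftInverse_of_injective
    (Submodule.ker_subtype _)
  refine ⟨s ∘ₗ r, LinearMap.ext fun v => ?_⟩
  have h1 := LinearMap.congr_fun hr (f.rangeRestrict v)
  have h2 := LinearMap.congr_fun hs (f.rangeRestrict v)
  change f (s (r (f v))) = f v
  change r (f v) = _ at h1
  rw [h1]
  exact congrArg Subtype.val h2

namespace IsKV

variable {C : Type (u + 1)} [Category.{u} C] [Preadditive C] [Linear k C]
  {D : Type (u + 1)} [Category.{u} D] [Preadditive D] [Linear k D]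

theorem hasFiniteLimits (hC : IsKV k C) : HasFiniteLimits C := by
  obtain ⟨n, e, -, -⟩ := hC
  exact ⟨fun J _ _ => Adjunction.hasLimitsOfShape_of_equivalence e.functor⟩

theorem hasFiniteColimits (hC : IsKV k C) : HasFiniteColimits C := by
  obtain ⟨n, e, -, -⟩ := hC
  exact ⟨fun J _ _ => Adjunction.hasColimitsOfShape_of_equivalence e.functor⟩

theorem hasZeroObject (hC : IsKV k C) : HasZeroObject C := by
  have := hC.hasFiniteLimits
  exact hasZeroObject_of_hasTerminal_object

theorem regular (hC : IsKV k C) {X Y : C} (f : X ⟶ Y) : ∃ g : Y ⟶ X, f ≫ g ≫ f = f := by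
  obtain ⟨n, e, -, -⟩ := hC
  choose g hg using fun i => linearMap_regular ((e.functor.map f) i).hom.hom
  obtain ⟨g', hg'⟩ := e.functor.map_surjective
    (X := Y) (Y := X) (fun i => ⟨ModuleCat.ofHom (g i)⟩ : e.functor.obj Y ⟶ e.functor.obj X)
  refine ⟨g', e.functor.map_injective ?_⟩
  rw [Functor.map_comp, Functor.map_comp, hg']
  funext i
  exact FGModuleCat.hom_ext (hg i)

/-- An additive functor between Kapranov-Voevodsky vector spaces preserves finite limits. -/
theorem preservesFiniteLimits (hC : IsKV k C) (hD : IsKV k D) (F : C ⥤ D) [F.Additive] :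
    PreservesFiniteLimits F := by
  have := hC.hasFiniteLimits
  have := hC.hasZeroObject
  have := HasBinaryBiproducts.of_hasBinaryProducts (C := C)
  have := hD.hasZeroObject
  have : ∀ {X Y} (f : X ⟶ Y), PreservesLimit (parallelPair f 0) F := fun {X Y} f => by
    obtain ⟨g, hg⟩ := hC.regular f
    refine preservesLimit_of_preserves_limit_cone (kernelIsKernel f) ?_
    refine (isLimitMapConeForkEquiv' F (kernel.condition f)).symm ?_
    let r : X ⟶ kernel f := kernel.lift f (𝟙 X - f ≫ g) (by simp [hg])
    have hr : r ≫ kernel.ι f = 𝟙 X - f ≫ g := by simp [r]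
    refine KernelFork.IsLimit.ofι _ _ (fun h _ => h ≫ F.map r) (fun h w => ?_) (fun h w m hm => ?_)
    · rw [Category.assoc, ← F.map_comp, hr, F.map_sub, Preadditive.comp_sub, F.map_id, F.map_comp,
        reassoc_of% w]
      simp
    · rw [← hm, Category.assoc, ← F.map_comp]
      have : kernel.ι f ≫ r = 𝟙 _ := by
        rw [← cancel_mono (kernel.ι f), Category.assoc, hr]; simp
      rw [this]; simp
  exact F.preservesFiniteLimits_of_preservesKernels

/-- An additive functor between Kapranov-Voevodsky vector spaces preserves finite colimits. -/
theorem preservesFiniteColimits (hC : IsKV k C) (hD : IsKV k D) (F : C ⥤ D) [F.Additive] :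
    PreservesFiniteColimits F := by
  have := hC.hasFiniteColimits
  have := hC.hasZeroObject
  have := HasBinaryBiproducts.of_hasBinaryCoproducts (C := C)
  have := hD.hasZeroObject
  have : ∀ {X Y} (f : X ⟶ Y), PreservesColimit (parallelPair f 0) F := fun {X Y} f => by
    obtain ⟨g, hg⟩ := hC.regular f
    refine preservesColimit_of_preserves_colimit_cocone (cokernelIsCokernel f) ?_
    refine (isColimitMapCoconeCoforkEquiv' F (cokernel.condition f)).symm ?_
    let r : cokernel f ⟶ Y := cokernel.desc f (𝟙 Y - g ≫ f) (by simp [hg])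
    have hr : cokernel.π f ≫ r = 𝟙 Y - g ≫ f := by simp [r]
    refine CokernelCofork.IsColimit.ofπ _ _ (fun h _ => F.map r ≫ h) (fun h w => ?_)
      (fun h w m hm => ?_)
    · rw [← Category.assoc, ← F.map_comp, hr, F.map_sub, Preadditive.sub_comp, F.map_id, F.map_comp,
        Category.assoc, w]
      simp
    · rw [← hm, ← Category.assoc, ← F.map_comp]
      have : r ≫ cokernel.π f = 𝟙 _ := by
        rw [← cancel_epi (cokernel.π f), ← Category.assoc, hr]; simp
      rw [this]; simp
  exact F.preservesFiniteColimits_of_preservesCokernels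

end IsKV

/-- The opposite of a linear category is linear. -/
instance (C : Type (u + 1)) [Category.{u} C] [Preadditive C] [Linear k C] : Linear k Cᵒᵖ where
  homModule X Y :=
    { smul := fun c f => (c • f.unop).op
      one_smul := fun f => Quiver.Hom.unop_inj (one_smul k f.unop)
      mul_smul := fun a b f => Quiver.Hom.unop_inj (mul_smul a b f.unop)
      smul_zero := fun a => Quiver.Hom.unop_inj (smul_zero (A := Y.unop ⟶ X.unop) a)
      smul_add := fun a f g => Quiver.Hom.unop_inj (smul_add a f.unop g.unop)
      add_smul := fun a b f => Quiver.Hom.unop_inj (add_smul a b f.unop)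
      zero_smul := fun f => Quiver.Hom.unop_inj (zero_smul k f.unop) }
  smul_comp _ _ _ c f g := Quiver.Hom.unop_inj (Linear.comp_smul _ _ _ g.unop c f.unop)
  comp_smul _ _ _ f c g := Quiver.Hom.unop_inj (Linear.smul_comp _ _ _ c g.unop f.unop)

instance {C D : Type (u + 1)} [Category.{u} C] [Preadditive C] [Linear k C] [Category.{u} D]
    [Preadditive D] [Linear k D] (F : C ⥤ D) [F.Linear k] : F.op.Linear k where
  map_smul f c := Quiver.Hom.unop_inj (Functor.map_smul (F := F) c f.unop)

/-- The functor `(Vect^n)ᵒᵖ ⥤ Vect^n` taking dual spaces. -/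
def VectPow.dual (n : ℕ) : (VectPow k n)ᵒᵖ ⥤ VectPow k n where
  obj V i := FGModuleCat.of k (Module.Dual k (V.unop i))
  map f i := FGModuleCat.ofHom (f.unop i).hom.hom.dualMap

theorem VectPow.dual_map_apply {n : ℕ} {V W : (VectPow k n)ᵒᵖ} (f : V ⟶ W) (i : Fin n)
    (φ : Module.Dual k (V.unop i)) (w : W.unop i) :
    (show Module.Dual k (W.unop i) from ((VectPow.dual n).map f i).hom.hom φ) w =
      φ ((f.unop i).hom.hom w) := rfl

instance (n : ℕ) : (VectPow.dual (k := k) n).Additive where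
  map_add {V _ f g} := funext fun i => FGModuleCat.hom_ext <| LinearMap.ext fun φ =>
    LinearMap.ext fun w => map_add (show Module.Dual k (V.unop i) from φ)
      ((f.unop i).hom.hom w) ((g.unop i).hom.hom w)

instance (n : ℕ) : (VectPow.dual (k := k) n).Linear k where
  map_smul {V _} f c := funext fun i => FGModuleCat.hom_ext <| LinearMap.ext fun φ =>
    LinearMap.ext fun w => map_smul (show Module.Dual k (V.unop i) from φ) c
      ((f.unop i).hom.hom w)

instance (n : ℕ) : (VectPow.dual (k := k) n).Faithful where
  map_injective {V W f g} h := Quiver.Hom.unop_inj <| funext fun i => FGModuleCat.hom_ext <|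
    LinearMap.ext fun w => by
      rw [← sub_eq_zero, ← Module.forall_dual_apply_eq_zero_iff k]
      intro φ
      rw [map_sub, sub_eq_zero]
      have h' : ((VectPow.dual n).map f i).hom.hom φ = ((VectPow.dual n).map g i).hom.hom φ :=
        congrArg (fun t : (VectPow.dual n).obj V ⟶ (VectPow.dual n).obj W => (t i).hom.hom φ) h
      exact congrArg (fun t : Module.Dual k (W.unop i) => t w) h'

instance (n : ℕ) : (VectPow.dual (k := k) n).Full where
  map_surjective {V W} f := by
    let g : W.unop ⟶ V.unop := fun i => FGModuleCat.ofHom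
      ((Module.evalEquiv k (V.unop i)).symm.toLinearMap ∘ₗ
        (show Module.Dual k (V.unop i) →ₗ[k] Module.Dual k (W.unop i) from
          (f i).hom.hom).dualMap ∘ₗ Module.Dual.eval k (W.unop i))
    refine ⟨g.op, funext fun i => FGModuleCat.hom_ext <| LinearMap.ext fun φ =>
      LinearMap.ext fun w => ?_⟩
    let T : Module.Dual k (V.unop i) →ₗ[k] Module.Dual k (W.unop i) := (f i).hom.hom
    exact Module.apply_evalEquiv_symm_apply k (V.unop i) φ (T.dualMap (Module.Dual.eval k _ w))

instance (n : ℕ) : (VectPow.dual (k := k) n).EssSurj where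
  mem_essImage V := by
    refine ⟨Opposite.op fun i => FGModuleCat.of k (Module.Dual k (V i)), ⟨?_⟩⟩
    let e (i : Fin n) := (Module.evalEquiv k (V i)).symm.toFGModuleCatIso
    exact ⟨fun i => (e i).hom, fun i => (e i).inv, funext fun i => (e i).hom_inv_id,
      funext fun i => (e i).inv_hom_id⟩

theorem IsKV.op {C : Type (u + 1)} [Category.{u} C] [Preadditive C] [Linear k C] (hC : IsKV k C) :
    IsKV k Cᵒᵖ := by
  obtain ⟨n, e, h1, h2⟩ := hC
  have : (VectPow.dual (k := k) n).IsEquivalence := { }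
  refine ⟨n, e.op.trans (VectPow.dual n).asEquivalence, ?_, ?_⟩
  · exact inferInstanceAs ((e.functor.op ⋙ VectPow.dual n).Additive)
  · exact inferInstanceAs ((e.functor.op ⋙ VectPow.dual n).Linear k)

end KV

end

section

variable {k : Type u} [Field k]

section

open Limits

variable (k) in
/-- A Kapranov-Voevodsky vector space. -/
structure KV where
  carrier : Type (u + 1)
  [category : Category.{u} carrier]
  [preadditive : Preadditive carrier]
  [linear : Linear k carrier]
  isKV : IsKV k carrier

attribute [instance] KV.category KV.preadditive KV.linear

/-- A 1-morphism of Kapranov-Voevodsky vector spaces: an exact `k`-linear functor. -/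
structure KVHom (C D : KV k) where
  functor : C.carrier ⥤ D.carrier
  [additive : functor.Additive]
  [linear : functor.Linear k]
  finLim : PreservesFiniteLimits functor
  finColim : PreservesFiniteColimits functor

attribute [instance] KVHom.additive KVHom.linear

namespace KVHom

variable {C D E : KV k}

instance : Category (KVHom C D) where
  Hom F G := F.functor ⟶ G.functor
  id F := 𝟙 F.functor
  comp η θ := NatTrans.vcomp η θ

/-- The natural transformation underlying a 2-morphism. -/
def nt {F G : KVHom C D} (η : F ⟶ G) : F.functor ⟶ G.functor := η

/-- The 2-morphism given by a natural transformation. -/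
def ofNt {F G : KVHom C D} (η : F.functor ⟶ G.functor) : F ⟶ G := η

@[simp] theorem nt_ofNt {F G : KVHom C D} (η : F.functor ⟶ G.functor) :
    nt (ofNt η : F ⟶ G) = η := rfl
@[simp] theorem nt_id (F : KVHom C D) : nt (𝟙 F) = 𝟙 F.functor := rfl
@[simp] theorem nt_comp {F G H : KVHom C D} (η : F ⟶ G) (θ : G ⟶ H) :
    nt (η ≫ θ) = nt η ≫ nt θ := rfl

@[ext] theorem hom_ext {F G : KVHom C D} {η θ : F ⟶ G}
    (h : ∀ X, (nt η).app X = (nt θ).app X) : η = θ := NatTrans.ext (funext h)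

/-- A natural isomorphism as an invertible 2-morphism. -/
def ofNtIso {F G : KVHom C D} (η : F.functor ≅ G.functor) : F ≅ G where
  hom := ofNt η.hom
  inv := ofNt η.inv
  hom_inv_id := η.hom_inv_id
  inv_hom_id := η.inv_hom_id

/-- A linear functor as a 1-morphism; it is automatically exact. -/
def mk' (F : C.carrier ⥤ D.carrier) [F.Additive] [F.Linear k] : KVHom C D where
  functor := F
  finLim := C.isKV.preservesFiniteLimits D.isKV F
  finColim := C.isKV.preservesFiniteColimits D.isKV F

/-- The identity functor. -/
def id (C : KV k) : KVHom C C := mk' (𝟭 _)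

/-- The composite of two functors. -/
def comp (F : KVHom C D) (G : KVHom D E) : KVHom C E := mk' (F.functor ⋙ G.functor)

end KVHom

instance : CategoryStruct (KV k) where
  Hom C D := KVHom C D
  id C := KVHom.id C
  comp F G := F.comp G

/-- The 2-category of Kapranov-Voevodsky vector spaces. -/
instance : Bicategory (KV k) where
  homCategory C D := inferInstanceAs (Category (KVHom C D))
  whiskerLeft {C D E} (F : KVHom C D) (G H : KVHom D E) (η : G ⟶ H) :=
    (KVHom.ofNt (Functor.whiskerLeft F.functor (KVHom.nt η)) : F.comp G ⟶ F.comp H)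
  whiskerRight {C D E} {F G : KVHom C D} (η : F ⟶ G) (H : KVHom D E) :=
    (KVHom.ofNt (Functor.whiskerRight (KVHom.nt η) H.functor) : F.comp H ⟶ G.comp H)
  associator {C D E E'} (F : KVHom C D) (G : KVHom D E) (H : KVHom E E') :=
    (KVHom.ofNtIso (Functor.associator F.functor G.functor H.functor) :
      (F.comp G).comp H ≅ F.comp (G.comp H))
  leftUnitor {C D} (F : KVHom C D) :=
    (KVHom.ofNtIso (Functor.leftUnitor F.functor) : (KVHom.id C).comp F ≅ F)
  rightUnitor {C D} (F : KVHom C D) :=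
    (KVHom.ofNtIso (Functor.rightUnitor F.functor) : F.comp (KVHom.id D) ≅ F)
  whiskerLeft_id F G := rfl
  whiskerLeft_comp F G H I η θ := rfl
  id_whiskerLeft {C D} (F G : KVHom C D) (η : F ⟶ G) := KVHom.hom_ext fun X =>
    ((Category.id_comp _).trans (Category.comp_id _)).symm
  comp_whiskerLeft {C D E E'} F G H I η := KVHom.hom_ext fun X =>
    ((Category.id_comp _).trans (Category.comp_id _)).symm
  id_whiskerRight F G := KVHom.hom_ext fun X => G.functor.map_id _
  comp_whiskerRight {C D E} F G H η θ I := KVHom.hom_ext fun X => I.functor.map_comp _ _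
  whiskerRight_id {C D} F G η := KVHom.hom_ext fun X =>
    ((Category.id_comp _).trans (Category.comp_id _)).symm
  whiskerRight_comp F G H := KVHom.hom_ext fun X =>
    ((Category.id_comp _).trans (Category.comp_id _)).symm
  whisker_assoc F G H η I := KVHom.hom_ext fun X =>
    ((Category.id_comp _).trans (Category.comp_id _)).symm
  whisker_exchange η θ := KVHom.hom_ext fun X => ((KVHom.nt θ).naturality _).symm
  pentagon F G H I := KVHom.hom_ext fun X => by
    change I.functor.map (𝟙 _) ≫ 𝟙 _ ≫ 𝟙 _ = 𝟙 _ ≫ 𝟙 _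
    simp
  triangle F G := KVHom.hom_ext fun X => by
    change 𝟙 _ ≫ 𝟙 _ = G.functor.map (𝟙 _)
    simp

end

end

section

variable {k : Type u} [Field k]

/-- The opposite category of `C`, with the same type of objects, so that the opposite of the
opposite is `C` itself. -/
def Rev (C : Type (u + 1)) : Type (u + 1) := C

namespace Rev

variable (C : Type (u + 1)) [Category.{u} C]

instance : Category.{u} (Rev C) where
  Hom X Y := (show C from Y) ⟶ (show C from X)
  id X := 𝟙 (show C from X)
  comp f g := CategoryStruct.comp (obj := C) g f
  id_comp f := Category.comp_id (obj := C) f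
  comp_id f := Category.id_comp (obj := C) f
  assoc f g h := (Category.assoc (obj := C) h g f).symm

instance [Preadditive C] : Preadditive (Rev C) where
  homGroup X Y := inferInstanceAs (AddCommGroup ((show C from Y) ⟶ (show C from X)))
  add_comp X Y Z f f' g := Preadditive.comp_add (C := C) Z Y X g f f'
  comp_add X Y Z f g g' := Preadditive.add_comp (C := C) Z Y X g g' f

instance [Preadditive C] [Linear k C] : Linear k (Rev C) where
  homModule X Y := inferInstanceAs (Module k ((show C from Y) ⟶ (show C from X)))
  smul_comp X Y Z r f g := Linear.comp_smul (C := C) Z Y X g r f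
  comp_smul X Y Z f r g := Linear.smul_comp (C := C) Z Y X r g f

/-- The opposite of a functor. -/
def mapFun {C D : Type (u + 1)} [Category.{u} C] [Category.{u} D] (F : C ⥤ D) : Rev C ⥤ Rev D where
  obj X := F.obj X
  map f := F.map f
  map_id X := F.map_id X
  map_comp f g := F.map_comp g f

/-- The comparison with the other model of the opposite category. -/
def toOp : Rev C ⥤ Cᵒᵖ where
  obj X := Opposite.op X
  map f := Quiver.Hom.op f
  map_id _ := rfl
  map_comp _ _ := rfl

instance : (toOp C).IsEquivalence where
  faithful := ⟨fun h => Quiver.Hom.op_inj h⟩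
  full := ⟨fun f => ⟨f.unop, rfl⟩⟩
  essSurj := ⟨fun X => ⟨X.unop, ⟨Iso.refl X⟩⟩⟩

instance [Preadditive C] : (toOp C).Additive := ⟨rfl⟩

instance [Preadditive C] [Linear k C] : (toOp C).Linear k := ⟨fun _ _ => rfl⟩

theorem isKV [Preadditive C] [Linear k C] (hC : IsKV k C) : IsKV k (Rev C) := by
  obtain ⟨n, e, h1, h2⟩ := hC.op
  exact ⟨n, (toOp C).asEquivalence.trans e, inferInstanceAs (toOp C ⋙ e.functor).Additive,
    inferInstanceAs ((toOp C ⋙ e.functor).Linear k)⟩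

end Rev

namespace KV

open Co

/-- The opposite category. -/
def op (C : KV k) : KV k where
  carrier := Rev C.carrier
  isKV := Rev.isKV C.carrier C.isKV

theorem op_op (C : KV k) : C.op.op = C := rfl

/-- The opposite functor. -/
def opFun {C D : KV k} (F : KVHom C D) : C.op.carrier ⥤ D.op.carrier :=
  Rev.mapFun (C := C.carrier) (D := D.carrier) F.functor

instance {C D : KV k} (F : KVHom C D) : (opFun F).Additive where
  map_add {X Y _ _} := F.functor.map_add (X := show C.carrier from Y) (Y := show C.carrier from X)

instance {C D : KV k} (F : KVHom C D) : (opFun F).Linear k where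
  map_smul {X Y} f c := F.functor.map_smul (X := show C.carrier from Y)
    (Y := show C.carrier from X) c f

/-- The opposite of a 1-morphism. -/
def opMap {C D : KV k} (F : C ⟶ D) : C.op ⟶ D.op := KVHom.mk' (C := C.op) (D := D.op) (opFun F)

/-- The opposite natural transformation. -/
def opMap₂ {C D : KV k} {F G : C ⟶ D} (η : F ⟶ G) : opMap G ⟶ opMap F :=
  KVHom.ofNt (C := C.op) (D := D.op) (F := opMap G) (G := opMap F)

    { app := fun X => (KVHom.nt η).app X
      naturality := fun X Y f => ((KVHom.nt η).naturality (X := show C.carrier from Y)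
        (Y := show C.carrier from X) f).symm }

/-- A 2-morphism given by a natural family. -/
def homMk {C D : KV k} {F G : C ⟶ D} (a : ∀ X, (KVHom.functor F).obj X ⟶ (KVHom.functor G).obj X)
    (h : ∀ {X Y} (f : X ⟶ Y), (KVHom.functor F).map f ≫ a Y = a X ≫ (KVHom.functor G).map f) :
    F ⟶ G :=
  KVHom.ofNt (C := C) (D := D) (F := F) (G := G) { app := a, naturality := fun _ _ f => h f }

/-- The 2-isomorphism `1ᵒᵖ ≅ 1`, with identity components. -/
def opId (C : KV k) : opMap (𝟙 C) ≅ 𝟙 C.op where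
  hom := homMk (C := C.op) (D := C.op) (F := opMap (𝟙 C)) (G := 𝟙 C.op) (fun X => 𝟙 X)
    (fun _ => (Category.comp_id _).trans (Category.id_comp _).symm)
  inv := homMk (C := C.op) (D := C.op) (F := 𝟙 C.op) (G := opMap (𝟙 C)) (fun X => 𝟙 X)
    (fun _ => (Category.comp_id _).trans (Category.id_comp _).symm)
  hom_inv_id := KVHom.hom_ext fun _ => Category.id_comp _
  inv_hom_id := KVHom.hom_ext fun _ => Category.id_comp _

/-- The 2-isomorphism `(F ≫ G)ᵒᵖ ≅ Fᵒᵖ ≫ Gᵒᵖ`, with identity components. -/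
def opComp {C D E : KV k} (F : C ⟶ D) (G : D ⟶ E) : opMap (F ≫ G) ≅ opMap F ≫ opMap G where
  hom := homMk (C := C.op) (D := E.op) (F := opMap (F ≫ G)) (G := opMap F ≫ opMap G)
    (fun X => 𝟙 ((KVHom.functor (opMap (F ≫ G))).obj X))
    (fun _ => (Category.comp_id _).trans (Category.id_comp _).symm)
  inv := homMk (C := C.op) (D := E.op) (F := opMap F ≫ opMap G) (G := opMap (F ≫ G))
    (fun X => 𝟙 ((KVHom.functor (opMap (F ≫ G))).obj X))
    (fun _ => (Category.comp_id _).trans (Category.id_comp _).symm)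
  hom_inv_id := KVHom.hom_ext fun _ => Category.id_comp _
  inv_hom_id := KVHom.hom_ext fun _ => Category.id_comp _

variable (k) in
/-- The pseudofunctor `(-)ᵒᵖ` from the 2-cell dual. -/
def opFunctor : Co (KV k) ⥤ᵖ KV k where
  obj C := C.un.op
  map F := opMap (dn F)
  map₂ η := opMap₂ (dn₂ η)
  mapId C := opId C.un
  mapComp F G := opComp (dn F) (dn G)
  map₂_id F := rfl
  map₂_comp η θ := rfl
  map₂_whisker_left F G H η := KVHom.hom_ext fun X =>
    ((Category.id_comp _).trans (Category.comp_id _)).symm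
  map₂_whisker_right F G := KVHom.hom_ext fun X =>
    ((Category.id_comp _).trans (Category.comp_id _)).symm
  map₂_associator {A B C D} F G H := KVHom.hom_ext fun X => by
    refine ((Category.id_comp _).trans ?_).symm
    refine (congrArg (· ≫ _) ((KVHom.functor (opMap (dn H))).map_id _)).trans ?_
    refine (Category.id_comp _).trans ?_
    refine (Category.id_comp _).trans ?_
    exact (Category.id_comp _)
  map₂_left_unitor {A B} F := KVHom.hom_ext fun X => by
    refine ((Category.id_comp _).trans ?_).symm
    refine (congrArg (· ≫ _) ((KVHom.functor (opMap (dn F))).map_id _)).trans ?_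
    exact (Category.id_comp _)
  map₂_right_unitor {A B} F := KVHom.hom_ext fun X =>
    ((Category.id_comp _).trans (Category.id_comp _)).symm

/-- The identity functor of `C = Cᵒᵖᵒᵖ`. -/
def y (C : KV k) : C ⟶ C.op.op := 𝟙 C

/-- The 2-isomorphism `F ≫ y ≅ y ≫ Fᵒᵖᵒᵖ`, with identity components. -/
def yNat {C D : KV k} (F : C ⟶ D) : F ≫ y D ≅ y C ≫ opMap (opMap F) where
  hom := homMk (C := C) (D := D.op.op) (F := F ≫ y D) (G := y C ≫ opMap (opMap F))
    (fun X => 𝟙 ((KVHom.functor (F ≫ y D)).obj X))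
    (fun _ => (Category.comp_id _).trans (Category.id_comp _).symm)
  inv := homMk (C := C) (D := D.op.op) (F := y C ≫ opMap (opMap F)) (G := F ≫ y D)
    (fun X => 𝟙 ((KVHom.functor (F ≫ y D)).obj X))
    (fun _ => (Category.comp_id _).trans (Category.id_comp _).symm)
  hom_inv_id := KVHom.hom_ext fun _ => Category.id_comp _
  inv_hom_id := KVHom.hom_ext fun _ => Category.id_comp _

/-- The 2-isomorphism `y_{Cᵒᵖ} ≅ (y_C)ᵒᵖ`, with identity components. -/
def ζ (C : KV k) : y C.op ≅ opMap (y C) where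
  hom := homMk (C := C.op) (D := C.op.op.op) (F := y C.op) (G := opMap (y C))
    (fun X => 𝟙 ((KVHom.functor (y C.op)).obj X))
    (fun _ => (Category.comp_id _).trans (Category.id_comp _).symm)
  inv := homMk (C := C.op) (D := C.op.op.op) (F := opMap (y C)) (G := y C.op)
    (fun X => 𝟙 ((KVHom.functor (y C.op)).obj X))
    (fun _ => (Category.comp_id _).trans (Category.id_comp _).symm)
  hom_inv_id := KVHom.hom_ext fun _ => Category.id_comp _
  inv_hom_id := KVHom.hom_ext fun _ => Category.id_comp _

variable (k) in
/-- The identification of the double opposite with the identity, as a pseudonatural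
transformation. -/
def yTrans : Pseudofunctor.id (KV k) ⟶ (coMap' (opFunctor k)).comp (opFunctor k) where
  app C := y C
  naturality F := yNat F
  naturality_naturality {C D F G} η := KVHom.hom_ext fun X =>
    (Category.comp_id _).trans (Category.id_comp _).symm
  naturality_id C := KVHom.hom_ext fun X => by
    have h : ∀ Z : C.op.op.carrier, 𝟙 Z ≫ 𝟙 Z ≫ 𝟙 Z = 𝟙 Z ≫ 𝟙 Z ≫ 𝟙 Z := fun Z => rfl
    exact h X
  naturality_comp {C D E} F G := KVHom.hom_ext fun X => by
    have h : ∀ Z : E.op.op.carrier, 𝟙 Z ≫ 𝟙 Z ≫ 𝟙 Z = 𝟙 Z ≫ 𝟙 Z ≫ 𝟙 Z ≫ 𝟙 Z ≫ 𝟙 Z ≫ 𝟙 Z :=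
      fun Z => by simp
    refine .trans (h ((KVHom.functor (F ≫ G ≫ y E)).obj X)) ?_
    refine congrArg (𝟙 _ ≫ ·) (congrArg (𝟙 _ ≫ ·) (congrArg (𝟙 _ ≫ ·) (congrArg (𝟙 _ ≫ ·)
      (congrArg (· ≫ _) ?_))))
    exact ((KVHom.functor (opMap (opMap G))).map_id ((KVHom.functor (F ≫ y D)).obj X)).symm

end KV

variable (k) in
/-- The duality involution on Kapranov-Voevodsky vector spaces given by opposite categories. -/
def kvDuality : DualityData (KV k) where
  dual := KV.opFunctor k
  y := KV.yTrans k
  ζ C := KV.ζ C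

end

section

variable {k : Type u} [Field k]

/-! ### Representations of a semisimple algebra form a Kapranov-Voevodsky vector space -/

namespace RMod

section

variable {A : AlgFd k} {n : ℕ} {d : Fin n → ℕ}
  (e : A ≃ₐ[k] ∀ i, Matrix (Fin (d i)) (Fin (d i)) k)

/-- The matrix units of `A`. -/
def unit (i : Fin n) (a b : Fin (d i)) : A := e.symm (Pi.single i (Matrix.single a b 1))

theorem unit_mul (i : Fin n) (a b : Fin (d i)) (x : A) :
    unit e i a b * x = ∑ c, e x i b c • unit e i a c := by
  apply e.injective
  rw [map_mul, map_sum]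
  simp only [map_smul, unit, AlgEquiv.apply_symm_apply]
  funext j
  rw [Pi.mul_apply, Finset.sum_apply]
  by_cases h : j = i
  · subst h
    ext p q
    simp [Matrix.sum_apply, Matrix.single_apply, Matrix.mul_apply, Finset.sum_ite_eq, ite_and]
  · simp [h]

theorem mul_unit (i : Fin n) (a b : Fin (d i)) (x : A) :
    x * unit e i a b = ∑ c, e x i c a • unit e i c b := by
  apply e.injective
  rw [map_mul, map_sum]
  simp only [map_smul, unit, AlgEquiv.apply_symm_apply]
  funext j
  rw [Pi.mul_apply, Finset.sum_apply]
  by_cases h : j = i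
  · subst h
    ext p q
    simp [Matrix.sum_apply, Matrix.single_apply, Matrix.mul_apply, Finset.sum_ite_eq, ite_and]
  · simp [h]

theorem unit_mul_unit (i : Fin n) (a b c f : Fin (d i)) :
    unit e i a b * unit e i c f = if b = c then unit e i a f else 0 := by
  rw [unit_mul]
  simp [unit, Matrix.single_apply, ite_and, Finset.sum_ite_eq, eq_comm]

theorem unit_mul_unit_ne {i j : Fin n} (h : i ≠ j) (a b : Fin (d i)) (c f : Fin (d j)) :
    unit e i a b * unit e j c f = 0 := by
  rw [unit_mul]
  simp [unit, h]

theorem sum_unit : ∑ i, ∑ a, unit e i a a = 1 := by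
  apply e.injective
  simp only [map_sum, unit, AlgEquiv.apply_symm_apply, map_one]
  funext j
  simp only [Finset.sum_apply]
  rw [Finset.sum_eq_single j]
  · ext p q
    simp [Matrix.sum_apply, Matrix.single_apply, Matrix.one_apply, ite_and, Finset.sum_ite_eq,
      eq_comm]
  · intro i _ h
    simp [h]
  · simp

/-- The module with prescribed multiplicity spaces. -/
def ofPow (W : VectPow k n) : RMod A where
  carrier := ∀ i, Fin (d i) → W i
  act := LinearMap.mk₂ k (fun v x i c => ∑ a, e x i a c • v i a)
    (by intros; funext i c; simp [Finset.sum_add_distrib])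
    (by intro r v x; funext i c; simp [Finset.smul_sum, smul_comm r])
    (by intros; funext i c; simp [Finset.sum_add_distrib, add_smul])
    (by intros; funext i c; simp [Finset.smul_sum, smul_smul])
  act_one v := by
    funext i c
    simp [Matrix.one_apply]
  act_mul v x y := by
    funext i c
    simp only [LinearMap.mk₂_apply, map_mul, Pi.mul_apply, Matrix.mul_apply, Finset.sum_smul,
      Finset.smul_sum, smul_smul]
    rw [Finset.sum_comm]
    simp only [mul_comm]

theorem ofPow_act (W : VectPow k n) (v : ofPow e W) (x : A) (i : Fin n) (c : Fin (d i)) :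
    ((ofPow e W).act v x : ∀ i, Fin (d i) → W i) i c =
      ∑ a, e x i a c • (v : ∀ i, Fin (d i) → W i) i a := rfl

variable [∀ i, NeZero (d i)]

/-- The subspace `V e` for the first diagonal matrix unit `e` of the `i`-th block. -/
def fixed (V : RMod A) (i : Fin n) : Submodule k V :=
  LinearMap.ker (V.act.flip (unit e i 0 0) - LinearMap.id)

theorem mem_fixed (V : RMod A) (i : Fin n) (v : V) :
    v ∈ fixed e V i ↔ V.act v (unit e i 0 0) = v := by
  simp [fixed, sub_eq_zero]

theorem act_unit_mem (V : RMod A) (i : Fin n) (v : V) (a : Fin (d i)) :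
    V.act v (unit e i a 0) ∈ fixed e V i := by
  rw [mem_fixed, ← V.act_mul, unit_mul_unit, if_pos rfl]

theorem expand (V : RMod A) (v : V) :
    ∑ i, ∑ a, V.act (V.act v (unit e i a 0)) (unit e i 0 a) = v := by
  have h := congrArg (V.act v) (sum_unit e)
  rw [V.act_one] at h
  refine .trans ?_ h
  simp only [map_sum]
  refine Finset.sum_congr rfl fun i _ => Finset.sum_congr rfl fun a _ => ?_
  rw [← V.act_mul, unit_mul_unit, if_pos rfl]

/-- The functor sending a module to the tuple of its multiplicity spaces. -/
def toPow : RMod A ⥤ VectPow k n where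
  obj V i := FGModuleCat.of k (fixed e V i)
  map {V W} f i := FGModuleCat.ofHom ((lin f).restrict (p := fixed e V i) (q := fixed e W i)
    (fun v hv => by rw [mem_fixed] at hv ⊢; rw [← lin_act, hv]))

theorem toPow_map_apply {V W : RMod A} (f : V ⟶ W) (i : Fin n) (v : fixed e V i) :
    (((toPow e).map f i).hom.hom v : fixed e W i).1 = lin f v.1 := rfl

instance : (toPow e).Additive := ⟨rfl⟩

instance : (toPow e).Linear k := ⟨fun _ _ => rfl⟩

instance : (toPow e).Faithful where
  map_injective {V W f g} h := hom_ext <| LinearMap.ext fun v => by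
    have key : ∀ i (w : V), w ∈ fixed e V i → lin f w = lin g w := fun i w hw =>
      congrArg (fun t : (toPow e).obj V ⟶ (toPow e).obj W =>
        ((t i).hom.hom ⟨w, hw⟩ : fixed e W i).1) h
    rw [← expand e V v]
    simp only [map_sum, lin_act f, lin_act g]
    refine Finset.sum_congr rfl fun i _ => Finset.sum_congr rfl fun a _ => ?_
    have := key i _ (act_unit_mem e V i v a)
    rw [lin_act, lin_act] at this
    rw [this]

/-- The map `v ↦ v e` to the multiplicity space, for a matrix unit `e` in the first column. -/
def toFixed (V : RMod A) (i : Fin n) (a : Fin (d i)) : V →ₗ[k] fixed e V i :=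
  (V.act.flip (unit e i a 0)).codRestrict (fixed e V i) (fun v => act_unit_mem e V i v a)

theorem toFixed_act (V : RMod A) (i : Fin n) (a : Fin (d i)) (v : V) (x : A) :
    toFixed e V i a (V.act v x) = ∑ c, e x i c a • toFixed e V i c v := by
  apply Subtype.ext
  rw [AddSubmonoidClass.coe_finsetSum]
  change V.act (V.act v x) (unit e i a 0) = ∑ c, e x i c a • V.act v (unit e i c 0)
  rw [← V.act_mul, mul_unit]
  simp

theorem toFixed_self (V : RMod A) (i : Fin n) (v : fixed e V i) : toFixed e V i 0 v.1 = v :=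
  Subtype.ext ((mem_fixed e V i _).1 v.2)

theorem toFixed_ne (V : RMod A) (i : Fin n) (v : fixed e V i) (a : Fin (d i)) (h : a ≠ 0) :
    toFixed e V i a v.1 = 0 := by
  apply Subtype.ext
  change V.act v.1 _ = 0
  conv_lhs => rw [← (mem_fixed e V i _).1 v.2]
  rw [← V.act_mul, unit_mul_unit, if_neg h.symm, map_zero]

theorem toFixed_ne' (V : RMod A) {i j : Fin n} (h : j ≠ i) (v : fixed e V i) (a : Fin (d j)) :
    toFixed e V j a v.1 = 0 := by
  apply Subtype.ext
  change V.act v.1 _ = 0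
  conv_lhs => rw [← (mem_fixed e V i _).1 v.2]
  rw [← V.act_mul, unit_mul_unit_ne e h.symm, map_zero]

/-- The linear map on modules assembled from maps of multiplicity spaces. -/
def assemble (V W : RMod A) (g : ∀ i, fixed e V i →ₗ[k] fixed e W i) : V →ₗ[k] W :=
  ∑ i, ∑ a, (W.act.flip (unit e i 0 a)) ∘ₗ (fixed e W i).subtype ∘ₗ g i ∘ₗ toFixed e V i a

theorem assemble_apply (V W : RMod A) (g : ∀ i, fixed e V i →ₗ[k] fixed e W i) (v : V) :
    assemble e V W g v =
      ∑ i, ∑ a, W.act (g i (toFixed e V i a v) : fixed e W i).1 (unit e i 0 a) := by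
  simp [assemble]

theorem assemble_act (V W : RMod A) (g : ∀ i, fixed e V i →ₗ[k] fixed e W i) (v : V) (x : A) :
    assemble e V W g (V.act v x) = W.act (assemble e V W g v) x := by
  rw [assemble_apply, assemble_apply]
  simp only [map_sum, LinearMap.sum_apply]
  refine Finset.sum_congr rfl fun i _ => ?_
  have h2 : ∀ a, W.act (W.act (g i (toFixed e V i a v) : fixed e W i).1 (unit e i 0 a)) x =
      ∑ c, e x i a c • W.act (g i (toFixed e V i a v) : fixed e W i).1 (unit e i 0 c) :=
    fun a => by rw [← W.act_mul, unit_mul]; simp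
  simp only [toFixed_act, h2]
  rw [Finset.sum_comm]
  simp

theorem assemble_self (V W : RMod A) (g : ∀ i, fixed e V i →ₗ[k] fixed e W i) (i : Fin n)
    (v : fixed e V i) : assemble e V W g v.1 = (g i v : fixed e W i).1 := by
  rw [assemble_apply, Finset.sum_eq_single i, Finset.sum_eq_single 0]
  · rw [toFixed_self]
    exact (mem_fixed e W i _).1 (g i v).2
  · intro a _ ha
    rw [toFixed_ne e V i v a ha]; simp
  · simp
  · intro j _ hj
    refine Finset.sum_eq_zero fun a _ => ?_
    rw [toFixed_ne' e V hj v a]; simp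
  · simp

instance : (toPow e).Full where
  map_surjective {V W} f := by
    let g : ∀ i, fixed e V i →ₗ[k] fixed e W i := fun i => (f i).hom.hom
    refine ⟨ofLin (assemble e V W g) (assemble_act e V W g), ?_⟩
    funext i
    exact FGModuleCat.hom_ext (LinearMap.ext fun v => Subtype.ext (assemble_self e V W g i v))

theorem ofPow_act_unit (W : VectPow k n) (v : ofPow e W) (i : Fin n) :
    (ofPow e W).act v (unit e i 0 0) =
      (Pi.single i (Pi.single 0 ((v : ∀ i, Fin (d i) → W i) i 0)) : ∀ i, Fin (d i) → W i) := by
  funext j c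
  rw [ofPow_act]
  by_cases h : j = i
  · subst h
    by_cases h : c = 0
    · subst h
      simp [unit, Matrix.single_apply]
    · simp [unit, h, Ne.symm h]
  · simp [unit, h]

/-- The multiplicity spaces of the module with prescribed multiplicity spaces. -/
def ofPowFixed (W : VectPow k n) (i : Fin n) : fixed e (ofPow e W) i ≃ₗ[k] W i where
  toFun v := (v.1 : ∀ i, Fin (d i) → W i) i 0
  map_add' _ _ := rfl
  map_smul' _ _ := rfl
  invFun w := ⟨(Pi.single i (Pi.single 0 w) : ∀ i, Fin (d i) → W i), by
    refine (mem_fixed e (ofPow e W) i _).2 ((ofPow_act_unit e W _ i).trans ?_)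
    simp
    rfl⟩
  left_inv v := Subtype.ext (by
    have := (mem_fixed e (ofPow e W) i v.1).1 v.2
    rw [ofPow_act_unit] at this
    exact this)
  right_inv w := by simp

instance : (toPow e).EssSurj where
  mem_essImage W := by
    let f (i : Fin n) := (ofPowFixed e W i).toFGModuleCatIso
    exact ⟨ofPow e W, ⟨fun i => (f i).hom, fun i => (f i).inv, funext fun i => (f i).hom_inv_id,
      funext fun i => (f i).inv_hom_id⟩⟩

end

/-- The category of finite-dimensional modules over a semisimple algebra over an algebraically
closed field is a Kapranov-Voevodsky vector space. -/
theorem isKV [IsAlgClosed k] (A : AlgFd k) : IsKV k (RMod A) := by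
  obtain ⟨n, d, hd, ⟨e⟩⟩ := IsSemisimpleRing.exists_algEquiv_pi_matrix_of_isAlgClosed k A
  have : (toPow e).IsEquivalence := { }
  exact ⟨n, (toPow e).asEquivalence, inferInstanceAs (toPow e).Additive,
    inferInstanceAs ((toPow e).Linear k)⟩

end RMod

end

section

variable {k : Type u} [Field k]

/-! ### The representation pseudofunctor -/

namespace RMod

variable {A B C D : AlgFd k}

theorem map_id (V : RMod A) (M : Bim A B) : map (𝟙 V) (𝟙 M) = 𝟙 (V.tensor M) := by
  ext m n; simp

theorem map_comp {M M' M'' : RMod A} {N N' N'' : Bim A B} (f : M ⟶ M') (f' : M' ⟶ M'')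
    (g : N ⟶ N') (g' : N' ⟶ N'') : map (f ≫ f') (g ≫ g') = map f g ≫ map f' g' := by
  ext m n; simp

theorem assoc_naturality {M M' : RMod A} {N N' : Bim A B} {P P' : Bim B C}
    (f : M ⟶ M') (g : N ⟶ N') (h : P ⟶ P') :
    map (map f g) h ≫ (assoc M' N' P').hom = (assoc M N P).hom ≫ map f (Bim.map g h) := by
  ext m n p; simp

theorem tensorOne_naturality {M N : RMod A} (f : M ⟶ N) :
    map f (𝟙 (Bim.one A)) ≫ (tensorOne N).hom = (tensorOne M).hom ≫ f := by
  ext m x; obtain ⟨a, rfl⟩ := el_surj x; simp [lin_act]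

theorem pentagon (M : RMod A) (N : Bim A B) (P : Bim B C) (Q : Bim C D) :
    map (assoc M N P).hom (𝟙 Q) ≫ (assoc M (N.tensor P) Q).hom ≫ map (𝟙 M) (Bim.assoc N P Q).hom =
      (assoc (M.tensor N) P Q).hom ≫ (assoc M N (P.tensor Q)).hom := by
  refine hom_ext (Tens.ext fun t q => ?_)
  have : (lin (map (assoc M N P).hom (𝟙 Q) ≫ (assoc M (N.tensor P) Q).hom ≫
        map (𝟙 M) (Bim.assoc N P Q).hom)) ∘ₗ (tmk _ Q).flip q =
      lin ((assoc (M.tensor N) P Q).hom ≫ (assoc M N (P.tensor Q)).hom) ∘ₗ (tmk _ Q).flip q :=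
    Tens.ext₂ fun m n p => by
      change (lin (map (assoc M N P).hom (𝟙 Q) ≫ (assoc M (N.tensor P) Q).hom ≫
        map (𝟙 M) (Bim.assoc N P Q).hom)) (tmk _ Q (tmk _ P (tmk M N m n) p) q) =
        lin ((assoc (M.tensor N) P Q).hom ≫ (assoc M N (P.tensor Q)).hom)
          (tmk _ Q (tmk _ P (tmk M N m n) p) q)
      simp
  exact LinearMap.congr_fun this t

theorem triangle (M : RMod A) (N : Bim A B) :
    (assoc M (Bim.one A) N).hom ≫ map (𝟙 M) (Bim.oneTensor N).hom =
      map (tensorOne M).hom (𝟙 N) := by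
  ext m x n; obtain ⟨a, rfl⟩ := el_surj x; simp [tmk_act]

theorem triangle' (M : RMod A) (N : Bim A B) :
    map (𝟙 M) (Bim.tensorOne N).hom =
      (assoc M N (Bim.one B)).inv ≫ (tensorOne (M.tensor N)).hom := by
  ext m n x; obtain ⟨a, rfl⟩ := el_surj x; simp

theorem map₂_comp (V : RMod A) {M N P : Bim A B} (f : M ⟶ N) (g : N ⟶ P) :
    map (𝟙 V) (f ≫ g) = map (𝟙 V) f ≫ map (𝟙 V) g := by
  rw [← map_comp, Category.comp_id]

theorem map₂_left (V : RMod A) (M : Bim A B) {N P : Bim B C} (f : N ⟶ P) :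
    map (𝟙 V) (Bim.map (𝟙 M) f) =
      (assoc V M N).inv ≫ map (𝟙 (V.tensor M)) f ≫ (assoc V M P).hom := by
  rw [← map_id, assoc_naturality]; simp

theorem map₂_right (V : RMod A) {M N : Bim A B} (f : M ⟶ N) (P : Bim B C) :
    map (𝟙 V) (Bim.map f (𝟙 P)) =
      (assoc V M P).inv ≫ map (map (𝟙 V) f) (𝟙 P) ≫ (assoc V N P).hom := by
  rw [assoc_naturality]; simp

theorem map₂_assoc (V : RMod A) (M : Bim A B) (N : Bim B C) (P : Bim C D) :
    map (𝟙 V) (Bim.assoc M N P).hom = (assoc V (M.tensor N) P).inv ≫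
      map (assoc V M N).inv (𝟙 P) ≫ 𝟙 (((V.tensor M).tensor N).tensor P) ≫
        (assoc (V.tensor M) N P).hom ≫ (assoc V M (N.tensor P)).hom := by
  rw [Category.id_comp, ← pentagon, ← Category.assoc (map _ _), ← map_comp]
  simp [map_id]

theorem map₂_leftUnitor (V : RMod A) (M : Bim A B) :
    map (𝟙 V) (Bim.oneTensor M).hom =
      (assoc V (Bim.one A) M).inv ≫ map (tensorOne V).hom (𝟙 M) := by
  rw [← triangle]; simp

/-- The functor `V ↦ V ⊗_A M`. -/
def tensorFun (M : Bim A B) : RMod A ⥤ RMod B where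
  obj V := V.tensor M
  map f := map f (𝟙 M)
  map_id V := map_id V M
  map_comp f g := by rw [← map_comp, Category.comp_id]

instance (M : Bim A B) : (tensorFun M).Additive where
  map_add {V W f g} := by
    change map (f + g) (𝟙 M) = map f (𝟙 M) + map g (𝟙 M)
    ext v m; simp

instance (M : Bim A B) : (tensorFun M).Linear k where
  map_smul {V W} f c := by
    change map (c • f) (𝟙 M) = c • map f (𝟙 M)
    ext v m; simp

/-- The natural transformation `V ⊗_A M ⟶ V ⊗_A N` induced by an intertwiner. -/
def tensorNat {M N : Bim A B} (g : M ⟶ N) : tensorFun M ⟶ tensorFun N where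
  app V := map (𝟙 V) g
  naturality V W f := by
    change map f (𝟙 M) ≫ map (𝟙 W) g = map (𝟙 V) g ≫ map f (𝟙 N)
    rw [← map_comp, ← map_comp]; simp

/-- The natural isomorphism `V ⊗_A A ≅ V`. -/
def tensorFunOne (A : AlgFd k) : tensorFun (Bim.one A) ≅ 𝟭 (RMod A) where
  hom := { app := fun V => (tensorOne V).hom, naturality := fun _ _ f => tensorOne_naturality f }
  inv :=
    { app := fun V => (tensorOne V).inv
      naturality := fun V W f => by
        change f ≫ (tensorOne W).inv = (tensorOne V).inv ≫ map f (𝟙 _)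
        rw [Iso.eq_inv_comp, ← Category.assoc, ← tensorOne_naturality]; simp }
  hom_inv_id := NatTrans.ext (funext fun V => (tensorOne V).hom_inv_id)
  inv_hom_id := NatTrans.ext (funext fun V => (tensorOne V).inv_hom_id)

/-- The natural isomorphism `V ⊗_A (M ⊗_B N) ≅ (V ⊗_A M) ⊗_B N`. -/
def tensorFunComp (M : Bim A B) (N : Bim B C) :
    tensorFun (M.tensor N) ≅ tensorFun M ⋙ tensorFun N where
  hom :=
    { app := fun V => (assoc V M N).inv
      naturality := fun V W f => by
        change map f (𝟙 _) ≫ (assoc W M N).inv = (assoc V M N).inv ≫ map (map f (𝟙 _)) (𝟙 _)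
        rw [Iso.eq_inv_comp, ← Category.assoc, ← Bim.map_id, ← assoc_naturality]; simp }
  inv :=
    { app := fun V => (assoc V M N).hom
      naturality := fun V W f => by
        change map (map f (𝟙 _)) (𝟙 _) ≫ (assoc W M N).hom = (assoc V M N).hom ≫ map f (𝟙 _)
        rw [assoc_naturality, Bim.map_id] }
  hom_inv_id := NatTrans.ext (funext fun V => (assoc V M N).inv_hom_id)
  inv_hom_id := NatTrans.ext (funext fun V => (assoc V M N).hom_inv_id)

end RMod

namespace ModRep

open RMod

variable {A B C D : AlgFd k} [IsAlgClosed k]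

/-- The category of finite-dimensional right `A`-modules. -/
def obj (A : AlgFd k) : KV k where
  carrier := RMod A
  isKV := RMod.isKV A

/-- The functor `V ↦ V ⊗_A M`. -/
def mapFun (M : Bim A B) : (obj A).carrier ⥤ (obj B).carrier := tensorFun M

instance (M : Bim A B) : (mapFun M).Additive := inferInstanceAs (tensorFun M).Additive

instance (M : Bim A B) : (mapFun M).Linear k := inferInstanceAs ((tensorFun M).Linear k)

/-- The 1-morphism `V ↦ V ⊗_A M`. -/
def map (M : A ⟶ B) : obj A ⟶ obj B := KVHom.mk' (C := obj A) (D := obj B) (mapFun M)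

/-- The 2-morphism `V ⊗_A M ⟶ V ⊗_A N` induced by an intertwiner. -/
def map₂ {M N : A ⟶ B} (g : M ⟶ N) : map M ⟶ map N :=
  KVHom.ofNt (C := obj A) (D := obj B) (F := map M) (G := map N)
    (show mapFun M ⟶ mapFun N from tensorNat g)

/-- The 2-isomorphism `V ⊗_A A ≅ V`. -/
def mapId (A : AlgFd k) : map (𝟙 A) ≅ 𝟙 (obj A) :=
  KVHom.ofNtIso (C := obj A) (D := obj A) (F := map (𝟙 A)) (G := 𝟙 (obj A))
    (show mapFun (𝟙 A) ≅ 𝟭 _ from tensorFunOne A)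

/-- The 2-isomorphism `V ⊗_A (M ⊗_B N) ≅ (V ⊗_A M) ⊗_B N`. -/
def mapComp (M : A ⟶ B) (N : B ⟶ C) : map (M ≫ N) ≅ map M ≫ map N :=
  KVHom.ofNtIso (C := obj A) (D := obj C) (F := map (M ≫ N)) (G := map M ≫ map N)
    (show mapFun (M ≫ N) ≅ mapFun M ⋙ mapFun N from tensorFunComp M N)

end ModRep

variable (k) in
/-- The representation pseudofunctor, sending an algebra `A` to the category of finite-dimensional
right `A`-modules, and an `(A, B)`-bimodule `M` to the functor `V ↦ V ⊗_A M`. -/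
def modRep [IsAlgClosed k] : AlgFd k ⥤ᵖ KV k where
  obj := ModRep.obj
  map := ModRep.map
  map₂ := ModRep.map₂
  mapId := ModRep.mapId
  mapComp := ModRep.mapComp
  map₂_id {A _} M := KVHom.hom_ext fun V => RMod.map_id (A := A) V M
  map₂_comp {A B _ _ _} f g := KVHom.hom_ext fun V => RMod.map₂_comp (A := A) (B := B) V f g
  map₂_whisker_left {A _ _} M _ _ f := KVHom.hom_ext fun V => RMod.map₂_left (A := A) V M f
  map₂_whisker_right {A _ _ _ _} f P := KVHom.hom_ext fun V => RMod.map₂_right (A := A) V f P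
  map₂_associator {A _ _ _} M N P := KVHom.hom_ext fun V => RMod.map₂_assoc (A := A) V M N P
  map₂_left_unitor {A _} M := KVHom.hom_ext fun V =>
    (RMod.map₂_leftUnitor (A := A) V M).trans
      (congrArg (_ ≫ ·) (Category.comp_id (RMod.map (RMod.tensorOne _).hom _)).symm)
  map₂_right_unitor {A _} M := KVHom.hom_ext fun V =>
    (RMod.triangle' (A := A) V M).trans
      (congrArg (_ ≫ ·) (Category.comp_id (RMod.tensorOne (RMod.tensor _ _)).hom).symm)

end

section

variable {k : Type u} [Field k]

/-! ### Dual modules -/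

namespace AlgFd

/-- The element of the opposite algebra given by an element of `A`. -/
def toOp (A : AlgFd k) : A ≃ₗ[k] A.op := opLinearEquiv k

variable (A : AlgFd k)

@[simp] theorem toOp_mul (a b : A) : A.toOp (a * b) = A.toOp b * A.toOp a := rfl
@[simp] theorem toOp_one : A.toOp 1 = 1 := rfl
@[simp] theorem toOp_symm_mul (a b : A.op) :
    A.toOp.symm (a * b) = A.toOp.symm b * A.toOp.symm a := rfl
@[simp] theorem toOp_symm_one : A.toOp.symm 1 = 1 := rfl

end AlgFd

namespace RMod

variable {A B C : AlgFd k}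

/-- The dual `hom_A(V, A)` of a right `A`-module, as a right module over the opposite algebra:
`(f · a) v = a * f v`. -/
def dual (V : RMod A) : RMod A.op where
  carrier := homs V (reg A)
  act := LinearMap.mk₂ k
    (fun f x => ⟨LinearMap.mulLeft k (A.toOp.symm x) ∘ₗ f.1, fun v a =>
      (congrArg (A.toOp.symm x * ·) (f.2 v a)).trans
        (mul_assoc (A.toOp.symm x) (show A from f.1 v) a).symm⟩)
    (fun f g _ => Subtype.ext (LinearMap.ext fun v => mul_add _ (show A from f.1 v) (g.1 v)))
    (fun c f _ => Subtype.ext (LinearMap.ext fun v => mul_smul_comm c _ (show A from f.1 v)))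
    (fun f x y => Subtype.ext (LinearMap.ext fun v =>
      (congrArg (· * (show A from f.1 v)) (map_add A.toOp.symm x y)).trans
        (add_mul _ _ (show A from f.1 v))))
    (fun c f x => Subtype.ext (LinearMap.ext fun v =>
      (congrArg (· * (show A from f.1 v)) (map_smul A.toOp.symm c x)).trans
        (smul_mul_assoc c _ (show A from f.1 v))))
  act_one f := Subtype.ext (LinearMap.ext fun v => one_mul (show A from f.1 v))
  act_mul f x y := Subtype.ext (LinearMap.ext fun v =>
    mul_assoc (A.toOp.symm y) (A.toOp.symm x) (show A from f.1 v))

/-- Evaluation of an element of the dual. -/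
def ev (V : RMod A) : V.dual →ₗ[k] V →ₗ[k] A := (homs V (reg A)).subtype

/-- The element of the dual given by a linear map. -/
def dmk (V : RMod A) (φ : V →ₗ[k] A) (h : ∀ v a, φ (V.act v a) = φ v * a) : V.dual := ⟨φ, h⟩

@[simp] theorem ev_dmk (V : RMod A) (φ : V →ₗ[k] A) (h) : V.ev (dmk V φ h) = φ := rfl

@[simp] theorem ev_act (V : RMod A) (f : V.dual) (v : V) (a : A) :
    V.ev f (V.act v a) = V.ev f v * a := f.2 v a

@[simp] theorem ev_dual_act (V : RMod A) (f : V.dual) (x : A.op) (v : V) :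
    V.ev (V.dual.act f x) v = A.toOp.symm x * V.ev f v := rfl

theorem dual_ext {V : RMod A} {f g : V.dual} (h : ∀ v, V.ev f v = V.ev g v) : f = g :=
  Subtype.ext (LinearMap.ext h)

/-- Finite-dimensional modules over a semisimple algebra have a dual basis. -/
theorem exists_dualBasis (V : RMod A) : ∃ (n : ℕ) (e : Fin n → V) (f : Fin n → V.dual),
    ∀ v, ∑ i, V.act (e i) (V.ev (f i) v) = v := by
  let : Module A.carrierᵐᵒᵖ V :=
    { smul := fun a v => V.act v (unop a)
      one_smul := V.act_one
      mul_smul := fun a b v => V.act_mul v (unop b) (unop a)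
      smul_zero := fun a => by change V.act 0 _ = 0; simp
      smul_add := fun a v w => by change V.act (v + w) _ = V.act v _ + V.act w _; simp
      add_smul := fun a b v => map_add (V.act v) (unop a) (unop b)
      zero_smul := fun v => map_zero (V.act v) }
  have hs : ∀ (a : A.carrierᵐᵒᵖ) (v : V), a • v = V.act v (unop a) := fun _ _ => rfl
  have : IsScalarTower k A.carrierᵐᵒᵖ V := ⟨fun c a v => by
    rw [hs, hs, unop_smul, map_smul]⟩
  have : Module.Finite A.carrierᵐᵒᵖ V := Module.Finite.of_restrictScalars_finite k _ V
  have := Module.projective_of_isSemisimpleRing A.carrierᵐᵒᵖ V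
  obtain ⟨n, p, q, -, -, hpq⟩ := Module.Finite.exists_comp_eq_id_of_projective A.carrierᵐᵒᵖ V
  refine ⟨n, fun i => p (Pi.single i 1), fun i => V.dmk
    { toFun := fun v => unop (q v i)
      map_add' := fun v w => by simp
      map_smul' := fun c v => by
        have : c • v = (c • (1 : A.carrierᵐᵒᵖ)) • v := by rw [smul_assoc, one_smul]
        rw [this, map_smul]; simp } (fun v a => by
        change unop (q (V.act v (unop (op a))) i) = _
        rw [← hs, map_smul]; rfl), fun v => ?_⟩
  refine .trans ?_ (LinearMap.congr_fun hpq v)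
  rw [LinearMap.comp_apply]
  conv_rhs => rw [← Finset.univ_sum_single (q v)]
  rw [map_sum]
  refine Finset.sum_congr rfl fun i _ => ?_
  change V.act _ (unop (q v i)) = _
  rw [← hs, ← map_smul]
  simp [← Pi.single_smul]

/-- The transpose of a module map. -/
def dmap {V W : RMod A} (f : V ⟶ W) : W.dual ⟶ V.dual :=
  ofLin
    { toFun := fun g => dmk V (W.ev g ∘ₗ lin f) (fun v a => by simp [lin_act])
      map_add' := fun g h => dual_ext fun v => by simp
      map_smul' := fun c g => dual_ext fun v => by simp }
    (fun g x => dual_ext fun v => by simp)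

@[simp] theorem ev_dmap {V W : RMod A} (f : V ⟶ W) (g : W.dual) (v : V) :
    V.ev (lin (dmap f) g) v = W.ev g (lin f v) := rfl

/-- The map `V ⟶ V°°` to the double dual, as a linear map: `ψ(v)(f) = f(v)`. -/
def psi (V : RMod A) : V →ₗ[k] V.dual.dual :=
  LinearMap.codRestrict (homs V.dual (reg A.op))
    (((LinearMap.llcomp k V.dual A A.op) A.toOp.toLinearMap) ∘ₗ V.ev.flip) (fun v f x => by
      change A.toOp (V.ev (V.dual.act f x) v) = A.toOp (V.ev f v) * x
      rw [ev_dual_act, AlgFd.toOp_mul, LinearEquiv.apply_symm_apply])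

@[simp] theorem ev_psi (V : RMod A) (v : V) (f : V.dual) :
    V.dual.ev (V.psi v) f = A.toOp (V.ev f v) := rfl

theorem psi_act (V : RMod A) (v : V) (a : A) :
    V.psi (V.act v a) = V.dual.dual.act (V.psi v) (A.op.toOp (A.toOp a)) :=
  dual_ext fun f => by simp

theorem psi_bijective (V : RMod A) : Function.Bijective V.psi := by
  obtain ⟨n, e, f, h⟩ := V.exists_dualBasis
  constructor
  · rw [injective_iff_map_eq_zero]
    intro v hv
    rw [← h v]
    refine Finset.sum_eq_zero fun i _ => ?_
    have : A.toOp (V.ev (f i) v) = 0 := by rw [← ev_psi, hv]; simp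
    rw [(LinearEquiv.map_eq_zero_iff _).1 this, map_zero]
  · intro Φ
    refine ⟨∑ i, V.act (e i) (A.toOp.symm (V.dual.ev Φ (f i))), dual_ext fun g => ?_⟩
    have hg : g = ∑ i, V.dual.act (f i) (A.toOp (V.ev g (e i))) := dual_ext fun v => by
      conv_lhs => rw [← h v]
      simp
    conv_rhs => rw [hg]
    simp

end RMod

namespace Bim

variable {A B C : AlgFd k}

/-- The dual `hom_B(M, B)` of a bimodule, with `(a · f) m = f (a m)`. -/
def dual (M : Bim A B) : Bim A.op B.op where
  toRMod := M.toRMod.dual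
  lact := LinearMap.mk₂ k
    (fun x f => RMod.dmk M.toRMod (M.toRMod.ev f ∘ₗ M.lact (A.toOp.symm x)) (fun m b => by
      simp [← M.lact_act]))
    (fun _ _ _ => RMod.dual_ext fun m => by simp)
    (fun _ _ _ => RMod.dual_ext fun m => by simp)
    (fun _ _ _ => RMod.dual_ext fun m => by simp)
    (fun _ _ _ => RMod.dual_ext fun m => by simp)
  one_lact f := RMod.dual_ext fun m => by simp [M.one_lact]
  mul_lact x y f := RMod.dual_ext fun m => by simp [M.mul_lact]
  lact_act x f b := RMod.dual_ext fun m => by simp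

/-- Evaluation of an element of the dual. -/
def ev (M : Bim A B) : M.dual →ₗ[k] M →ₗ[k] B := M.toRMod.ev

@[simp] theorem ev_lact (M : Bim A B) (x : A.op) (f : M.dual) (m : M) :
    M.ev (M.dual.lact x f) m = M.ev f (M.lact (A.toOp.symm x) m) := rfl

@[simp] theorem ev_act (M : Bim A B) (f : M.dual) (m : M) (b : B) :
    M.ev f (M.act m b) = M.ev f m * b := M.toRMod.ev_act f m b

@[simp] theorem ev_dual_act (M : Bim A B) (f : M.dual) (x : B.op) (m : M) :
    M.ev (M.dual.act f x) m = B.toOp.symm x * M.ev f m := rfl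

theorem dual_ext {M : Bim A B} {f g : M.dual} (h : ∀ v, M.ev f v = M.ev g v) : f = g :=
  RMod.dual_ext h

/-- The transpose of an intertwiner. -/
def dmap {M N : Bim A B} (f : M ⟶ N) : N.dual ⟶ M.dual :=
  ofLin (RMod.lin (RMod.dmap (toR f))) (RMod.lin_act (RMod.dmap (toR f))) (fun x g =>
    dual_ext fun m => by
      change N.ev g (N.lact _ (lin f m)) = N.ev g (lin f (M.lact _ m))
      rw [lin_lact])

@[simp] theorem ev_dmap {M N : Bim A B} (f : M ⟶ N) (g : N.dual) (m : M) :
    M.ev (lin (dmap f) g) m = N.ev g (lin f m) := rfl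

end Bim

namespace RMod

variable {A B C D : AlgFd k}

theorem dual_ext_tensor {V : RMod A} {M : Bim A B} {f g : (V.tensor M).dual}
    (h : ∀ v m, (V.tensor M).ev f (tmk V M v m) = (V.tensor M).ev g (tmk V M v m)) : f = g :=
  dual_ext fun t => LinearMap.congr_fun (tensor_ext h) t

/-- The linear map `v ⊗ m ↦ g (f(v) m)`. -/
def dualTensorAux (V : RMod A) (M : Bim A B) (f : V.dual) (g : M.dual) : V.tensor M →ₗ[k] B :=
  tlift ((M.lact.compr₂ (M.ev g)) ∘ₗ V.ev f) (fun v a m => by simp [M.mul_lact])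

@[simp] theorem dualTensorAux_tmk (V : RMod A) (M : Bim A B) (f : V.dual) (g : M.dual)
    (v : V) (m : M) : dualTensorAux V M f g (tmk V M v m) = M.ev g (M.lact (V.ev f v) m) :=
  tlift_tmk _ _ _ _

/-- The element `v ⊗ m ↦ g (f(v) m)` of `(V ⊗ M)°` given by `f` in `V°` and `g` in `M°`. -/
def dualTensorMk (V : RMod A) (M : Bim A B) :
    V.dual →ₗ[k] M.dual →ₗ[k] (V.tensor M).dual :=
  LinearMap.mk₂ k (fun f g => dmk (V.tensor M) (dualTensorAux V M f g) (fun t b => by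
      induction t using tensor_induction with
      | h0 => simp
      | hmk v m => simp [← M.lact_act]
      | hadd s t hs ht => simp only [map_add, hs, ht, LinearMap.add_apply, add_mul]))
    (fun _ _ _ => dual_ext_tensor fun v m => by simp)
    (fun _ _ _ => dual_ext_tensor fun v m => by simp)
    (fun _ _ _ => dual_ext_tensor fun v m => by simp)
    (fun _ _ _ => dual_ext_tensor fun v m => by simp)

@[simp] theorem ev_dualTensorMk (V : RMod A) (M : Bim A B) (f : V.dual) (g : M.dual)
    (v : V) (m : M) :
    (V.tensor M).ev (dualTensorMk V M f g) (tmk V M v m) = M.ev g (M.lact (V.ev f v) m) :=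
  dualTensorAux_tmk V M f g v m

/-- The map `V° ⊗ M° ⟶ (V ⊗ M)°`, `f ⊗ g ↦ (v ⊗ m ↦ g (f(v) m))`. -/
def dualTensorHom (V : RMod A) (M : Bim A B) : V.dual.tensor M.dual ⟶ (V.tensor M).dual :=
  thom (dualTensorMk V M)
    (fun f x g => dual_ext_tensor fun v m => by simp [M.mul_lact])
    (fun f g x => dual_ext_tensor fun v m => by simp)

@[simp] theorem dualTensorHom_tmk (V : RMod A) (M : Bim A B) (f : V.dual) (g : M.dual) :
    lin (dualTensorHom V M) (tmk V.dual M.dual f g) = dualTensorMk V M f g :=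
  lin_thom_tmk _ _ _ f g

/-- The element `m ↦ h (v ⊗ m)` of `M°`. -/
def slice (V : RMod A) (M : Bim A B) (v : V) : (V.tensor M).dual →ₗ[k] M.dual where
  toFun h := dmk M.toRMod ((V.tensor M).ev h ∘ₗ tmk V M v) (fun m b => by
    simp [← tensor_act])
  map_add' _ _ := Bim.dual_ext fun m => rfl
  map_smul' _ _ := Bim.dual_ext fun m => rfl

@[simp] theorem ev_slice (V : RMod A) (M : Bim A B) (v : V) (h : (V.tensor M).dual) (m : M) :
    M.ev (slice V M v h) m = (V.tensor M).ev h (tmk V M v m) := rfl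

theorem dualTensorHom_bijective (V : RMod A) (M : Bim A B) :
    Function.Bijective (lin (dualTensorHom V M)) := by
  obtain ⟨n, e, f, h⟩ := V.exists_dualBasis
  let q : (V.tensor M).dual →ₗ[k] V.dual.tensor M.dual :=
    ∑ i, tmk V.dual M.dual (f i) ∘ₗ slice V M (e i)
  have hq : ∀ t, q t = ∑ i, tmk V.dual M.dual (f i) (slice V M (e i) t) := fun t => by simp [q]
  refine Function.bijective_iff_has_inverse.2 ⟨q, fun t => ?_, fun t => ?_⟩
  · refine LinearMap.congr_fun (f := q ∘ₗ lin (dualTensorHom V M)) (g := LinearMap.id)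
      (tensor_ext fun g x => ?_) t
    rw [LinearMap.comp_apply, hq, dualTensorHom_tmk]
    have h1 : ∀ v, slice V M v (dualTensorMk V M g x) = M.dual.lact (A.toOp (V.ev g v)) x :=
      fun v => Bim.dual_ext fun m => by simp
    have hg : g = ∑ i, V.dual.act (f i) (A.toOp (V.ev g (e i))) := dual_ext fun v => by
      conv_lhs => rw [← h v]
      simp
    simp only [h1, ← tmk_act]
    conv_rhs => rw [hg]
    simp
  · refine dual_ext_tensor fun v m => ?_
    rw [hq]
    conv_rhs => rw [← h v]
    simp [tmk_act]

/-- The canonical isomorphism `V° ⊗ M° ≅ (V ⊗ M)°`. -/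
def dualTensor (V : RMod A) (M : Bim A B) : V.dual.tensor M.dual ≅ (V.tensor M).dual :=
  isoOfBijective (dualTensorHom V M) (dualTensorHom_bijective V M)

theorem dualTensor_tmk (V : RMod A) (M : Bim A B) (f : V.dual) (g : M.dual) :
    lin (dualTensor V M).hom (tmk V.dual M.dual f g) = dualTensorMk V M f g :=
  dualTensorHom_tmk V M f g

theorem dualTensor_naturality {V W : RMod A} {M N : Bim A B} (f : V ⟶ W) (g : M ⟶ N) :
    map (dmap f) (Bim.dmap g) ≫ (dualTensor V M).hom =
      (dualTensor W N).hom ≫ dmap (map f g) := by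
  ext p q
  refine dual_ext_tensor fun v m => ?_
  simp [dualTensor_tmk, Bim.lin_lact]

theorem dual_ext_tensor_right {V : RMod A} {M : Bim A B} {N : Bim B C}
    {f g : (V.tensor (M.tensor N)).dual}
    (h : ∀ v m n, (V.tensor (M.tensor N)).ev f (tmk V _ v (Bim.tmk M N m n)) =
      (V.tensor (M.tensor N)).ev g (tmk V _ v (Bim.tmk M N m n))) : f = g :=
  dual_ext fun t => LinearMap.congr_fun (Tens.ext₂' (ρ' := V.act) (l' := (M.tensor N).lact)
    (f := (V.tensor (M.tensor N)).ev f) (g := (V.tensor (M.tensor N)).ev g) h) t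

end RMod

namespace Bim

open RMod (el el_surj)

variable {A B C D : AlgFd k}

/-- The element `m ⊗ n ↦ g (f(m) n)` of `(M ⊗ N)°` given by `f` in `M°` and `g` in `N°`. -/
def dualTensorMk (M : Bim A B) (N : Bim B C) : M.dual →ₗ[k] N.dual →ₗ[k] (M.tensor N).dual :=
  RMod.dualTensorMk M.toRMod N

@[simp] theorem ev_dualTensorMk (M : Bim A B) (N : Bim B C) (f : M.dual) (g : N.dual)
    (m : M) (n : N) :
    (M.tensor N).ev (dualTensorMk M N f g) (tmk M N m n) = N.ev g (N.lact (M.ev f m) n) :=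
  RMod.ev_dualTensorMk M.toRMod N f g m n

theorem _root_.RMod.dualTensor_assoc (V : RMod A) (M : Bim A B) (N : Bim B C) (f : V.dual)
    (g : M.dual) (h : N.dual) :
    RMod.lin (RMod.dmap (RMod.assoc V M N).inv)
        (RMod.dualTensorMk (V.tensor M) N (RMod.dualTensorMk V M f g) h) =
      RMod.dualTensorMk V (M.tensor N) f (dualTensorMk M N g h) := by
  refine RMod.dual_ext_tensor_right fun v m n => ?_
  simp

theorem dual_ext_tensor {M : Bim A B} {N : Bim B C} {f g : (M.tensor N).dual}
    (h : ∀ m n, (M.tensor N).ev f (tmk M N m n) = (M.tensor N).ev g (tmk M N m n)) : f = g :=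
  RMod.dual_ext_tensor h

theorem dual_ext_tensor_right {V : Bim D A} {M : Bim A B} {N : Bim B C}
    {f g : (V.tensor (M.tensor N)).dual}
    (h : ∀ v m n, (V.tensor (M.tensor N)).ev f (tmk V _ v (Bim.tmk M N m n)) =
      (V.tensor (M.tensor N)).ev g (tmk V _ v (Bim.tmk M N m n))) : f = g :=
  RMod.dual_ext_tensor_right h

/-- The canonical isomorphism `M° ⊗ N° ≅ (M ⊗ N)°`, `f ⊗ g ↦ (m ⊗ n ↦ g (f(m) n))`. -/
def dualTensor (M : Bim A B) (N : Bim B C) : M.dual.tensor N.dual ≅ (M.tensor N).dual :=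
  isoOfR (RMod.dualTensor M.toRMod N) fun x t => by
    induction t using tensor_induction with
    | h0 => simp only [map_zero]
    | hadd s t hs ht => simp only [map_add, hs, ht]
    | hmk f g =>
      rw [tensor_lact]
      refine (RMod.dualTensor_tmk M.toRMod N _ g).trans (.trans ?_
        (congrArg ((M.tensor N).dual.lact x) (RMod.dualTensor_tmk M.toRMod N f g).symm))
      change dualTensorMk M N _ g = (M.tensor N).dual.lact x (dualTensorMk M N f g)
      exact dual_ext_tensor fun m n => by simp

@[simp] theorem dualTensor_tmk (M : Bim A B) (N : Bim B C) (f : M.dual) (g : N.dual) :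
    lin (dualTensor M N).hom (tmk M.dual N.dual f g) = dualTensorMk M N f g :=
  RMod.dualTensor_tmk M.toRMod N f g

theorem dualTensor_naturality {M M' : Bim A B} {N N' : Bim B C} (f : M ⟶ M') (g : N ⟶ N') :
    map (dmap f) (dmap g) ≫ (dualTensor M N).hom = (dualTensor M' N').hom ≫ dmap (map f g) := by
  ext p q
  refine dual_ext_tensor fun v m => ?_
  simp [lin_lact]

theorem dualTensor_assoc (M : Bim A B) (N : Bim B C) (P : Bim C D) :
    map (dualTensor M N).hom (𝟙 P.dual) ≫ (dualTensor (M.tensor N) P).hom ≫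
      dmap (assoc M N P).inv =
    (assoc M.dual N.dual P.dual).hom ≫ map (𝟙 M.dual) (dualTensor N P).hom ≫
      (dualTensor M (N.tensor P)).hom := by
  ext f g h
  refine dual_ext_tensor_right fun v m n => ?_
  simp

theorem dmap_id (M : Bim A B) : dmap (𝟙 M) = 𝟙 M.dual := by
  ext f; exact dual_ext fun m => by simp

theorem dmap_comp {M N P : Bim A B} (f : M ⟶ N) (g : N ⟶ P) :
    dmap (f ≫ g) = dmap g ≫ dmap f := by
  ext f; exact dual_ext fun m => by simp

/-- Evaluation of an endomorphism of the unit bimodule at the unit. -/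
def evOne (A : AlgFd k) : (one A).dual →ₗ[k] A := (one A).ev.flip (el 1)

@[simp] theorem evOne_apply (f : (one A).dual) : evOne A f = (one A).ev f (el 1) := rfl

theorem ev_el (f : (one A).dual) (a : A) : (one A).ev f (el a) = (one A).ev f (el 1) * a := by
  rw [← ev_act, RMod.el_act, one_mul]

/-- The map `hom_A(A, A) ⟶ A°`, `f ↦ f(1)`. -/
def dualOneHom (A : AlgFd k) : (one A).dual ⟶ one A.op :=
  ofLin (el ∘ₗ A.toOp.toLinearMap ∘ₗ evOne A) (fun f x => by simp)
    (fun x f => by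
      simp only [LinearMap.comp_apply, evOne_apply, ev_lact, LinearEquiv.coe_coe, RMod.el_lact]
      rw [mul_one, ev_el]
      simp)

theorem dualOneHom_apply (A : AlgFd k) (f : (one A).dual) :
    lin (dualOneHom A) f = el (A.toOp ((one A).ev f (el 1))) := rfl

theorem dualOneHom_bijective (A : AlgFd k) : Function.Bijective (lin (dualOneHom A)) := by
  constructor
  · intro f g h
    refine dual_ext fun x => ?_
    obtain ⟨a, rfl⟩ := el_surj x
    rw [ev_el, ev_el g]
    exact congrArg (· * a) (A.toOp.injective h)
  · intro x
    obtain ⟨a, rfl⟩ := A.toOp.surjective x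
    exact ⟨RMod.dmk (RMod.reg A) (LinearMap.mulLeft k a) (fun v b => (mul_assoc a v b).symm),
      congrArg A.toOp (mul_one a)⟩

/-- The canonical isomorphism `hom_A(A, A) ≅ A°`, `f ↦ f(1)`. -/
def dualOne (A : AlgFd k) : (one A).dual ≅ one A.op :=
  isoOfR (RMod.isoOfBijective (toR (dualOneHom A)) (dualOneHom_bijective A))
    (lin_lact (dualOneHom A))

@[simp] theorem dualOne_apply (A : AlgFd k) (f : (one A).dual) :
    lin (dualOne A).hom f = el (A.toOp ((one A).ev f (el 1))) := rfl

@[simp] theorem ev_dualOne_inv (A : AlgFd k) (x : A.op) (b : A) :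
    (one A).ev (lin (dualOne A).inv (el x)) (el b) = A.toOp.symm x * b := by
  have h : lin (dualOne A).hom (lin (dualOne A).inv (el x)) = el x := by
    rw [← LinearMap.comp_apply, ← lin_comp, Iso.inv_hom_id]; rfl
  rw [dualOne_apply] at h
  have h' : A.toOp ((one A).ev (lin (dualOne A).inv (el x)) (el 1)) = x := h
  rw [ev_el, (LinearEquiv.eq_symm_apply A.toOp).2 h']

theorem dualTensor_left (M : Bim A B) :
    (dualTensor (one A) M).hom ≫ dmap (oneTensor M).inv =
      map (dualOne A).hom (𝟙 M.dual) ≫ (oneTensor M.dual).hom := by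
  ext f g
  refine dual_ext fun m => ?_
  simp

theorem dualTensor_right (M : Bim A B) :
    (dualTensor M (one B)).hom ≫ dmap (tensorOne M).inv =
      map (𝟙 M.dual) (dualOne B).hom ≫ (tensorOne M.dual).hom := by
  ext f g
  refine dual_ext fun m => ?_
  have h : ∀ b, (one B).ev g (el b) = (one B).ev g (el 1) * b := ev_el g
  simp [← h]

end Bim

end

section

variable {k : Type u} [Field k]

namespace Bim

variable {A B C D : AlgFd k}

theorem dmap_left (M : Bim A B) {N N' : Bim B C} (g : N ⟶ N') :
    dmap (map (𝟙 M) g) =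
      (dualTensor M N').inv ≫ map (𝟙 M.dual) (dmap g) ≫ (dualTensor M N).hom := by
  rw [Iso.eq_inv_comp, ← dualTensor_naturality, dmap_id]

theorem dmap_right {M M' : Bim A B} (g : M ⟶ M') (N : Bim B C) :
    dmap (map g (𝟙 N)) =
      (dualTensor M' N).inv ≫ map (dmap g) (𝟙 N.dual) ≫ (dualTensor M N).hom := by
  rw [Iso.eq_inv_comp, ← dualTensor_naturality, dmap_id]

theorem dmap_assoc (M : Bim A B) (N : Bim B C) (P : Bim C D) :
    dmap (assoc M N P).inv = (dualTensor (M.tensor N) P).inv ≫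
      map (dualTensor M N).inv (𝟙 P.dual) ≫ (assoc M.dual N.dual P.dual).hom ≫
        map (𝟙 M.dual) (dualTensor N P).hom ≫ (dualTensor M (N.tensor P)).hom := by
  rw [← dualTensor_assoc, Iso.eq_inv_comp, ← Category.assoc (map _ _), ← map_comp]
  simp [map_id]

theorem dmap_oneTensor (M : Bim A B) :
    dmap (oneTensor M).inv = (dualTensor (one A) M).inv ≫
      map (dualOne A).hom (𝟙 M.dual) ≫ (oneTensor M.dual).hom := by
  rw [← dualTensor_left, Iso.inv_hom_id_assoc]

theorem dmap_tensorOne (M : Bim A B) :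
    dmap (tensorOne M).inv = (dualTensor M (one B)).inv ≫
      map (𝟙 M.dual) (dualOne B).hom ≫ (tensorOne M.dual).hom := by
  rw [← dualTensor_right, Iso.inv_hom_id_assoc]

end Bim

open Co

variable (k) in
/-- The pseudofunctor `(-)°` on the Morita bicategory: an algebra is sent to its opposite, an
`(A, B)`-bimodule `M` to the `(A°, B°)`-bimodule `hom_B(M, B)`. -/
def circ : Co (AlgFd k) ⥤ᵖ AlgFd k where
  obj A := A.un.op
  map M := Bim.dual (dn M)
  map₂ η := Bim.dmap (dn₂ η)
  mapId A := Bim.dualOne A.un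
  mapComp M N := (Bim.dualTensor (dn M) (dn N)).symm
  map₂_id M := Bim.dmap_id (dn M)
  map₂_comp f g := Bim.dmap_comp (dn₂ g) (dn₂ f)
  map₂_whisker_left M _ _ f := Bim.dmap_left (dn M) (dn₂ f)
  map₂_whisker_right f P := Bim.dmap_right (dn₂ f) (dn P)
  map₂_associator M N P := Bim.dmap_assoc (dn M) (dn N) (dn P)
  map₂_left_unitor M := Bim.dmap_oneTensor (dn M)
  map₂_right_unitor M := Bim.dmap_tensorOne (dn M)

end

section

variable {k : Type u} [Field k]

/-! ### The double dual -/

variable {A B C D : AlgFd k}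

/-- `A` as a bimodule from `A` to its double opposite. -/
def yBim (A : AlgFd k) : Bim A A.op.op where
  carrier := A
  act := (LinearMap.mul k A).compl₂ (A.toOp.symm.toLinearMap ∘ₗ A.op.toOp.symm.toLinearMap)
  act_one v := mul_one (M := A) v
  act_mul v _ _ := (mul_assoc (G := A) v _ _).symm
  lact := LinearMap.mul k A
  one_lact v := one_mul (M := A) v
  mul_lact a b v := mul_assoc (G := A) a b v
  lact_act a m _ := mul_assoc (G := A) a m _

/-- The element `a` of the bimodule `yBim A`. -/
def yel : A →ₗ[k] yBim A := LinearMap.id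

theorem yel_surj (x : yBim A) : ∃ a : A, yel a = x := ⟨x, rfl⟩

@[simp] theorem yel_act (a b : A) : (yBim A).act (yel a) (A.op.toOp (A.toOp b)) = yel (a * b) := rfl
theorem yel_act' (a : A) (x : A.op.op) :
    (yBim A).act (yel a) x = yel (a * A.toOp.symm (A.op.toOp.symm x)) := rfl
@[simp] theorem yel_lact (a b : A) : (yBim A).lact b (yel a) = yel (b * a) := rfl

namespace RMod

/-- The bilinear map `(v, a) ↦ va`. -/
def actY (V : RMod A) : V →ₗ[k] yBim A →ₗ[k] V := V.act

@[simp] theorem actY_yel (V : RMod A) (v : V) (a : A) : actY V v (yel a) = V.act v a := rfl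

/-- The linear map `V ⊗ A ⟶ V`, `v ⊗ a ↦ va`. -/
def tensorY (V : RMod A) : V.tensor (yBim A) →ₗ[k] V :=
  tlift (actY V) (fun v a x => by obtain ⟨b, rfl⟩ := yel_surj x; simp [V.act_mul])

@[simp] theorem tensorY_tmk (V : RMod A) (v : V) (a : A) :
    tensorY V (tmk V (yBim A) v (yel a)) = V.act v a := tlift_tmk _ _ _ _

theorem tmk_yel (V : RMod A) (v : V) (a : A) :
    tmk V (yBim A) v (yel a) = tmk V (yBim A) (V.act v a) (yel 1) := by
  rw [tmk_act, yel_lact, mul_one]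

theorem tensorY_bijective (V : RMod A) : Function.Bijective (tensorY V) := by
  refine Function.bijective_iff_has_inverse.2 ⟨fun v => tmk V (yBim A) v (yel 1), fun t => ?_,
    fun v => by simp [V.act_one]⟩
  refine LinearMap.congr_fun (f := (tmk V (yBim A)).flip (yel 1) ∘ₗ tensorY V)
    (g := LinearMap.id) (tensor_ext fun v x => ?_) t
  obtain ⟨a, rfl⟩ := yel_surj x
  simp [← tmk_yel]

/-- The isomorphism `V ⊗ A ≅ V°°`, `v ⊗ a ↦ ψ(va)`, where `ψ` is the map to the double dual. -/
def psiTensor (V : RMod A) : V.tensor (yBim A) ≅ V.dual.dual :=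
  isoOfBijective (ofLin (V.psi ∘ₗ tensorY V) (fun t x => by
    obtain ⟨x, rfl⟩ := A.op.toOp.surjective x
    obtain ⟨x, rfl⟩ := A.toOp.surjective x
    induction t using tensor_induction with
    | h0 => simp
    | hmk v a =>
      obtain ⟨a, rfl⟩ := yel_surj a
      simp [V.act_mul, psi_act]
    | hadd s t hs ht => simp only [map_add, hs, ht, LinearMap.add_apply]))
    (V.psi_bijective.comp V.tensorY_bijective)

@[simp] theorem psiTensor_tmk (V : RMod A) (v : V) (a : A) :
    lin (psiTensor V).hom (tmk V (yBim A) v (yel a)) = V.psi (V.act v a) :=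
  congrArg V.psi (tensorY_tmk V v a)

@[simp] theorem dmap_dmap_psi {V W : RMod A} (f : V ⟶ W) (v : V) :
    lin (dmap (dmap f)) (V.psi v) = W.psi (lin f v) := dual_ext fun g => by simp

end RMod

namespace Bim

/-- The bilinear map `(a, n) ↦ an`. -/
def lactY (N : Bim A.op.op B) : yBim A →ₗ[k] N →ₗ[k] N :=
  N.lact ∘ₗ A.op.toOp.toLinearMap ∘ₗ A.toOp.toLinearMap

@[simp] theorem lactY_yel (N : Bim A.op.op B) (a : A) (n : N) :
    lactY N (yel a) n = N.lact (A.op.toOp (A.toOp a)) n := rfl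

theorem tmk_yel (N : Bim A.op.op B) (a : A) (n : N) :
    tmk (yBim A) N (yel a) n = tmk (yBim A) N (yel 1) (N.lact (A.op.toOp (A.toOp a)) n) := by
  rw [← tmk_act, yel_act, one_mul]

theorem lactY_bal (N : Bim A.op.op B) (x : yBim A) (c : A.op.op) (n : N) :
    lactY N ((yBim A).act x c) n = lactY N x (N.lact c n) := by
  obtain ⟨b, rfl⟩ := yel_surj x
  obtain ⟨a, rfl⟩ := A.op.toOp.surjective c
  obtain ⟨a, rfl⟩ := A.toOp.surjective a
  simp [N.mul_lact]

theorem yTensor_bijective (N : Bim A.op.op B) :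
    Function.Bijective (tmk (yBim A) N (yel 1)) := by
  refine Function.bijective_iff_has_inverse.2 ⟨tlift (lactY N) (lactY_bal N),
    fun n => by simp [N.one_lact], fun t => ?_⟩
  refine LinearMap.congr_fun (f := tmk (yBim A) N (yel 1) ∘ₗ tlift (lactY N) (lactY_bal N))
    (g := LinearMap.id) (tensor_ext fun x n => ?_) t
  obtain ⟨a, rfl⟩ := yel_surj x
  rw [LinearMap.comp_apply, tlift_tmk, lactY_yel]
  exact (tmk_yel N a n).symm

/-- The isomorphism of right modules `N ≅ A ⊗ N`, `n ↦ 1 ⊗ n`. -/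
def yTensor (N : Bim A.op.op B) : N.toRMod ≅ ((yBim A).tensor N).toRMod :=
  RMod.isoOfBijective
    (RMod.ofLin (tmk (yBim A) N (yel 1)) (fun n b => (tensor_act (yel 1) n b).symm))
    (yTensor_bijective N)

/-- The map `M ⟶ M°°` to the double dual. -/
def psi (M : Bim A B) : M →ₗ[k] M.dual.dual := M.toRMod.psi

@[simp] theorem ev_psi (M : Bim A B) (m : M) (f : M.dual) :
    M.dual.ev (M.psi m) f = B.toOp (M.ev f m) := rfl

theorem psi_act (M : Bim A B) (m : M) (b : B) :
    M.psi (M.act m b) = M.dual.dual.act (M.psi m) (B.op.toOp (B.toOp b)) := M.toRMod.psi_act m b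

theorem psi_lact (M : Bim A B) (m : M) (a : A) :
    M.psi (M.lact a m) = M.dual.dual.lact (A.op.toOp (A.toOp a)) (M.psi m) :=
  dual_ext fun f => by simp

@[simp] theorem dmap_dmap_psi {M N : Bim A B} (f : M ⟶ N) (m : M) :
    lin (dmap (dmap f)) (M.psi m) = N.psi (lin f m) := dual_ext fun g => by simp

/-- The isomorphism `M ⊗ B ≅ A ⊗ M°°`, `m ⊗ b ↦ 1 ⊗ ψ(mb)`. -/
def yNat (M : Bim A B) : M.tensor (yBim B) ≅ (yBim A).tensor M.dual.dual :=
  isoOfR ((RMod.psiTensor M.toRMod).trans (yTensor M.dual.dual)) fun a t => by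
    induction t using tensor_induction with
    | h0 => simp only [map_zero]
    | hadd s t hs ht => simp only [map_add, hs, ht]
    | hmk m x =>
      obtain ⟨b, rfl⟩ := yel_surj x
      rw [tensor_lact]
      have h : ∀ m : M, RMod.lin ((RMod.psiTensor M.toRMod).trans (yTensor M.dual.dual)).hom
          (tmk M (yBim B) m (yel b)) = tmk (yBim A) M.dual.dual (yel 1) (M.psi (M.act m b)) :=
        fun m => congrArg (tmk (yBim A) M.dual.dual (yel 1)) (RMod.psiTensor_tmk M.toRMod m b)
      refine (h _).trans (.trans ?_ (congrArg _ (h m).symm))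
      rw [tensor_lact, yel_lact, mul_one, M.lact_act, psi_lact]
      exact (tmk_yel _ _ _).symm

@[simp] theorem yNat_tmk (M : Bim A B) (m : M) (b : B) :
    lin (yNat M).hom (tmk M (yBim B) m (yel b)) =
      tmk (yBim A) M.dual.dual (yel 1) (M.psi (M.act m b)) :=
  congrArg (tmk (yBim A) M.dual.dual (yel 1)) (RMod.psiTensor_tmk M.toRMod m b)

theorem yNat_naturality {M N : Bim A B} (g : M ⟶ N) :
    map g (𝟙 (yBim B)) ≫ (yNat N).hom = (yNat M).hom ≫ map (𝟙 (yBim A)) (dmap (dmap g)) := by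
  ext m x
  obtain ⟨b, rfl⟩ := yel_surj x
  simp [lin_act]

theorem yNat_id (A : AlgFd k) :
    (yNat (one A)).hom ≫ map (𝟙 (yBim A)) (dmap (dualOne A).inv ≫ (dualOne A.op).hom) =
      (oneTensor (yBim A)).hom ≫ (tensorOne (yBim A)).inv := by
  ext x y
  obtain ⟨a, rfl⟩ := RMod.el_surj x
  obtain ⟨b, rfl⟩ := yel_surj y
  simp only [lin_comp, LinearMap.comp_apply, yNat_tmk, map_tmk, lin_id, LinearMap.id_apply,
    dualOne_apply, oneTensor_hom_tmk, tensorOne_inv, yel_lact, RMod.el_act]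
  have h : (one A.op).ev (lin (dmap (dualOne A).inv) ((one A).psi (RMod.el (a * b)))) (RMod.el 1) =
      A.toOp (a * b) := by
    rw [ev_dmap, ev_psi, ev_dualOne_inv]; simp
  rw [h, tmk_yel (one A.op.op) (a * b), RMod.el_lact, mul_one]

theorem dual_dualTensor (M : Bim A B) (N : Bim B C) (m : M) (n : N) :
    lin (dualTensor M.dual N.dual).inv (lin (dmap (dualTensor M N).hom)
      ((M.tensor N).psi (tmk M N m n))) = tmk _ _ (M.psi m) (N.psi n) := by
  have h : lin (dmap (dualTensor M N).hom) ((M.tensor N).psi (tmk M N m n)) =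
      lin (dualTensor M.dual N.dual).hom (tmk _ _ (M.psi m) (N.psi n)) := by
    refine dual_ext_tensor fun f g => ?_
    simp
  rw [h, ← LinearMap.comp_apply, ← lin_comp, Iso.hom_inv_id]
  rfl

theorem yNat_comp (M : Bim A B) (N : Bim B C) :
    (yNat (M.tensor N)).hom ≫ map (𝟙 (yBim A)) (dmap (dualTensor M N).hom ≫
        (dualTensor M.dual N.dual).inv) =
      (assoc M N (yBim C)).hom ≫ map (𝟙 M) (yNat N).hom ≫ (assoc M (yBim B) N.dual.dual).inv ≫
        map (yNat M).hom (𝟙 N.dual.dual) ≫ (assoc (yBim A) M.dual.dual N.dual.dual).hom := by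
  ext m n x
  obtain ⟨b, rfl⟩ := yel_surj x
  simp [dual_dualTensor, M.act_one]

end Bim

variable (k) in
/-- The pseudonatural transformation from the identity to the double dual, whose component at `A`
is `A` as a bimodule. -/
def yTrans : Pseudofunctor.id (AlgFd k) ⟶ (coMap' (circ k)).comp (circ k) where
  app A := yBim A
  naturality M := Bim.yNat M
  naturality_naturality g := Bim.yNat_naturality g
  naturality_id A := (Bim.yNat_id A).trans ((Category.id_comp _).symm.trans
    (congrArg (· ≫ (Bim.oneTensor (yBim A)).hom ≫ (Bim.tensorOne (yBim A)).inv)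
      (Bim.map_id (Bim.one A) (yBim A)).symm))
  naturality_comp {A B C} (M : Bim A B) (N : Bim B C) := (Bim.yNat_comp M N).trans
    ((Category.id_comp _).symm.trans
      (congrArg (· ≫ (Bim.assoc M N (yBim C)).hom ≫ Bim.map (𝟙 M) (Bim.yNat N).hom ≫
        (Bim.assoc M (yBim B) N.dual.dual).inv ≫ Bim.map (Bim.yNat M).hom (𝟙 N.dual.dual) ≫
          (Bim.assoc (yBim A) M.dual.dual N.dual.dual).hom)
        (Bim.map_id (M.tensor N) (yBim C)).symm))

/-- The map `A° ⟶ hom_A(A, A)`, `x ↦ (v ↦ x v)`. -/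
def zetaLin (A : AlgFd k) : yBim A.op →ₗ[k] (yBim A).dual where
  toFun x := RMod.dmk (yBim A).toRMod
    (A.op.toOp.toLinearMap ∘ₗ A.toOp.toLinearMap ∘ₗ LinearMap.mulLeft k (A.toOp.symm x))
    (fun v z => by
      obtain ⟨a, rfl⟩ := yel_surj v
      rw [yel_act']
      exact congrArg (fun t => A.op.toOp (A.toOp t)) (mul_assoc (A.toOp.symm x) a _).symm)
  map_add' x y := Bim.dual_ext fun v => congrArg (fun t => A.op.toOp (A.toOp t))
    (add_mul (A.toOp.symm x) (A.toOp.symm y) v)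
  map_smul' c x := Bim.dual_ext fun v => congrArg (fun t => A.op.toOp (A.toOp t))
    (smul_mul_assoc c (A.toOp.symm x) v)

@[simp] theorem ev_zetaLin (A : AlgFd k) (x : A.op) (a : A) :
    (yBim A).ev (zetaLin A (yel x)) (yel a) = A.op.toOp (A.toOp (A.toOp.symm x * a)) := rfl

theorem dual_yBim_ext {A : AlgFd k} {f g : (yBim A).dual}
    (h : ∀ a, (yBim A).ev f (yel a) = (yBim A).ev g (yel a)) : f = g :=
  Bim.dual_ext fun x => by obtain ⟨a, rfl⟩ := yel_surj x; exact h a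

/-- The map `A° ⟶ hom_A(A, A)`, `x ↦ (v ↦ x v)`. -/
def zetaHom (A : AlgFd k) : yBim A.op ⟶ (yBim A).dual :=
  Bim.ofLin (zetaLin A)
    (fun v x => by
      obtain ⟨v, rfl⟩ := yel_surj v
      obtain ⟨x, rfl⟩ := A.op.op.toOp.surjective x
      obtain ⟨x, rfl⟩ := A.op.toOp.surjective x
      refine dual_yBim_ext fun a => ?_
      rw [yel_act, ev_zetaLin, Bim.ev_dual_act, ev_zetaLin]
      obtain ⟨x, rfl⟩ := A.toOp.surjective x
      simp [mul_assoc])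
    (fun x v => by
      obtain ⟨v, rfl⟩ := yel_surj v
      refine dual_yBim_ext fun a => ?_
      simp [mul_assoc])

theorem zetaHom_bijective (A : AlgFd k) : Function.Bijective (Bim.lin (zetaHom A)) := by
  constructor
  · intro x y h
    obtain ⟨x, rfl⟩ := yel_surj x
    obtain ⟨y, rfl⟩ := yel_surj y
    have h' := congrArg (fun f => (yBim A).ev f (yel 1)) h
    change (yBim A).ev (zetaLin A _) _ = (yBim A).ev (zetaLin A _) _ at h'
    have : x = y := by simpa using h'
    rw [this]
  · intro f
    refine ⟨yel (A.op.toOp.symm ((yBim A).ev f (yel 1))), dual_yBim_ext fun a => ?_⟩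
    refine (ev_zetaLin A _ a).trans ?_
    have : yel a = (yBim A).act (yel 1) (A.op.toOp (A.toOp a)) := by rw [yel_act, one_mul]
    rw [this, Bim.ev_act]
    simp

/-- The isomorphism `A° ≅ hom_A(A, A)`, `x ↦ (v ↦ x v)`. -/
def zeta (A : AlgFd k) : yBim A.op ≅ (yBim A).dual :=
  Bim.isoOfR (RMod.isoOfBijective (Bim.toR (zetaHom A)) (zetaHom_bijective A))
    (Bim.lin_lact (zetaHom A))

variable (k) in
/-- The duality involution on the Morita bicategory. -/
def algDuality : DualityData (AlgFd k) where
  dual := circ k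
  y := yTrans k
  ζ A := zeta A

end

section

variable {k : Type u} [Field k]

/-! ### The duality structure on the representation pseudofunctor -/

namespace RMod

variable {A B C : AlgFd k}

theorem dmap_id (V : RMod A) : dmap (𝟙 V) = 𝟙 V.dual := by
  ext f; exact dual_ext fun m => by simp

theorem dmap_comp {M N P : RMod A} (f : M ⟶ N) (g : N ⟶ P) :
    dmap (f ≫ g) = dmap g ≫ dmap f := by
  ext f; exact dual_ext fun m => by simp

/-- The tensor product of two isomorphisms. -/
def mapIso {V W : RMod A} {M N : Bim A B} (f : V ≅ W) (g : M ≅ N) : V.tensor M ≅ W.tensor N where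
  hom := map f.hom g.hom
  inv := map f.inv g.inv
  hom_inv_id := by rw [← map_comp, f.hom_inv_id, g.hom_inv_id, map_id]
  inv_hom_id := by rw [← map_comp, f.inv_hom_id, g.inv_hom_id, map_id]

/-- The transpose of an isomorphism. -/
def dmapIso {V W : RMod A} (f : V ≅ W) : W.dual ≅ V.dual where
  hom := dmap f.hom
  inv := dmap f.inv
  hom_inv_id := by rw [← dmap_comp, f.inv_hom_id, dmap_id]
  inv_hom_id := by rw [← dmap_comp, f.hom_inv_id, dmap_id]

theorem dualTensor_nat₂ (V : RMod A) {M N : Bim A B} (g : N ⟶ M) :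
    dmap (map (𝟙 V) g) ≫ (dualTensor V N).inv =
      (dualTensor V M).inv ≫ map (𝟙 V.dual) (Bim.dmap g) := by
  rw [Iso.eq_inv_comp, ← Category.assoc, ← dualTensor_naturality, dmap_id]; simp

theorem dualTensor_id (V : RMod A) :
    (dualTensor V (Bim.one A)).inv ≫ map (𝟙 V.dual) (Bim.dualOne A).hom ≫
      (tensorOne V.dual).hom = dmap (tensorOne V).inv := by
  rw [Iso.inv_comp_eq]
  ext f g
  refine dual_ext fun m => ?_
  have h : ∀ b, (Bim.one A).ev g (el b) = (Bim.one A).ev g (el 1) * b := Bim.ev_el g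
  simp [← h, dualTensor_tmk]

theorem dualTensor_comp (V : RMod A) (M : Bim A B) (N : Bim B C) :
    (dualTensor V (M.tensor N)).inv ≫ map (𝟙 V.dual) (Bim.dualTensor M N).inv ≫
      (assoc V.dual M.dual N.dual).inv =
    dmap (assoc V M N).hom ≫ (dualTensor (V.tensor M) N).inv ≫
      map (dualTensor V M).inv (𝟙 N.dual) := by
  have h : map (dualTensor V M).hom (𝟙 N.dual) ≫ (dualTensor (V.tensor M) N).hom ≫
      dmap (assoc V M N).inv =
    (assoc V.dual M.dual N.dual).hom ≫ map (𝟙 V.dual) (Bim.dualTensor M N).hom ≫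
      (dualTensor V (M.tensor N)).hom := by
    ext f g h
    refine dual_ext_tensor_right fun v m n => ?_
    simp [dualTensor_tmk]
  have h1 := congrArg Iso.inv (Iso.ext h :
    mapIso (dualTensor V M) (Iso.refl N.dual) ≪≫ dualTensor (V.tensor M) N ≪≫
      dmapIso (assoc V M N).symm =
    assoc V.dual M.dual N.dual ≪≫ mapIso (Iso.refl V.dual) (Bim.dualTensor M N) ≪≫
      dualTensor V (M.tensor N))
  simp only [Iso.trans_inv, Category.assoc] at h1
  exact h1.symm

theorem dmap_add {V W : RMod A} (f g : V ⟶ W) : dmap (f + g) = dmap f + dmap g := by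
  ext p
  exact dual_ext fun v => map_add (ev W p) (lin f v) (lin g v)

theorem dmap_smul {V W : RMod A} (c : k) (f : V ⟶ W) : dmap (c • f) = c • dmap f := by
  ext p
  exact dual_ext fun v => map_smul (ev W p) c (lin f v)

theorem dualTensor_nat₁ {V W : RMod A} (f : V ⟶ W) (M : Bim A B) :
    map (dmap f) (𝟙 M.dual) ≫ (dualTensor V M).hom =
      (dualTensor W M).hom ≫ dmap (map f (𝟙 M)) := by
  rw [← dualTensor_naturality, Bim.dmap_id]

/-- The functor `V ↦ hom_A(V, A)`. -/
def dualFun (A : AlgFd k) : Rev (RMod A) ⥤ RMod A.op where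
  obj V := dual V
  map {V W} f := dmap (V := W) (W := V) f
  map_id V := dmap_id V
  map_comp {U V W} f g := dmap_comp (M := W) (N := V) (P := U) g f

instance (A : AlgFd k) : (dualFun A).Additive where
  map_add {V W f g} := dmap_add (V := W) (W := V) f g

instance (A : AlgFd k) : (dualFun A).Linear k where
  map_smul {V W} f c := dmap_smul (V := W) (W := V) c f

/-- The natural isomorphism `(V ⊗_A M)° ≅ V° ⊗ M°`. -/
def dualFunNat (M : Bim A B) :
    Rev.mapFun (tensorFun M) ⋙ dualFun B ≅ dualFun A ⋙ tensorFun M.dual :=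
  (NatIso.ofComponents (F := dualFun A ⋙ tensorFun M.dual)
    (G := Rev.mapFun (tensorFun M) ⋙ dualFun B)
    (fun V => dualTensor V M)
    (fun {V W} f => dualTensor_nat₁ (V := W) (W := V) f M)).symm

/-- The functor `V ↦ V°°`. -/
def doubleDual (A : AlgFd k) : RMod A ⥤ RMod A.op.op where
  obj V := V.dual.dual
  map f := dmap (dmap f)
  map_id V := by rw [dmap_id, dmap_id]
  map_comp f g := by rw [dmap_comp, dmap_comp]

/-- The natural isomorphism `V°° ≅ V ⊗_A A`. -/
def thetaNat (A : AlgFd k) : doubleDual A ≅ tensorFun (yBim A) :=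
  (NatIso.ofComponents (F := tensorFun (yBim A)) (G := doubleDual A)
    (fun V => psiTensor V)
    (fun {V W} f => by
      change map f (𝟙 (yBim A)) ≫ (psiTensor W).hom = (psiTensor V).hom ≫ dmap (dmap f)
      ext v x
      obtain ⟨a, rfl⟩ := yel_surj x
      simp [lin_act])).symm

end RMod

variable [IsAlgClosed k]

namespace ModRep

open Co

variable {A B C : AlgFd k}

/-- The functor `V ↦ hom_A(V, A)`. -/
def iFun (A : AlgFd k) : (obj A).op.carrier ⥤ (obj A.op).carrier := RMod.dualFun A

instance (A : AlgFd k) : (iFun A).Additive := inferInstanceAs (RMod.dualFun A).Additive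

instance (A : AlgFd k) : (iFun A).Linear k := inferInstanceAs ((RMod.dualFun A).Linear k)

/-- The 1-morphism `V ↦ hom_A(V, A)`. -/
def i (A : AlgFd k) : (obj A).op ⟶ obj A.op :=
  KVHom.mk' (C := (obj A).op) (D := obj A.op) (iFun A)

/-- The 2-morphism `(V ⊗_A M)° ≅ V° ⊗ M°`. -/
def iNat (M : Bim A B) :
    KV.opMap (map (A := A) (B := B) M) ≫ i B ≅ i A ≫ map (A := A.op) (B := B.op) M.dual :=
  KVHom.ofNtIso (C := (obj A).op) (D := obj B.op)
    (F := KV.opMap (map (A := A) (B := B) M) ≫ i B)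
    (G := i A ≫ map (A := A.op) (B := B.op) M.dual) (RMod.dualFunNat M)

variable (k) in
/-- The pseudonatural transformation with components `V ↦ hom_A(V, A)`. -/
def iTrans : (coMap (modRep k)).comp (KV.opFunctor k) ⟶ (circ k).comp (modRep k) where
  app A := i A.un
  naturality M := iNat (dn M)
  naturality_naturality {A B M N} η := KVHom.hom_ext fun V =>
    RMod.dualTensor_nat₂ (A := A.un) (B := B.un) V (M := dn M) (N := dn N) (dn₂ η)
  naturality_id A := KVHom.hom_ext fun V => by
    refine (RMod.dualTensor_id (A := A.un) V).trans ?_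
    refine (Category.comp_id _).symm.trans (congrArg₂ (· ≫ ·) ?_ (Category.comp_id _).symm)
    exact congrArg (RMod.dualFun A.un).map
      (Category.comp_id (obj := (obj A.un).op.carrier) (RMod.tensorOne (A := A.un) V).inv).symm
  naturality_comp {A B C} M N := KVHom.hom_ext fun V => by
    refine (RMod.dualTensor_comp (A := A.un) (B := B.un) (C := C.un) V (dn M) (dn N)).trans ?_
    refine congrArg₂ (· ≫ ·) ?_ ((Category.id_comp _).trans (congrArg (_ ≫ ·)
      ((Category.id_comp _).trans (Category.comp_id _)))).symm
    exact congrArg (RMod.dualFun C.un).map (Category.comp_id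
      (obj := (obj C.un).op.carrier)
      (RMod.assoc (A := A.un) (B := B.un) (C := C.un) V (dn M) (dn N)).hom).symm

end ModRep

variable (k) in
/-- The duality structure on the representation pseudofunctor. -/
def repDuality : DualityFunctorData (algDuality k) (kvDuality k) (modRep k) where
  i := ModRep.iTrans k
  θ A := KVHom.ofNtIso (C := ModRep.obj A) (D := ModRep.obj A.op.op)
    (F := KV.y (ModRep.obj A) ≫ KV.opMap (ModRep.i A) ≫ ModRep.i A.op)
    (G := ModRep.map (A := A) (B := A.op.op) (yBim A)) (RMod.thetaNat A)

end

end

noncomputable section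

/-! ### Strong transformations whose components are equivalences -/

section

universe w v w₁ v₁ u₁ w₂ v₂ u₂

section Mates

variable {B : Type u} [Bicategory.{w, v} B] {c d e f : B} {g g' : c ⟶ e} {h h' : d ⟶ f}
  {l₁ : c ⟶ d} {r₁ : d ⟶ c} {l₂ : e ⟶ f} {r₂ : f ⟶ e} (adj₁ : l₁ ⊣ r₁) (adj₂ : l₂ ⊣ r₂)

theorem mateEquiv_whiskerLeft (α : g ≫ l₂ ⟶ l₁ ≫ h) (β : h ⟶ h') :
    mateEquiv adj₁ adj₂ (α ≫ l₁ ◁ β) = mateEquiv adj₁ adj₂ α ≫ β ▷ r₂ := by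
  simp only [mateEquiv_apply']
  calc
    _ = 𝟙 _ ⊗≫ r₁ ◁ g ◁ adj₂.unit ⊗≫ r₁ ◁ α ▷ r₂ ⊗≫
          ((r₁ ≫ l₁) ◁ β ≫ adj₁.counit ▷ h') ▷ r₂ ⊗≫ 𝟙 _ := by bicategory
    _ = _ := by rw [whisker_exchange]; bicategory

theorem mateEquiv_whiskerRight (α : g' ≫ l₂ ⟶ l₁ ≫ h) (β : g ⟶ g') :
    mateEquiv adj₁ adj₂ (β ▷ l₂ ≫ α) = r₁ ◁ β ≫ mateEquiv adj₁ adj₂ α := by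
  simp only [mateEquiv_apply']
  calc
    _ = 𝟙 _ ⊗≫ r₁ ◁ (g ◁ adj₂.unit ≫ β ▷ (l₂ ≫ r₂)) ⊗≫ r₁ ◁ α ▷ r₂ ⊗≫
          adj₁.counit ▷ h ▷ r₂ ⊗≫ 𝟙 _ := by bicategory
    _ = _ := by rw [whisker_exchange]; bicategory

theorem mateEquiv_unitors :
    mateEquiv adj₁ adj₁ ((λ_ l₁).hom ≫ (ρ_ l₁).inv) = (ρ_ r₁).hom ≫ (λ_ r₁).inv := by
  rw [← adj₁.right_triangle, mateEquiv_apply']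
  bicategory

theorem mateEquiv_whiskerRight_counit (α : g ≫ l₂ ⟶ l₁ ≫ h) :
    mateEquiv adj₁ adj₂ α ▷ l₂ ≫ (α_ _ _ _).hom ≫ h ◁ adj₂.counit ≫ (ρ_ _).hom =
      (α_ _ _ _).hom ≫ r₁ ◁ α ≫ (α_ _ _ _).inv ≫ adj₁.counit ▷ h ≫ (λ_ _).hom := by
  rw [mateEquiv_apply']
  calc
    _ = 𝟙 _ ⊗≫ r₁ ◁ g ◁ adj₂.unit ▷ l₂ ⊗≫ r₁ ◁ α ▷ (r₂ ≫ l₂) ⊗≫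
          (adj₁.counit ▷ (h ≫ r₂ ≫ l₂) ≫ 𝟙 d ◁ h ◁ adj₂.counit) ⊗≫ 𝟙 _ := by bicategory
    _ = 𝟙 _ ⊗≫ r₁ ◁ g ◁ adj₂.unit ▷ l₂ ⊗≫ r₁ ◁ (α ▷ (r₂ ≫ l₂) ≫
          (l₁ ≫ h) ◁ adj₂.counit) ⊗≫ adj₁.counit ▷ h ⊗≫ 𝟙 _ := by
      rw [← whisker_exchange]; bicategory
    _ = 𝟙 _ ⊗≫ r₁ ◁ g ◁ leftZigzag adj₂.unit adj₂.counit ⊗≫ r₁ ◁ α ⊗≫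
          adj₁.counit ▷ h ⊗≫ 𝟙 _ := by
      rw [← whisker_exchange]; bicategory
    _ = _ := by rw [adj₂.left_triangle]; bicategory

theorem whiskerLeft_mateEquiv (α : g ≫ l₂ ⟶ l₁ ≫ h) :
    (λ_ _).inv ≫ adj₁.unit ▷ _ ≫ (α_ _ _ _).hom ≫ l₁ ◁ mateEquiv adj₁ adj₂ α =
      (ρ_ _).inv ≫ g ◁ adj₂.unit ≫ (α_ _ _ _).inv ≫ α ▷ r₂ ≫ (α_ _ _ _).hom := by
  have := (mateEquiv_eq_iff adj₁ adj₂ α _).1 rfl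
  rw [Adjunction.homEquiv₁_symm_apply, Adjunction.homEquiv₂_apply] at this
  simpa using this

end Mates

/-- The adjunction underlying an adjoint equivalence. -/
def CategoryTheory.Bicategory.Equivalence.adj {B : Type u} [Bicategory.{w, v} B] {a b : B}
    (e : Bicategory.Equivalence a b) : e.hom ⊣ e.inv where
  unit := e.unit.hom
  counit := e.counit.hom
  left_triangle := e.left_triangle_hom
  right_triangle := e.right_triangle_hom

section

variable {A : Type u₁} [Bicategory.{w₁, v₁} A] {B : Type u₂} [Bicategory.{w₂, v₂} B]
  {F G : A ⥤ᵖ B}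

/-- A strong transformation together with an adjoint equivalence on each of its components. -/
structure EquivFamily (F G : A ⥤ᵖ B) where
  η : F ⟶ G
  inv : ∀ a, G.obj a ⟶ F.obj a
  unit : ∀ a, 𝟙 (F.obj a) ≅ η.app a ≫ inv a
  counit : ∀ a, inv a ≫ η.app a ≅ 𝟙 (G.obj a)
  adj : ∀ a, η.app a ⊣ inv a
  adj_unit : ∀ a, (adj a).unit = (unit a).hom
  adj_counit : ∀ a, (adj a).counit = (counit a).hom

namespace EquivFamily

variable (E : EquivFamily F G)

/-- The inverse of the mate of a naturality cell. -/
def nat {a b : A} (f : a ⟶ b) : G.map f ≫ E.inv b ≅ E.inv a ≫ F.map f :=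
  (λ_ _).symm ≪≫ whiskerRightIso (E.counit a).symm _ ≪≫ α_ _ _ _ ≪≫
    whiskerLeftIso (E.inv a) ((α_ _ _ _).symm ≪≫
      whiskerRightIso (E.η.naturality f).symm (E.inv b) ≪≫ α_ _ _ _ ≪≫
      whiskerLeftIso (F.map f) (E.unit b).symm ≪≫ ρ_ _)

theorem nat_inv {a b : A} (f : a ⟶ b) :
    (E.nat f).inv = mateEquiv (E.adj a) (E.adj b) (E.η.naturality f).hom := by
  rw [mateEquiv_apply', adj_unit, adj_counit]
  simp only [nat, Iso.trans_inv, Iso.symm_inv, whiskerRightIso_inv, whiskerLeftIso_inv]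
  bicategory

/-- The inverse transformation. -/
def invTrans : G ⟶ F where
  app := E.inv
  naturality f := E.nat f
  naturality_naturality {a b f g} θ := by
    rw [← Iso.inv_comp_eq, ← Category.assoc, ← Iso.eq_comp_inv, nat_inv, nat_inv,
      ← mateEquiv_whiskerLeft, ← mateEquiv_whiskerRight, E.η.naturality_naturality]
  naturality_id a := by
    have h := congrArg (mateEquiv (E.adj a) (E.adj a)) (E.η.naturality_id a)
    rw [mateEquiv_whiskerLeft, mateEquiv_whiskerRight, mateEquiv_unitors, ← nat_inv,
      Iso.inv_comp_eq] at h
    rw [← Category.assoc ((G.mapId a).hom ▷ _), h]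
    simp
  naturality_comp {a b c} f g := by
    have h := congrArg (mateEquiv (E.adj a) (E.adj c)) (E.η.naturality_comp f g)
    have h' := mateEquiv_vcomp (E.adj a) (E.adj b) (E.adj c) (E.η.naturality f).hom
      (E.η.naturality g).hom
    rw [leftAdjointSquare.vcomp] at h'
    rw [mateEquiv_whiskerLeft, mateEquiv_whiskerRight, h', rightAdjointSquare.vcomp, ← nat_inv,
      ← nat_inv, ← nat_inv, Iso.inv_comp_eq] at h
    rw [h]
    simp

theorem unit_naturality {a b : A} (f : a ⟶ b) :
    F.map f ◁ (E.unit b).hom ≫ ((E.η ≫ E.invTrans).naturality f).hom =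
      ((𝟙 F : F ⟶ F).naturality f).hom ≫ (E.unit a).hom ▷ F.map f := by
  have h := whiskerLeft_mateEquiv (E.adj a) (E.adj b) (E.η.naturality f).hom
  rw [← nat_inv, adj_unit, adj_unit] at h
  change _ ≫ (α_ _ _ _).inv ≫ (E.η.naturality f).hom ▷ E.inv b ≫ (α_ _ _ _).hom ≫
    E.η.app a ◁ (E.nat f).hom ≫ (α_ _ _ _).inv =
      ((ρ_ (F.map f)).hom ≫ (λ_ (F.map f)).inv) ≫ (E.unit a).hom ▷ F.map f
  have h1 := congrArg (fun t => (ρ_ (F.map f)).hom ≫ t ≫ E.η.app a ◁ (E.nat f).hom ≫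
    (α_ _ _ _).inv) h
  simp only [Category.assoc, Iso.hom_inv_id_assoc, whiskerLeft_inv_hom_assoc,
    Iso.hom_inv_id, Category.comp_id] at h1
  rw [Category.assoc]
  exact h1.symm

theorem counit_naturality {a b : A} (f : a ⟶ b) :
    G.map f ◁ (E.counit b).hom ≫ ((𝟙 G : G ⟶ G).naturality f).hom =
      ((E.invTrans ≫ E.η).naturality f).hom ≫ (E.counit a).hom ▷ G.map f := by
  have h := mateEquiv_whiskerRight_counit (E.adj a) (E.adj b) (E.η.naturality f).hom
  rw [← nat_inv, adj_counit, adj_counit] at h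
  change _ ≫ (ρ_ (G.map f)).hom ≫ (λ_ (G.map f)).inv =
    ((α_ _ _ _).inv ≫ (E.nat f).hom ▷ E.η.app b ≫ (α_ _ _ _).hom ≫
      E.inv a ◁ (E.η.naturality f).hom ≫ (α_ _ _ _).inv) ≫ (E.counit a).hom ▷ G.map f
  have h1 := congrArg (fun t => (α_ _ _ _).inv ≫ (E.nat f).hom ▷ E.η.app b ≫ t ≫
    (λ_ (G.map f)).inv) h
  simp only [Category.assoc, hom_inv_whiskerRight_assoc, Iso.inv_hom_id_assoc,
    Iso.hom_inv_id, Category.comp_id] at h1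
  simp only [Category.assoc]
  exact h1

/-- The adjoint equivalence of pseudofunctors. -/
def equivalence : Bicategory.Equivalence F G :=
  .mkOfAdjointifyCounit (f := E.η) (g := E.invTrans)
    (Pseudofunctor.StrongTrans.isoMk E.unit fun f => E.unit_naturality f)
    (Pseudofunctor.StrongTrans.isoMk E.counit fun f => E.counit_naturality f)

end EquivFamily

/-- A strong transformation whose components are equivalences is part of an adjoint equivalence. -/
theorem exists_equivalence_of_app (η : F ⟶ G)
    (h : ∀ a, ∃ e : Bicategory.Equivalence (F.obj a) (G.obj a), e.hom = η.app a) :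
    ∃ e : Bicategory.Equivalence F G, e.hom = η := by
  have h' : ∀ a, ∃ (g : G.obj a ⟶ F.obj a) (u : 𝟙 (F.obj a) ≅ η.app a ≫ g)
      (c : g ≫ η.app a ≅ 𝟙 (G.obj a)) (adj : η.app a ⊣ g),
      adj.unit = u.hom ∧ adj.counit = c.hom := by
    intro a
    obtain ⟨e, he⟩ := h a
    rw [← he]
    exact ⟨e.inv, e.unit, e.counit, e.adj, rfl, rfl⟩
  choose g u c adj hu hc using h'
  exact ⟨EquivFamily.equivalence ⟨η, g, u, c, adj, hu, hc⟩, rfl⟩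

end

end

/-! ### The duality involution on the Morita bicategory -/

section

variable {k : Type u} [Field k] {A B C : AlgFd k}

@[simp] theorem zeta_hom_yel (A : AlgFd k) (x : A.op) :
    Bim.lin (zeta A).hom (yel x) = zetaLin A (yel x) := rfl

/-- `A` as a bimodule from its double opposite to `A`. -/
def yBimInv (A : AlgFd k) : Bim A.op.op A where
  carrier := A
  act := LinearMap.mul k A
  act_one v := mul_one (M := A) v
  act_mul v a b := (mul_assoc (G := A) v a b).symm
  lact := LinearMap.mul k A ∘ₗ A.toOp.symm.toLinearMap ∘ₗ A.op.toOp.symm.toLinearMap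
  one_lact v := one_mul (M := A) v
  mul_lact _ _ v := mul_assoc (G := A) _ _ v
  lact_act _ m b := mul_assoc (G := A) _ m b

/-- The element `a` of the bimodule `yBimInv A`. -/
def yelInv : A →ₗ[k] yBimInv A := LinearMap.id

theorem yelInv_surj (x : yBimInv A) : ∃ a : A, yelInv a = x := ⟨x, rfl⟩

@[simp] theorem yelInv_lact (a b : A) :
    (yBimInv A).lact (A.op.toOp (A.toOp b)) (yelInv a) = yelInv (b * a) := rfl

namespace Bim

open RMod (el el_surj)

/-- The isomorphism `A ≅ A ⊗ A` expressing that `yBimInv A` is right inverse to `yBim A`. -/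
def yUnit (A : AlgFd k) : one A ≅ (yBim A).tensor (yBimInv A) :=
  isoOfR (M := one A) (yTensor (yBimInv A)) fun a x => by
    obtain ⟨b, rfl⟩ := RMod.el_surj x
    change tmk (yBim A) (yBimInv A) (yel 1) (yelInv (a * b)) =
      ((yBim A).tensor (yBimInv A)).lact a (tmk (yBim A) (yBimInv A) (yel 1) (yelInv b))
    rw [tensor_lact, yel_lact, mul_one, tmk_yel _ a, yelInv_lact]

/-- The intertwiner `A ⊗ A ⟶ A°°`, `a ⊗ b ↦ ab`. -/
def yCounitHom (A : AlgFd k) : (yBimInv A).tensor (yBim A) ⟶ one A.op.op :=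
  thom (M := yBimInv A) (N := yBim A) (P := one A.op.op)
    ((LinearMap.mul k A).compr₂ (el ∘ₗ A.op.toOp.toLinearMap ∘ₗ A.toOp.toLinearMap))
    (fun x a y => by
      obtain ⟨x, rfl⟩ := yelInv_surj x
      obtain ⟨y, rfl⟩ := yel_surj y
      exact congrArg (fun t => el (A.op.toOp (A.toOp t))) (mul_assoc (G := A) x a y))
    (fun x y c => by
      obtain ⟨x, rfl⟩ := yelInv_surj x
      obtain ⟨y, rfl⟩ := yel_surj y
      obtain ⟨c, rfl⟩ := A.op.toOp.surjective c
      obtain ⟨c, rfl⟩ := A.toOp.surjective c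
      exact congrArg (fun t => el (A.op.toOp (A.toOp t))) (mul_assoc (G := A) x y c).symm)
    (fun c x y => by
      obtain ⟨x, rfl⟩ := yelInv_surj x
      obtain ⟨y, rfl⟩ := yel_surj y
      obtain ⟨c, rfl⟩ := A.op.toOp.surjective c
      obtain ⟨c, rfl⟩ := A.toOp.surjective c
      exact congrArg (fun t => el (A.op.toOp (A.toOp t))) (mul_assoc (G := A) c x y))

theorem yCounitHom_bijective (A : AlgFd k) : Function.Bijective (lin (yCounitHom A)) := by
  have h : ∀ t, lin (yCounitHom A) t =
      el (A.op.toOp (A.toOp (RMod.tensorY (yBimInv A).toRMod t))) := fun t => by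
    refine LinearMap.congr_fun (f := lin (yCounitHom A)) (g := el ∘ₗ A.op.toOp.toLinearMap ∘ₗ
      A.toOp.toLinearMap ∘ₗ RMod.tensorY (yBimInv A).toRMod) (tensor_ext fun x y => ?_) t
    refine (lin_thom_tmk (M := yBimInv A) (N := yBim A) (P := one A.op.op) _ _ _ _ x y).trans ?_
    exact congrArg (fun t => el (A.op.toOp (A.toOp t)))
      (RMod.tensorY_tmk (yBimInv A).toRMod x y).symm
  have h' : ⇑(lin (yCounitHom A)) = ⇑(A.op.toOp) ∘ ⇑(A.toOp) ∘
    ⇑(RMod.tensorY (yBimInv A).toRMod) := funext h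
  rw [h']
  exact A.op.toOp.bijective.comp (A.toOp.bijective.comp (RMod.tensorY_bijective _))

/-- The isomorphism `A ⊗ A ≅ A°°` expressing that `yBimInv A` is left inverse to `yBim A`. -/
def yCounit (A : AlgFd k) : (yBimInv A).tensor (yBim A) ≅ one A.op.op :=
  isoOfR (RMod.isoOfBijective (toR (yCounitHom A)) (yCounitHom_bijective A))
    (lin_lact (yCounitHom A))

theorem zeta_naturality (M : Bim A B) :
    map (𝟙 M.dual) (zeta B).hom ≫ (dualTensor M (yBim B)).hom ≫ dmap (yNat M).inv ≫
      (dualTensor (yBim A) M.dual.dual).inv =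
    (yNat M.dual).hom ≫ map (zeta A).hom (𝟙 M.dual.dual.dual) := by
  have h : map (𝟙 M.dual) (zeta B).hom ≫ (dualTensor M (yBim B)).hom =
      (yNat M.dual).hom ≫ map (zeta A).hom (𝟙 M.dual.dual.dual) ≫
        (dualTensor (yBim A) M.dual.dual).hom ≫ dmap (yNat M).hom := by
    ext f x
    obtain ⟨x, rfl⟩ := yel_surj x
    refine dual_ext_tensor fun m y => ?_
    obtain ⟨b, rfl⟩ := yel_surj y
    simp [mul_assoc, M.one_lact]
  have h' : dmap (yNat M).hom ≫ dmap (yNat M).inv = 𝟙 _ := by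
    rw [← dmap_comp, Iso.inv_hom_id, dmap_id]
  rw [← Category.assoc, h]
  simp only [Category.assoc]
  rw [← Category.assoc (dmap _), h']
  simp

theorem zeta_coherence (A : AlgFd k) :
    map (𝟙 (yBim A)) (zeta A.op).hom =
      (yNat (yBim A)).hom ≫ map (𝟙 (yBim A)) (dmap (zeta A).hom) := by
  ext x y
  obtain ⟨a, rfl⟩ := yel_surj x
  obtain ⟨b, rfl⟩ := yel_surj y
  simp only [lin_comp, LinearMap.comp_apply, yNat_tmk, map_tmk, lin_id, LinearMap.id_apply,
    zeta_hom_yel]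
  rw [tmk_yel _ a]
  refine congrArg _ (dual_ext fun z => ?_)
  obtain ⟨c, rfl⟩ := yel_surj z
  obtain ⟨b, rfl⟩ := A.op.toOp.surjective b
  obtain ⟨b, rfl⟩ := A.toOp.surjective b
  obtain ⟨c, rfl⟩ := A.toOp.surjective c
  simp [mul_assoc]

end Bim

theorem algDuality_isWeakDualityInvolution (k : Type u) [Field k] :
    (algDuality k).IsWeakDualityInvolution where
  y_equiv := exists_equivalence_of_app _ fun A =>
    ⟨.mkOfAdjointifyCounit (B := AlgFd k) (f := yBim A) (g := yBimInv A) (Bim.yUnit A)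
      (Bim.yCounit A), rfl⟩
  ζ_natural M := Bim.zeta_naturality M
  coherence A := Bim.zeta_coherence A

end

/-! ### The duality involution on Kapranov-Voevodsky vector spaces -/

section

variable {k : Type u} [Field k]

namespace KV

theorem y_equivalence (C : KV k) :
    ∃ e : Bicategory.Equivalence C C.op.op, e.hom = y C := ⟨.id C, rfl⟩

instance : Bicategory.Strict (KV k) where
  id_comp _ := rfl
  comp_id _ := rfl
  assoc _ _ _ := rfl
  leftUnitor_eqToIso _ := rfl
  rightUnitor_eqToIso _ := rfl
  associator_eqToIso _ _ _ := rfl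

end KV

theorem kvDuality_isWeakDualityInvolution (k : Type u) [Field k] :
    (kvDuality k).IsWeakDualityInvolution where
  y_equiv := exists_equivalence_of_app _ fun C => KV.y_equivalence C
  ζ_natural {C D} F := KVHom.hom_ext fun X => by
    have h : ∀ Z : D.op.op.op.carrier, 𝟙 Z ≫ 𝟙 Z ≫ 𝟙 Z ≫ 𝟙 Z = 𝟙 Z ≫ 𝟙 Z := fun Z => by simp
    refine (h ((KVHom.functor (KV.opMap F)).obj X)).trans ?_
    exact congrArg (𝟙 _ ≫ ·)
      ((KVHom.functor (KV.opMap (KV.opMap (KV.opMap F)))).map_id X).symm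
  coherence C := KVHom.hom_ext fun X => by
    have h : ∀ Z : C.carrier, 𝟙 Z = 𝟙 Z ≫ 𝟙 Z := fun Z => by simp
    exact h X

theorem kvDuality_isStrictDualityInvolution (k : Type u) [Field k] :
    (kvDuality k).IsStrictDualityInvolution where
  toIsWeakDualityInvolution := kvDuality_isWeakDualityInvolution k
  strict := inferInstance
  map_id _ := rfl
  mapId_eq _ := rfl
  map_comp _ _ := rfl
  mapComp_eq _ _ := rfl
  dual_dual _ := rfl
  y_eq_id _ := HEq.rfl
  y_naturality _ := rfl
  yNat_eq _ := rfl
  y_dual _ := rfl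
  ζ_eq _ := rfl

end

/-! ### Representations as a duality pseudofunctor -/

section

variable {k : Type u} [Field k]

namespace KV

/-- An exact linear functor that is an equivalence of categories is part of an adjoint
equivalence. -/
theorem exists_equivalence_of_isEquivalence {C D : KV k} (F : C ⟶ D)
    [(KVHom.functor F).IsEquivalence] : ∃ e : Bicategory.Equivalence C D, e.hom = F := by
  let E := (KVHom.functor F).asEquivalence
  have : E.functor.Additive := inferInstanceAs (KVHom.functor F).Additive
  have : E.functor.Linear k := inferInstanceAs ((KVHom.functor F).Linear k)
  have : E.inverse.Additive := inferInstance
  have : E.inverse.Linear k := E.inverseLinear k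
  let G : D ⟶ C := KVHom.mk' (C := D) (D := C) E.inverse
  exact ⟨.mkOfAdjointifyCounit (f := F) (g := G)
    (KVHom.ofNtIso (C := C) (D := C) (F := 𝟙 C) (G := F ≫ G) E.unitIso)
    (KVHom.ofNtIso (C := D) (D := D) (F := G ≫ F) (G := 𝟙 D) E.counitIso), rfl⟩

end KV

namespace RMod

variable {A B C : AlgFd k}

instance (A : AlgFd k) : (dualFun A).Faithful where
  map_injective {V W f g} h := by
    let f' : (show RMod A from W) ⟶ (show RMod A from V) := f
    let g' : (show RMod A from W) ⟶ (show RMod A from V) := g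
    change f' = g'
    have h' : dmap f' = dmap g' := h
    ext w
    apply (psi_bijective _).1
    rw [← dmap_dmap_psi, ← dmap_dmap_psi, h']

theorem dmap_surjective {V W : RMod A} (φ : V.dual ⟶ W.dual) : ∃ f : W ⟶ V, dmap f = φ := by
  let e := LinearEquiv.ofBijective V.psi V.psi_bijective
  have he : ∀ x, V.psi (e.symm x) = x := fun x => e.apply_symm_apply x
  refine ⟨ofLin (e.symm.toLinearMap ∘ₗ lin (dmap φ) ∘ₗ W.psi) (fun w a => ?_), ?_⟩
  · apply V.psi_bijective.1
    rw [psi_act]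
    simp only [LinearMap.comp_apply, LinearEquiv.coe_coe, he, psi_act, lin_act]
  · ext f
    refine dual_ext fun w => A.toOp.injective ?_
    rw [ev_dmap, lin_ofLin, ← ev_psi]
    simp only [LinearMap.comp_apply, LinearEquiv.coe_coe, he]
    rw [ev_dmap, ev_psi]

instance (A : AlgFd k) : (dualFun A).Full where
  map_surjective {V W} φ := dmap_surjective (V := show RMod A from V) (W := show RMod A from W) φ

/-- A module over the double opposite of `A`, as a module over `A`. -/
def ofOpOp (V : RMod A.op.op) : RMod A where
  carrier := V
  act := V.act.compl₂ (A.op.toOp.toLinearMap ∘ₗ A.toOp.toLinearMap)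
  act_one v := V.act_one v
  act_mul v a b := V.act_mul v (A.op.toOp (A.toOp a)) (A.op.toOp (A.toOp b))

/-- The identity, as a map to the module over `A`. -/
def toOfOpOp (V : RMod A.op.op) : V ≃ₗ[k] ofOpOp V := LinearEquiv.refl k V

@[simp] theorem toOfOpOp_symm_act (V : RMod A.op.op) (v : ofOpOp V) (a : A) :
    (toOfOpOp V).symm ((ofOpOp V).act v a) =
      V.act ((toOfOpOp V).symm v) (A.op.toOp (A.toOp a)) := rfl

theorem toOfOpOp_act (V : RMod A.op.op) (v : V) (a : A) :
    toOfOpOp V (V.act v (A.op.toOp (A.toOp a))) = (ofOpOp V).act (toOfOpOp V v) a := rfl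

/-- The evaluation map from a module over the opposite algebra to the dual of its dual. -/
def toDualOfOpOp (V : RMod A.op) : V ⟶ (ofOpOp V.dual).dual :=
  ofLin
    { toFun := fun v => dmk (ofOpOp V.dual)
        (A.toOp.symm.toLinearMap ∘ₗ V.ev.flip v ∘ₗ (toOfOpOp V.dual).symm.toLinearMap)
        (fun f a => by simp)
      map_add' := fun v w => dual_ext fun f =>
        map_add (A.toOp.symm.toLinearMap ∘ₗ V.ev ((toOfOpOp V.dual).symm f)) v w
      map_smul' := fun c v => dual_ext fun f =>
        map_smul (A.toOp.symm.toLinearMap ∘ₗ V.ev ((toOfOpOp V.dual).symm f)) c v }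
    (fun v x => dual_ext fun f =>
      congrArg A.toOp.symm (V.ev_act ((toOfOpOp V.dual).symm f) v x))

theorem ev_toDualOfOpOp (V : RMod A.op) (v : V) (f : V.dual) :
    (ofOpOp V.dual).ev (lin (toDualOfOpOp V) v) (toOfOpOp V.dual f) = A.toOp.symm (V.ev f v) := rfl

theorem toDualOfOpOp_bijective (V : RMod A.op) : Function.Bijective (lin (toDualOfOpOp V)) := by
  constructor
  · intro v w h
    refine V.psi_bijective.1 (dual_ext fun f => ?_)
    have := congrArg (fun t => (ofOpOp V.dual).ev t (toOfOpOp V.dual f)) h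
    rw [ev_psi, ev_psi]
    exact congrArg A.op.toOp (A.toOp.symm.injective this)
  · intro φ
    obtain ⟨v, hv⟩ := V.psi_bijective.2 (dmk V.dual (A.op.toOp.toLinearMap ∘ₗ
      A.toOp.toLinearMap ∘ₗ (ofOpOp V.dual).ev φ ∘ₗ (toOfOpOp V.dual).toLinearMap) (fun f x => by
        obtain ⟨x, rfl⟩ := A.op.toOp.surjective x
        obtain ⟨x, rfl⟩ := A.toOp.surjective x
        simp only [LinearMap.comp_apply, LinearEquiv.coe_coe, toOfOpOp_act, ev_act,
          AlgFd.toOp_mul]))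
    refine ⟨v, dual_ext fun f => ?_⟩
    obtain ⟨f, rfl⟩ := (toOfOpOp V.dual).surjective f
    rw [ev_toDualOfOpOp, LinearEquiv.symm_apply_eq]
    apply A.op.toOp.injective
    rw [← ev_psi, hv]
    rfl

/-- Every module over the opposite algebra is a dual. -/
def isoDual (V : RMod A.op) : (ofOpOp V.dual).dual ≅ V :=
  (isoOfBijective (toDualOfOpOp V) (toDualOfOpOp_bijective V)).symm

instance (A : AlgFd k) : (dualFun A).EssSurj where
  mem_essImage V := ⟨ofOpOp V.dual, ⟨isoDual V⟩⟩

instance (A : AlgFd k) : (dualFun A).IsEquivalence where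

theorem dual_dualTensor (V : RMod A) (M : Bim A B) (v : V) (m : M) :
    lin (dualTensor V.dual M.dual).inv (lin (dmap (dualTensor V M).hom)
      ((V.tensor M).psi (tmk V M v m))) = tmk _ _ (V.psi v) (M.psi m) := by
  have h : lin (dmap (dualTensor V M).hom) ((V.tensor M).psi (tmk V M v m)) =
      lin (dualTensor V.dual M.dual).hom (tmk _ _ (V.psi v) (M.psi m)) := by
    refine dual_ext_tensor fun f g => ?_
    simp [dualTensor_tmk]
  rw [h, ← LinearMap.comp_apply, ← lin_comp, Iso.hom_inv_id]
  rfl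

theorem psiTensor_naturality (V : RMod A) (M : Bim A B) :
    (psiTensor (V.tensor M)).inv ≫ (assoc V M (yBim B)).hom ≫ map (𝟙 V) (Bim.yNat M).hom ≫
      (assoc V (yBim A) M.dual.dual).inv =
    dmap (dualTensor V M).hom ≫ (dualTensor V.dual M.dual).inv ≫
      map (psiTensor V).inv (𝟙 M.dual.dual) := by
  rw [Iso.inv_comp_eq]
  have h : map (psiTensor V).inv (𝟙 M.dual.dual) ≫ map (psiTensor V).hom (𝟙 M.dual.dual) = 𝟙 _ := by
    rw [← map_comp]; simp [map_id]
  have h' : map (psiTensor V).hom (𝟙 M.dual.dual) ≫ map (psiTensor V).inv (𝟙 M.dual.dual) = 𝟙 _ := by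
    rw [← map_comp]; simp [map_id]
  have key : ((assoc V M (yBim B)).hom ≫ map (𝟙 V) (Bim.yNat M).hom ≫
      (assoc V (yBim A) M.dual.dual).inv) ≫ map (psiTensor V).hom (𝟙 M.dual.dual) =
      (psiTensor (V.tensor M)).hom ≫ dmap (dualTensor V M).hom ≫
        (dualTensor V.dual M.dual).inv := by
    ext v m x
    obtain ⟨b, rfl⟩ := yel_surj x
    simp [dual_dualTensor, V.act_one]
  have := congrArg (· ≫ map (psiTensor V).inv (𝟙 M.dual.dual)) key
  simpa only [Category.assoc, h', Category.comp_id] using this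

theorem psiTensor_coherence (V : RMod A) :
    (psiTensor V.dual).inv ≫ map (𝟙 V.dual) (zeta A).hom =
      dmap (psiTensor V).hom ≫ (dualTensor V (yBim A)).inv := by
  rw [Iso.inv_comp_eq, ← Category.assoc, Iso.eq_comp_inv]
  ext f x
  obtain ⟨x, rfl⟩ := yel_surj x
  refine dual_ext_tensor fun v y => ?_
  obtain ⟨a, rfl⟩ := yel_surj y
  simp [dualTensor_tmk, mul_assoc]

end RMod

variable [IsAlgClosed k]

theorem ModRep.i_equivalence (A : AlgFd k) :
    ∃ e : Bicategory.Equivalence (ModRep.obj A).op (ModRep.obj A.op), e.hom = ModRep.i A := by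
  have : (KVHom.functor (ModRep.i A)).IsEquivalence :=
    inferInstanceAs (RMod.dualFun A).IsEquivalence
  exact KV.exists_equivalence_of_isEquivalence _

theorem repDuality_isDualityPseudofunctor (k : Type u) [Field k] [IsAlgClosed k] :
    (repDuality k).IsDualityPseudofunctor where
  i_equiv := exists_equivalence_of_app _ fun A => ModRep.i_equivalence A.un
  θ_natural {A B} M := KVHom.hom_ext fun V => by
    refine (RMod.psiTensor_naturality (A := A) (B := B) V M).trans ?_
    have h : RMod.dmap (RMod.dualTensor (A := A) (B := B) V M).hom ≫
        (RMod.dualTensor (RMod.dual V) (Bim.dual M)).inv ≫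
          RMod.map (RMod.psiTensor V).inv (𝟙 (Bim.dual (Bim.dual M))) =
      (𝟙 _ ≫ RMod.dmap (RMod.dmap (𝟙 _)) ≫ 𝟙 _ ≫ (𝟙 _ ≫
        RMod.dmap ((𝟙 _ ≫ (RMod.dualTensor (A := A) (B := B) V M).hom) ≫ 𝟙 _) ≫ 𝟙 _ ≫
        (RMod.dualTensor (RMod.dual V) (Bim.dual M)).inv ≫ 𝟙 _) ≫ 𝟙 _) ≫
          RMod.map (RMod.psiTensor V).inv (𝟙 (Bim.dual (Bim.dual M))) := by
      simp [RMod.dmap_id]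
    exact h
  coherence A := KVHom.hom_ext fun V => by
    refine (RMod.psiTensor_coherence (A := A) V).trans ?_
    have h : ∀ W : RMod A, RMod.dmap (RMod.psiTensor W).hom ≫ (RMod.dualTensor W (yBim A)).inv =
      𝟙 _ ≫ RMod.dmap (RMod.dmap (RMod.dmap (𝟙 W) ≫ 𝟙 _)) ≫ 𝟙 _ ≫ 𝟙 _ ≫ 𝟙 _ ≫
        RMod.dmap (((RMod.psiTensor W).hom ≫ 𝟙 _) ≫ 𝟙 _) ≫ (RMod.dualTensor W (yBim A)).inv :=
      fun W => by simp [RMod.dmap_id]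
    exact h V

end

/-! ### Functors between categories of modules are tensor products with bimodules -/

section

variable {k : Type u} [Field k]

namespace RMod

variable {A B : AlgFd k}

/-- The element `a` of the regular module. -/
def rel : A →ₗ[k] reg A := LinearMap.id

@[simp] theorem rel_act (a b : A) : (reg A).act (rel a) b = rel (a * b) := rfl

/-- The map `A ⟶ V`, `a ↦ va`. -/
def ofElem (V : RMod A) (v : V) : reg A ⟶ V :=
  ofLin (V := reg A) (V.act v) (fun a b => V.act_mul v a b)

/-- The underlying linear map of a morphism, as a linear map. -/
def linMap (V W : RMod A) : (V ⟶ W) →ₗ[k] V →ₗ[k] W where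
  toFun f := lin f
  map_add' _ _ := rfl
  map_smul' _ _ := rfl

theorem lin_ofElem (V : RMod A) (v : V) (a : A) : lin (ofElem V v) (rel a) = V.act v a := rfl

theorem ofElem_add (V : RMod A) (v w : V) : ofElem V (v + w) = ofElem V v + ofElem V w :=
  hom_ext (map_add V.act v w)

theorem ofElem_smul (V : RMod A) (c : k) (v : V) : ofElem V (c • v) = c • ofElem V v :=
  hom_ext (map_smul V.act c v)

theorem ofElem_act (V : RMod A) (v : V) (a : A) :
    ofElem V (V.act v a) = ofElem (reg A) (rel a) ≫ ofElem V v :=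
  hom_ext (LinearMap.ext fun b => (V.act_mul v a b).symm)

theorem ofElem_comp {V W : RMod A} (v : V) (f : V ⟶ W) :
    ofElem V v ≫ f = ofElem W (lin f v) :=
  hom_ext (LinearMap.ext fun a => lin_act f v a)

theorem ofElem_one : ofElem (reg A) (rel 1) = 𝟙 (reg A) :=
  hom_ext (LinearMap.ext fun a : A => one_mul a)

/-- An element of the dual as a morphism to the regular module. -/
def dualHom (V : RMod A) (f : V.dual) : V ⟶ reg A :=
  ofLin (W := reg A) (V.ev f) (fun v a => V.ev_act f v a)

theorem lin_dualHom (V : RMod A) (f : V.dual) (v : V) : lin (dualHom V f) v = rel (V.ev f v) := rfl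

/-- The element `1 ⊗ m` of `A ⊗_A M`. -/
def oneTmk (M : Bim A B) : M →ₗ[k] (reg A).tensor M := tmk (reg A) M (rel 1)

/-- The isomorphism `A ⊗_A M ≅ M` as a linear map. -/
def regTensor (M : Bim A B) : (reg A).tensor M →ₗ[k] M := Bim.lin (Bim.oneTensor M).hom

theorem regTensor_tmk (M : Bim A B) (a : A) (m : M) :
    regTensor M (tmk (reg A) M (rel a) m) = M.lact a m := Bim.oneTensor_hom_tmk M a m

@[simp] theorem regTensor_oneTmk (M : Bim A B) (m : M) : regTensor M (oneTmk M m) = m :=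
  (regTensor_tmk M 1 m).trans (M.one_lact m)

@[simp] theorem oneTmk_regTensor (M : Bim A B) (t : (reg A).tensor M) :
    oneTmk M (regTensor M t) = t :=
  LinearMap.congr_fun (congrArg Bim.lin (Bim.oneTensor M).hom_inv_id) t

theorem regTensor_act (M : Bim A B) (t : (reg A).tensor M) (b : B) :
    regTensor M (((reg A).tensor M).act t b) = M.act (regTensor M t) b :=
  Bim.lin_act (Bim.oneTensor M).hom t b

theorem map_ofElem_oneTmk (V : RMod A) (M : Bim A B) (v : V) (m : M) :
    lin (map (ofElem V v) (𝟙 M)) (oneTmk M m) = tmk V M v m := by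
  rw [oneTmk, map_tmk, lin_ofElem, V.act_one, Bim.lin_id, LinearMap.id_apply]

theorem regTensor_map (M : Bim A B) (a : A) (t : (reg A).tensor M) :
    regTensor M (lin (map (ofElem (reg A) (rel a)) (𝟙 M)) t) = M.lact a (regTensor M t) := by
  conv_lhs => rw [← oneTmk_regTensor M t]
  rw [map_ofElem_oneTmk, regTensor_tmk]

theorem map_oneTmk {M N : Bim A B} (g : M ⟶ N) (m : M) :
    lin (map (𝟙 (reg A)) g) (oneTmk M m) = oneTmk N (Bim.lin g m) := by
  rw [oneTmk, map_tmk, lin_id, LinearMap.id_apply, oneTmk]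

theorem tensorNat_injective {M N : Bim A B} {f g : M ⟶ N} (h : tensorNat f = tensorNat g) :
    f = g := by
  ext m
  have h' : map (𝟙 (reg A)) f = map (𝟙 (reg A)) g := congrArg (fun t => NatTrans.app t (reg A)) h
  rw [← regTensor_oneTmk N (Bim.lin f m), ← map_oneTmk, h', map_oneTmk, regTensor_oneTmk]

section

variable {M N : Bim A B} (τ : tensorFun M ⟶ tensorFun N)

/-- The component of a natural transformation at a module. -/
def natApp (V : RMod A) : V.tensor M ⟶ V.tensor N := τ.app V

theorem natApp_naturality {V W : RMod A} (f : V ⟶ W) (t : V.tensor M) :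
    lin (natApp τ W) (lin (map f (𝟙 M)) t) = lin (map f (𝟙 N)) (lin (natApp τ V) t) :=
  LinearMap.congr_fun (congrArg lin (τ.naturality f)) t

/-- The intertwiner inducing a natural transformation. -/
def ofTensorNat : M ⟶ N :=
  Bim.ofLin (regTensor N ∘ₗ lin (natApp τ (reg A)) ∘ₗ oneTmk M)
    (fun m b => by
      simp only [LinearMap.comp_apply]
      rw [← regTensor_act, ← lin_act]
      congr 2)
    (fun a m => by
      simp only [LinearMap.comp_apply]
      rw [← regTensor_map, ← natApp_naturality, map_ofElem_oneTmk]
      rw [oneTmk, ← tmk_act, rel_act, one_mul])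

theorem lin_ofTensorNat (m : M) :
    Bim.lin (ofTensorNat τ) m = regTensor N (lin (natApp τ (reg A)) (oneTmk M m)) := rfl

theorem tensorNat_ofTensorNat : tensorNat (ofTensorNat τ) = τ := by
  refine NatTrans.ext (funext fun V => ?_)
  change map (𝟙 V) (ofTensorNat τ) = natApp τ V
  ext v m
  rw [map_tmk, ← map_ofElem_oneTmk V M, natApp_naturality, ← map_ofElem_oneTmk V N,
    lin_ofTensorNat, oneTmk_regTensor]
  rfl

end

section

variable (F : RMod A ⥤ RMod B) [F.Additive] [F.Linear k]

/-- Left multiplication on `F(A)`. -/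
def wattsLact : A →ₗ[k] F.obj (reg A) →ₗ[k] F.obj (reg A) :=
  LinearMap.mk₂ k (fun a m => lin (F.map (ofElem (reg A) (rel a))) m)
    (fun a b m => by
      rw [map_add, ofElem_add, F.map_add, lin_add, LinearMap.add_apply])
    (fun c a m => by
      rw [map_smul, ofElem_smul, F.map_smul, lin_smul, LinearMap.smul_apply])
    (fun a m n => map_add _ m n)
    (fun c a m => map_smul _ c m)

theorem wattsLact_apply (a : A) (m : F.obj (reg A)) :
    wattsLact F a m = lin (F.map (ofElem (reg A) (rel a))) m := rfl

/-- The bimodule `F(A)` of a linear functor. -/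
def wattsBim : Bim A B where
  toRMod := F.obj (reg A)
  lact := wattsLact F
  one_lact m := by
    rw [wattsLact_apply, ofElem_one, F.map_id, lin_id, LinearMap.id_apply]
  mul_lact a b m := by
    rw [wattsLact_apply, ← rel_act, ofElem_act, F.map_comp]; rfl
  lact_act a m b := (lin_act (F.map (ofElem (reg A) (rel a))) m b).symm

/-- The identity, as a map to the bimodule `F(A)`. -/
def wel : F.obj (reg A) ≃ₗ[k] wattsBim F := LinearEquiv.refl k _

theorem wattsBim_lact (a : A) (m : F.obj (reg A)) :
    (wattsBim F).lact a (wel F m) = wel F (lin (F.map (ofElem (reg A) (rel a))) m) := rfl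

/-- The bilinear map `(v, m) ↦ F(a ↦ va)(m)`. -/
def wattsAux (V : RMod A) : V →ₗ[k] wattsBim F →ₗ[k] F.obj V :=
  LinearMap.mk₂ k (fun v m => lin (F.map (ofElem V v)) ((wel F).symm m))
    (fun a b m => by
      rw [ofElem_add, F.map_add]; rfl)
    (fun c a m => by
      rw [ofElem_smul, F.map_smul]; rfl)
    (fun a m n => by simp)
    (fun c a m => by simp)

@[simp] theorem wattsAux_apply (V : RMod A) (v : V) (m : F.obj (reg A)) :
    wattsAux F V v (wel F m) = lin (F.map (ofElem V v)) m := rfl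

/-- The map `V ⊗_A F(A) ⟶ F(V)`, `v ⊗ m ↦ F(a ↦ va)(m)`. -/
def wattsHom (V : RMod A) : V.tensor (wattsBim F) ⟶ F.obj V :=
  thom (wattsAux F V)
    (fun v a m => by
      obtain ⟨m, rfl⟩ := (wel F).surjective m
      rw [wattsBim_lact, wattsAux_apply, wattsAux_apply, ofElem_act, F.map_comp, lin_comp,
        LinearMap.comp_apply])
    (fun v m b => lin_act (F.map (ofElem V v)) m b)

theorem wattsHom_tmk (V : RMod A) (v : V) (m : F.obj (reg A)) :
    lin (wattsHom F V) (tmk V (wattsBim F) v (wel F m)) = lin (F.map (ofElem V v)) m :=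
  lin_thom_tmk (wattsAux F V) _ _ v (wel F m)

theorem wattsHom_naturality {V W : RMod A} (f : V ⟶ W) :
    map f (𝟙 (wattsBim F)) ≫ wattsHom F W = wattsHom F V ≫ F.map f := by
  ext v m
  obtain ⟨m, rfl⟩ := (wel F).surjective m
  rw [lin_comp, LinearMap.comp_apply, map_tmk, Bim.lin_id, LinearMap.id_apply, wattsHom_tmk,
    lin_comp, LinearMap.comp_apply, wattsHom_tmk, ← ofElem_comp, F.map_comp, lin_comp,
    LinearMap.comp_apply]

theorem sum_dualBasis {V : RMod A} {n : ℕ} {e : Fin n → V} {f : Fin n → V.dual}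
    (h : ∀ v, ∑ i, V.act (e i) (V.ev (f i) v) = v) :
    ∑ i, dualHom V (f i) ≫ ofElem V (e i) = 𝟙 V := by
  refine hom_ext (LinearMap.ext fun v => .trans ?_ (h v))
  change (linMap V V (∑ i, dualHom V (f i) ≫ ofElem V (e i))) v = _
  rw [map_sum, LinearMap.sum_apply]
  rfl

theorem wattsHom_bijective (V : RMod A) : Function.Bijective (lin (wattsHom F V)) := by
  obtain ⟨n, e, f, h⟩ := V.exists_dualBasis
  let q : F.obj V →ₗ[k] V.tensor (wattsBim F) :=
    ∑ i, tmk V (wattsBim F) (e i) ∘ₗ (wel F).toLinearMap ∘ₗ lin (F.map (dualHom V (f i)))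
  have hq : ∀ x, q x = ∑ i, tmk V (wattsBim F) (e i) (wel F (lin (F.map (dualHom V (f i))) x)) :=
    fun x => by simp [q]
  refine Function.bijective_iff_has_inverse.2 ⟨q, fun t => ?_, fun x => ?_⟩
  · refine LinearMap.congr_fun (f := q ∘ₗ lin (wattsHom F V)) (g := LinearMap.id)
      (tensor_ext fun v m => ?_) t
    obtain ⟨m, rfl⟩ := (wel F).surjective m
    rw [LinearMap.comp_apply, hq, wattsHom_tmk]
    have h1 : ∀ i, wel F (lin (F.map (dualHom V (f i))) (lin (F.map (ofElem V v)) m)) =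
        (wattsBim F).lact (V.ev (f i) v) (wel F m) := fun i => by
      rw [wattsBim_lact, ← lin_dualHom, ← ofElem_comp, F.map_comp, lin_comp, LinearMap.comp_apply]
    simp only [h1, ← tmk_act]
    conv_rhs => rw [← h v]
    simp
  · rw [hq, map_sum]
    simp only [wattsHom_tmk]
    have h1 := congrArg (fun t => linMap (F.obj V) (F.obj V) (F.map t) x) (sum_dualBasis h)
    simp only [F.map_sum, map_sum, LinearMap.sum_apply, F.map_comp, F.map_id] at h1
    exact h1

/-- A linear functor between module categories is the tensor product with a bimodule. -/
def wattsIso : tensorFun (wattsBim F) ≅ F :=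
  NatIso.ofComponents (fun V => isoOfBijective (wattsHom F V) (wattsHom_bijective F V))
    (fun f => wattsHom_naturality F f)

end

end RMod

variable [IsAlgClosed k]

theorem modRep_locallyEquiv (A B : AlgFd k) : ((modRep k).mapFunctor A B).IsEquivalence where
  faithful := ⟨fun h => RMod.tensorNat_injective h⟩
  full := ⟨fun τ => ⟨RMod.ofTensorNat τ, RMod.tensorNat_ofTensorNat τ⟩⟩
  essSurj := ⟨fun F => by
    let G : RMod A ⥤ RMod B := KVHom.functor F
    have : G.Additive := inferInstanceAs (KVHom.functor F).Additive
    have : G.Linear k := inferInstanceAs ((KVHom.functor F).Linear k)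
    exact ⟨RMod.wattsBim G, ⟨KVHom.ofNtIso (C := ModRep.obj A) (D := ModRep.obj B)
      (F := ModRep.map (A := A) (B := B) (RMod.wattsBim G)) (G := F) (RMod.wattsIso G)⟩⟩⟩

/-- The algebra `k^n`, with the factors presented as matrix algebras. -/
def AlgFd.pow (k : Type u) [Field k] (n : ℕ) : AlgFd k where
  carrier := ∀ _ : Fin n, Matrix (Fin 1) (Fin 1) k

theorem ModRep.exists_equivalence {A : AlgFd k} {n : ℕ} {d : Fin n → ℕ} [∀ i, NeZero (d i)]
    (f : A ≃ₐ[k] ∀ i, Matrix (Fin (d i)) (Fin (d i)) k) {C : KV k} (e : C.carrier ≌ VectPow k n)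
    [e.functor.Additive] [e.functor.Linear k] :
    Nonempty (Bicategory.Equivalence (ModRep.obj A) C) := by
  let t : RMod A ⥤ VectPow k n := RMod.toPow f
  have : t.IsEquivalence := { }
  have : e.inverse.Linear k := e.inverseLinear k
  let G : (ModRep.obj A).carrier ⥤ C.carrier := t ⋙ e.inverse
  have : G.Additive := inferInstanceAs (t ⋙ e.inverse).Additive
  have : G.Linear k := inferInstanceAs ((t ⋙ e.inverse).Linear k)
  let H : ModRep.obj A ⟶ C := KVHom.mk' (C := ModRep.obj A) (D := C) G
  have : (KVHom.functor H).IsEquivalence := inferInstanceAs (t ⋙ e.inverse).IsEquivalence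
  exact ⟨(KV.exists_equivalence_of_isEquivalence H).choose⟩

theorem modRep_essSurj (C : KV k) :
    ∃ A : AlgFd k, Nonempty (Bicategory.Equivalence ((modRep k).obj A) C) := by
  obtain ⟨n, e, h1, h2⟩ := C.isKV
  have : ∀ i : Fin n, NeZero ((fun _ : Fin n => 1) i) := fun _ => inferInstanceAs (NeZero 1)
  exact ⟨AlgFd.pow k n, ModRep.exists_equivalence (A := AlgFd.pow k n)
    (d := fun _ : Fin n => 1) AlgEquiv.refl e⟩

end

end

theorem theorem6p3 (k : Type u) [Field k] [IsAlgClosed k] [CharZero k] :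
    (algDuality k).IsWeakDualityInvolution ∧
      (kvDuality k).IsStrictDualityInvolution ∧
      (repDuality k).IsDualityPseudofunctor ∧
      IsBiequivalence (modRep k) :=
  ⟨algDuality_isWeakDualityInvolution k, kvDuality_isStrictDualityInvolution k,
    repDuality_isDualityPseudofunctor k, modRep_essSurj, modRep_locallyEquiv⟩
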